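/- **Proposition 3.3.** Let $u:[0,\infty)\to\mathbb R$ be continuous with $\int_0^\infty(1+x^2)|u(x)|\,dx<\infty$. For $x\ge 0$ let $\psi(x,k)$ ($\operatorname{Im}k\ge0$, with $\psi(x,k)e^{-ikx}$ bounded in $x$) and $\phi(x,k)$ ($k\in\mathbb C$) be the continuous solutions of $$\psi(x,k)=e^{ikx}+\int_x^\infty\frac{\sin k(x-\xi)}{k}u(\xi)\psi(\xi,k)\,d\xi,\qquad \phi(x,k)=e^{-ikx}-\int_0^x\frac{\sin k(x-\xi)}{k}u(\xi)\phi(\xi,k)\,d\xi ,$$ where $\sin(kt)/k$ means $t$ at $k=0$, and let $a(k)=\frac{1}{2ik}(\phi\psi_x-\psi\phi_x)$ (independent of $x$; evaluated at $x=0$). Assume that $a(k)\ne0$ for all $k\neq 0$ with $\operatorname{Im}k\ge0$. Let $\gamma_1<0$, $\gamma_2\in\mathbb R$, and let $q(x,y)$ be a real-valued function on the closed quarter plane $x,y\ge 0$ that is $C^2$ for $x,y>0$, is $C^1$ up to the boundary, satisfies, for some $C,\varepsilon>0$, the bound $|q|,|q_x|,|q_y|\le C(1+x+y)^{-1-\varepsilon}$,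 and solves the Poincaré problem with $\beta=0$: $$q_{xx}+q_{yy}+u(x)q=0\quad(x,y>0),\qquad q_y(x,0)+\gamma_1q(x,0)=f(x)\quad(x>0),\qquad q_x(0,y)+\gamma_2q(0,y)=g(y)\quad(y>0).$$ Define, in terms of the data $f,g$ (and $u,\gamma_1,\gamma_2$) only, $$N(k)=-\frac{\psi(0,k)\int_0^\infty f(x)\phi(x,k)\,dx-\phi(0,k)\int_0^\infty f(x)\psi(x,k)\,dx}{i\,a(k)(k-\gamma_1)\psi(0,k)},\qquad D(k)=\psi_x(0,k)+\gamma_2\psi(0,k),$$ $$H(k)=\int_0^\infty f(x)\psi(x,k)\,dx+\psi(0,k)\int_0^\infty e^{ky}g(y)\,dy,\qquad F(k)=\frac{(k-\gamma_1)H(k)+(k+\gamma_1)\overline{H(-\bar k)}}{(k-\gamma_1)D(k)}$$ (on the positive imaginary axis $F$ is given by this formula wherever $D(k)\neq0$; its value at zeros of $D$ is irrelevant). Then, for all $x,y>0$, $$q(x,y)=\frac1{2i\pi}\left\{\int_\infty^0e^{-ky}\psi(x,k)N(k)\,dk+\int_0^{i\infty}e^{-ky}\psi(x,k)\frac{F(k)}{\psi(0,k)}\,dk\right\}$$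 $$\qquad+\frac1{2i\pi}\left\{\int_{-\infty}^0e^{ky}\psi(x,k)\overline{N(-\bar k)}\,dk+\int_0^{i\infty}e^{ky}\psi(x,k)\frac{k-\gamma_1}{k+\gamma_1}\frac{F(k)}{\psi(0,k)}\,dk\right\},$$ all four integrals converging absolutely. Moreover, with $g_0(k)=\int_0^\infty e^{ky}q(0,y)\,dy$ ($\operatorname{Re}k\le0$) and with $\partial D_1$, $\partial D_2$ the boundaries of the first and second quadrants of the complex $k$-plane, for all $x,y>0$ each of the contour integrals $$\int_{\partial D_1}e^{-ky}\psi(x,k)\frac{g_0(-k)}{\psi(0,k)}\frac{k+\gamma_1}{k-\gamma_1}\,dk,\qquad \int_{\partial D_2}e^{ky}\psi(x,k)\frac{g_0(k)}{\psi(0,k)}\frac{k-\gamma_1}{k+\gamma_1}\,dk$$ converges absolutely and equals zero. -/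

import Mathlib

open Set MeasureTheory
open scoped ComplexConjugate

noncomputable section

namespace GenLaplace

/-! ### Eigenfunctions of `χ'' + (u + k²) χ = 0` on the half line -/

/-- The kernel `sin (k t) / k`, with its limiting value `t` at `k = 0`. -/
def sinKernel (k : ℂ) (t : ℝ) : ℂ :=
  if k = 0 then (t : ℂ) else Complex.sin (k * t) / k

/-- `χ` is the solution on `[0, ∞)`, normalised at infinity, of the Volterra equation
`χ(x) = e^{ikx} + ∫_x^∞ (sin k(x-ξ) / k) u(ξ) χ(ξ) dξ`; here `Im k ≥ 0`. Boundedness of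
`χ(x) e^{-ikx}` makes the integral converge absolutely and the solution unique on `[0, ∞)`. -/
structure IsPsi (u : ℝ → ℝ) (k : ℂ) (χ : ℝ → ℂ) : Prop where
  continuousOn : ContinuousOn χ (Ici 0)
  bounded : ∃ C : ℝ, ∀ x : ℝ, 0 ≤ x → ‖χ x * Complex.exp (-(Complex.I * k * x))‖ ≤ C
  eqn : ∀ x : ℝ, 0 ≤ x →
    χ x = Complex.exp (Complex.I * k * x)
      + ∫ ξ in Ioi x, sinKernel k (x - ξ) * (u ξ : ℂ) * χ ξ

/-- `χ` is the solution on `[0, ∞)` of the Volterra equation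
`χ(x) = e^{-ikx} - ∫_0^x (sin k(x-ξ) / k) u(ξ) χ(ξ) dξ`. -/
structure IsPhi (u : ℝ → ℝ) (k : ℂ) (χ : ℝ → ℂ) : Prop where
  continuousOn : ContinuousOn χ (Ici 0)
  eqn : ∀ x : ℝ, 0 ≤ x →
    χ x = Complex.exp (-(Complex.I * k * x))
      - ∫ ξ in (0 : ℝ)..x, sinKernel k (x - ξ) * (u ξ : ℂ) * χ ξ

open Classical in
/-- `ψ(x,k)`: the solution of the Volterra equation from infinity (used for `x ≥ 0`, `Im k ≥ 0`). -/
def psi (u : ℝ → ℝ) (x : ℝ) (k : ℂ) : ℂ :=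
  if h : ∃ χ, IsPsi u k χ then h.choose x else 0

open Classical in
/-- `φ(x,k)`: the solution of the Volterra equation from the origin (used for `x ≥ 0`). -/
def phi (u : ℝ → ℝ) (x : ℝ) (k : ℂ) : ℂ :=
  if h : ∃ χ, IsPhi u k χ then h.choose x else 0

/-- `ψ_x(0,k)`, the one-sided derivative at the end point. -/
def psiX0 (u : ℝ → ℝ) (k : ℂ) : ℂ := derivWithin (fun x => psi u x k) (Ici 0) 0

/-- `φ_x(0,k)`, the one-sided derivative at the end point. -/
def phiX0 (u : ℝ → ℝ) (k : ℂ) : ℂ := derivWithin (fun x => phi u x k) (Ici 0) 0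

/-- `a(k) = (φ ψ_x - ψ φ_x) / (2ik)`; the Wronskian does not depend on `x`, and it is
evaluated at `x = 0`. -/
def specA (u : ℝ → ℝ) (k : ℂ) : ℂ :=
  (phi u 0 k * psiX0 u k - psi u 0 k * phiX0 u k) / (2 * Complex.I * k)

/-! ### The boundary value problem -/

/-- `q_x`, one-sided on the boundary `x = 0`. -/
def partialX (q : ℝ → ℝ → ℝ) (x y : ℝ) : ℝ := derivWithin (fun s => q s y) (Ici 0) x

/-- `q_y`, one-sided on the boundary `y = 0`. -/
def partialY (q : ℝ → ℝ → ℝ) (x y : ℝ) : ℝ := derivWithin (fun t => q x t) (Ici 0) y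

/-- A classical solution of `q_xx + q_yy + u(x) q = 0` in the quarter plane, continuously
differentiable up to the boundary, with the Poincaré conditions
`q_y + γ₁ q = f` on `y = 0` and `q_x + β q_y + γ₂ q = g` on `x = 0`. -/
structure IsPoincareSolution (u f g : ℝ → ℝ) (β γ₁ γ₂ : ℝ) (q : ℝ → ℝ → ℝ) : Prop where
  contDiff_closed : ContDiffOn ℝ 1 (fun p : ℝ × ℝ => q p.1 p.2) (Ici 0 ×ˢ Ici 0)
  contDiff_open : ContDiffOn ℝ 2 (fun p : ℝ × ℝ => q p.1 p.2) (Ioi 0 ×ˢ Ioi 0)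
  pde : ∀ x y : ℝ, 0 < x → 0 < y →
    deriv (deriv fun s => q s y) x + deriv (deriv fun t => q x t) y + u x * q x y = 0
  bc_bottom : ∀ x : ℝ, 0 < x → partialY q x 0 + γ₁ * q x 0 = f x
  bc_left : ∀ y : ℝ, 0 < y →
    partialX q 0 y + β * partialY q 0 y + γ₂ * q 0 y = g y

/-- `q`, `q_x`, `q_y` are `O((1 + x + y)^{-1-ε})` in the closed quarter plane, for some `ε > 0`. -/
def HasDecay (q : ℝ → ℝ → ℝ) : Prop :=
  ∃ C ε : ℝ, 0 < ε ∧ ∀ x y : ℝ, 0 ≤ x → 0 ≤ y →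
    |q x y| ≤ C * (1 + x + y) ^ (-(1 + ε)) ∧
    |partialX q x y| ≤ C * (1 + x + y) ^ (-(1 + ε)) ∧
    |partialY q x y| ≤ C * (1 + x + y) ^ (-(1 + ε))

/-! ### Spectral functions of the data -/

/-- `D(k) = ψ_x(0,k) + (γ₂ - β k) ψ(0,k)`. -/
def specD (u : ℝ → ℝ) (β γ₂ : ℝ) (k : ℂ) : ℂ :=
  psiX0 u k + ((γ₂ : ℂ) - β * k) * psi u 0 k

/-- `H(k) = ∫_0^∞ f(x) ψ(x,k) dx + ψ(0,k) ∫_0^∞ e^{ky} g(y) dy`. -/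
def specH (u f g : ℝ → ℝ) (k : ℂ) : ℂ :=
  (∫ x in Ioi (0 : ℝ), (f x : ℂ) * psi u x k)
    + psi u 0 k * ∫ y in Ioi (0 : ℝ), Complex.exp (k * y) * (g y : ℂ)

/-- `F(k) = ((k - γ₁) H(k) + (k + γ₁) conj H(-conj k)) / ((k - γ₁) D(k))`. -/
def specF (u f g : ℝ → ℝ) (β γ₁ γ₂ : ℝ) (k : ℂ) : ℂ :=
  ((k - γ₁) * specH u f g k + (k + γ₁) * conj (specH u f g (-conj k)))
    / ((k - γ₁) * specD u β γ₂ k)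

/-- `N(k) = -(ψ(0,k) ∫ f φ dx - φ(0,k) ∫ f ψ dx) / (i a(k) (k - γ₁) ψ(0,k))`. -/
def specN (u f : ℝ → ℝ) (γ₁ : ℝ) (k : ℂ) : ℂ :=
  -(psi u 0 k * (∫ x in Ioi (0 : ℝ), (f x : ℂ) * phi u x k)
      - phi u 0 k * ∫ x in Ioi (0 : ℝ), (f x : ℂ) * psi u x k)
    / (Complex.I * specA u k * (k - γ₁) * psi u 0 k)

/-- `g₀(k) = ∫_0^∞ e^{ky} q(0,y) dy`. -/
def g0 (q : ℝ → ℝ → ℝ) (k : ℂ) : ℂ :=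
  ∫ y in Ioi (0 : ℝ), Complex.exp (k * y) * (q 0 y : ℂ)

/-! ### Integrals along rays in the complex plane -/

/-- Absolute convergence of the integral of `h` along the ray `{t ω : t > 0}`. -/
def RayIntegrable (ω : ℂ) (h : ℂ → ℂ) : Prop :=
  IntegrableOn (fun t : ℝ => h (t * ω)) (Ioi 0)

/-- The integral of `h(k) dk` along the ray from `0` to `∞ ω`. -/
def rayIntegral (ω : ℂ) (h : ℂ → ℂ) : ℂ :=
  ω * ∫ t in Ioi (0 : ℝ), h (t * ω)

/-- The integrand of the first leftover contour term. -/
def leftover1 (u : ℝ → ℝ) (γ₁ : ℝ) (q : ℝ → ℝ → ℝ) (x y : ℝ) (k : ℂ) : ℂ :=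
  Complex.exp (-(k * y)) * psi u x k * (g0 q (-k) / psi u 0 k) * ((k + γ₁) / (k - γ₁))

/-- The integrand of the second leftover contour term. -/
def leftover2 (u : ℝ → ℝ) (γ₁ : ℝ) (q : ℝ → ℝ → ℝ) (x y : ℝ) (k : ℂ) : ℂ :=
  Complex.exp (k * y) * psi u x k * (g0 q k / psi u 0 k) * ((k - γ₁) / (k + γ₁))

/-- First integrand of the solution formula: `e^{-ky} ψ(x,k) N(k)`. -/
def term1 (u f : ℝ → ℝ) (γ₁ : ℝ) (x y : ℝ) (k : ℂ) : ℂ :=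
  Complex.exp (-(k * y)) * psi u x k * specN u f γ₁ k

/-- Second integrand: `e^{-ky} ψ(x,k) F(k) / ψ(0,k)`. -/
def term2 (u f g : ℝ → ℝ) (β γ₁ γ₂ : ℝ) (x y : ℝ) (k : ℂ) : ℂ :=
  Complex.exp (-(k * y)) * psi u x k * (specF u f g β γ₁ γ₂ k / psi u 0 k)

/-- Third integrand: `e^{ky} ψ(x,k) conj N(-conj k)`. -/
def term3 (u f : ℝ → ℝ) (γ₁ : ℝ) (x y : ℝ) (k : ℂ) : ℂ :=
  Complex.exp (k * y) * psi u x k * conj (specN u f γ₁ (-conj k))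

/-- Fourth integrand: `e^{ky} ψ(x,k) ((k-γ₁)/(k+γ₁)) F(k) / ψ(0,k)`. -/
def term4 (u f g : ℝ → ℝ) (β γ₁ γ₂ : ℝ) (x y : ℝ) (k : ℂ) : ℂ :=
  Complex.exp (k * y) * psi u x k * ((k - γ₁) / (k + γ₁))
    * (specF u f g β γ₁ γ₂ k / psi u 0 k)

end GenLaplace

end

open GenLaplace

open Filter Topology
open scoped BoundedContinuousFunction

/-! ### Holomorphic dependence of integrals on a parameter -/

/-! The formula is the Dirichlet eigenfunction expansion of `q(·, y)`, with contours rotated until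
only the data occur.

Inversion. For real `t` let `s(ξ,t) = Im (ψ(ξ,t) conj ψ(0,t))`, the solution with `s = 0`, `s_x = t`
at the origin. For `h` of class C¹ with `h`, `h'` integrable and `h` vanishing at infinity, `(π/2)
h(x)` is the limit of `∫_0^R Im (ψ(x,t)/ψ(0,t)) ∫ s(ξ,t) h(ξ) dξ dt`
(`IsPotential.tendsto_sine_inversion`). To see this, integrate `k ∫ G(x,ξ,k) h(ξ) dξ`, with `G` the
Dirichlet Green function, around a large square in the first quadrant. On the real axis its
imaginary part is the integrand above, on the imaginary axis it is purely imaginary, and `k² ∫ G h →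
-h(x)` handles the far sides. Holomorphy requires `ψ(0,k) ≠ 0` in the closed upper half plane
(`IsPotential.psi_zero_ne_zero`). Off the axes this is the symmetry of the Dirichlet operator, on
the real axis away from 0 it is the Wronskian of `ψ` and `conj ψ`, and on the imaginary axis, 0
included, it is a Sturm comparison based on `a(k) ≠ 0`.

Transform of the problem. By Green's identity `P(y) = ∫ s q(x,y) dx` satisfies `P'' = t² P - t
q(0,y)`. Solving this with decay at infinity and the condition on `y = 0` gives `2P = ∫ e^{-t|η-y|}
q(0,η) dη - e^{-ty} (ψ(0,t) N(t) - g₀(-t)(t+γ₁)/(t-γ₁))`; see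
`IsDecayingSolution.two_mul_sine_transform` and `IsPotential.specN_eq`. Insertion in the inversion
formula writes `π q` as the imaginary part of three integrals over the positive axis.

Rotation. The `N` integral stays. The other two integrands are holomorphic in the first quadrant,
are `O(1/|k|)` and carry `e^{-x Im k}`, so a Jordan lemma on squares
(`tendsto_integral_bottom_sub_left`) moves them to the positive imaginary axis. For the `g₀(-k)`
term this is already the vanishing of the leftover integral. In the other one `ψ(x,k)/ψ(0,k)` is
real on the imaginary axis, and since cosine is even the kernel `e^{-k|η-y|}` has the same real part
there as `e^{k(η-y)}`, whose integral is `e^{-ky} g₀(k)`.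

Elimination. What remains is `g₀(k) + g₀(-k)(k+γ₁)/(k-γ₁)` for `k = it`. The transformed equation at
`y = 0`, with `ψ(·,it)` in place of `s`, gives one relation for `k` and one for `-k`; eliminating
the unknown `∫ ψ q(x,0) dx` identifies the sum with `F(k)` wherever `D(k) ≠ 0`
(`IsDecayingSolution.specF_eq`). The zeros of `D` are isolated, so almost everywhere suffices. Hence
`π q = Re ∫ term2 - Im ∫ term1`. The reflection `k ↦ -conj k` shows that the second brace of the
formula is the conjugate of the first, and likewise settles the second leftover integral. -/

theorem differentiableOn_integral_of_dominated {μ : Measure ℝ} {U : Set ℂ} (hU : IsOpen U)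
    {F : ℂ → ℝ → ℂ} {bound : ℝ → ℝ} (hmeas : ∀ k ∈ U, AEStronglyMeasurable (F k) μ)
    (hbound : ∀ᵐ ξ ∂μ, ∀ k ∈ U, ‖F k ξ‖ ≤ bound ξ) (hint : Integrable bound μ)
    (hdiff : ∀ᵐ ξ ∂μ, DifferentiableOn ℂ (fun k => F k ξ) U) :
    DifferentiableOn ℂ (fun k => ∫ ξ, F k ξ ∂μ) U := by
  intro k₀ hk₀
  obtain ⟨r, hr, hball⟩ := Metric.isOpen_iff.1 hU k₀ hk₀
  have hr2 : 0 < r / 2 := by positivity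
  have hsub : ∀ k ∈ Metric.ball k₀ (r / 2), Metric.closedBall k (r / 3) ⊆ U := by
    intro k hk z hz
    apply hball
    rw [Metric.mem_ball] at hk ⊢
    rw [Metric.mem_closedBall] at hz
    have := dist_triangle z k k₀
    linarith
  have hmem : ∀ k ∈ Metric.ball k₀ (r / 2), k ∈ U := fun k hk =>
    hsub k hk (Metric.mem_closedBall_self (by positivity))
  have hk₀' : k₀ ∈ Metric.ball k₀ (r / 2) := Metric.mem_ball_self hr2
  have hderiv : ∀ᵐ ξ ∂μ, ∀ k ∈ Metric.ball k₀ (r / 2),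
      HasDerivAt (fun k => F k ξ) (deriv (fun k => F k ξ) k) k := by
    filter_upwards [hdiff] with ξ h k hk
    exact (h.differentiableAt (hU.mem_nhds (hmem k hk))).hasDerivAt
  -- Measurability of the derivative in `ξ`: it is an almost everywhere limit of difference
  -- quotients along a sequence in `U` tending to `k₀`.
  have hF' : AEStronglyMeasurable (fun ξ => deriv (fun k => F k ξ) k₀) μ := by
    have hseq : Tendsto (fun n : ℕ => k₀ + ((r / 2 / ((n : ℝ) + 2) : ℝ) : ℂ)) atTop (𝓝[≠] k₀) := by
      apply tendsto_nhdsWithin_of_tendsto_nhds_of_eventually_within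
      · have : Tendsto (fun n : ℕ => r / 2 / ((n : ℝ) + 2)) atTop (𝓝 0) := by
          apply Tendsto.div_atTop tendsto_const_nhds
          exact tendsto_atTop_add_const_right _ _ tendsto_natCast_atTop_atTop
        have h2 := (Complex.continuous_ofReal.tendsto 0).comp this
        simpa using h2.const_add k₀
      · refine Eventually.of_forall fun n => ?_
        have : (r / 2 / ((n : ℝ) + 2) : ℝ) ≠ 0 := by positivity
        rw [mem_compl_singleton_iff, Ne, add_eq_left, Complex.ofReal_eq_zero]
        exact this
    have hin : ∀ n : ℕ, k₀ + ((r / 2 / ((n : ℝ) + 2) : ℝ) : ℂ) ∈ U := by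
      intro n
      apply hmem
      rw [Metric.mem_ball, dist_eq_norm, add_sub_cancel_left, Complex.norm_real,
        Real.norm_of_nonneg (by positivity)]
      rw [div_lt_iff₀ (by positivity)]
      nlinarith [hr2, (Nat.cast_nonneg n : (0 : ℝ) ≤ n)]
    refine aestronglyMeasurable_of_tendsto_ae atTop (f := fun (n : ℕ) ξ =>
      slope (fun k => F k ξ) k₀ (k₀ + ((r / 2 / ((n : ℝ) + 2) : ℝ) : ℂ))) (fun n => ?_) ?_
    · simp only [slope_def_field]
      exact ((hmeas _ (hin n)).sub (hmeas _ hk₀)).mul_const _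
    · filter_upwards [hderiv] with ξ h
      exact (hasDerivAt_iff_tendsto_slope.1 (h k₀ hk₀')).comp hseq
  -- No bound on the derivative is assumed. Cauchy's estimate on circles of radius `r / 3` supplies
  -- `bound ξ / (r / 3)`, and `r / 2 + r / 3 < r` keeps these circles inside `U`.
  have := (hasDerivAt_integral_of_dominated_loc_of_deriv_le (μ := μ) (F := F)
    (F' := fun k ξ => deriv (fun k => F k ξ) k) (bound := fun ξ => bound ξ / (r / 3))
    (Metric.ball_mem_nhds k₀ hr2) ?_ ?_ hF' ?_ (hint.div_const _) ?_).2
  · exact this.differentiableAt.differentiableWithinAt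
  · filter_upwards [Metric.ball_mem_nhds k₀ hr2] with k hk using hmeas k (hmem k hk)
  · refine hint.mono' (hmeas k₀ hk₀) ?_
    filter_upwards [hbound] with ξ h using h k₀ hk₀
  · filter_upwards [hbound, hdiff] with ξ hb hd k hk
    apply Complex.norm_deriv_le_of_forall_mem_sphere_norm_le (by positivity)
    · apply DifferentiableOn.diffContOnCl
      apply hd.mono
      exact (Metric.closure_ball_subset_closedBall).trans (hsub k hk)
    · intro z hz
      exact hb z (hsub k hk (Metric.sphere_subset_closedBall hz))
  · exact hderiv

/-! ### The kernel `(e^{2ikt} - 1) / (2ik)` -/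

/-- The kernel `(e^{2ikt} - 1) / (2ik)`, extended analytically to `k = 0`. -/
noncomputable def expKernel (t : ℝ) (k : ℂ) : ℂ :=
  t * dslope Complex.exp 0 (2 * Complex.I * k * t)

theorem differentiable_dslope_exp : Differentiable ℂ (dslope Complex.exp 0) := by
  have h : DifferentiableOn ℂ (dslope Complex.exp 0) univ :=
    (Complex.differentiableOn_dslope Filter.univ_mem).2
      Complex.differentiable_exp.differentiableOn
  exact differentiableOn_univ.1 h

theorem continuous_expKernel : Continuous fun p : ℝ × ℂ => expKernel p.1 p.2 := by
  unfold expKernel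
  have := differentiable_dslope_exp.continuous
  fun_prop

theorem differentiable_expKernel (t : ℝ) : Differentiable ℂ (expKernel t) := by
  unfold expKernel
  have := differentiable_dslope_exp
  fun_prop

theorem mul_expKernel (t : ℝ) (k : ℂ) :
    2 * Complex.I * k * expKernel t k = Complex.exp (2 * Complex.I * k * t) - 1 := by
  have := sub_smul_dslope Complex.exp 0 (2 * Complex.I * k * t)
  simp only [sub_zero, smul_eq_mul, Complex.exp_zero] at this
  rw [← this, expKernel]; ring

@[simp] theorem expKernel_zero_left (k : ℂ) : expKernel 0 k = 0 := by simp [expKernel]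

theorem expKernel_zero_right (t : ℝ) : expKernel t 0 = t := by
  simp [expKernel, dslope_same]

/-- Mean value inequality on the convex left half plane, where the derivative of `exp` has norm at
most one. -/
theorem norm_exp_sub_one_le_of_re_nonpos {z : ℂ} (hz : z.re ≤ 0) :
    ‖Complex.exp z - 1‖ ≤ ‖z‖ := by
  have hconv : Convex ℝ {w : ℂ | w.re ≤ 0} := convex_halfSpace_re_le 0
  have := hconv.norm_image_sub_le_of_norm_hasDerivWithin_le (f := Complex.exp)
    (f' := Complex.exp) (C := 1) (x := 0) (y := z)
    (fun w _ => (Complex.hasDerivAt_exp w).hasDerivWithinAt)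
    (fun w hw => by rw [Complex.norm_exp]; exact Real.exp_le_one_iff.2 hw) (by simp) hz
  simpa using this

theorem re_two_I_mul (k : ℂ) (t : ℝ) : (2 * Complex.I * k * t).re = -(2 * k.im * t) := by
  simp

/-- This bound is uniform in `k` and survives at `k = 0`. Its price is the factor `t`, which is why
the potential needs a finite first moment. -/
theorem norm_expKernel_le {t : ℝ} {k : ℂ} (ht : 0 ≤ t) (hk : 0 ≤ k.im) :
    ‖expKernel t k‖ ≤ t := by
  by_cases h0 : k = 0
  · subst h0; rw [expKernel_zero_right, Complex.norm_real, Real.norm_of_nonneg ht]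
  have h := congrArg norm (mul_expKernel t k)
  have h2 := norm_exp_sub_one_le_of_re_nonpos (z := 2 * Complex.I * k * t)
    (by rw [re_two_I_mul]; have := mul_nonneg hk ht; linarith)
  rw [← h] at h2
  simp only [norm_mul, Complex.norm_real, Real.norm_of_nonneg ht] at h2
  exact le_of_mul_le_mul_left h2 (by simpa using h0)

/-- The factor `t` is traded for a gain `1 / ‖k‖`; the asymptotics for large `k` rest on this. -/
theorem norm_mul_norm_expKernel_le {t : ℝ} {k : ℂ} (ht : 0 ≤ t) (hk : 0 ≤ k.im) :
    ‖k‖ * ‖expKernel t k‖ ≤ 1 := by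
  have h := congrArg norm (mul_expKernel t k)
  have h2 : ‖Complex.exp (2 * Complex.I * k * t) - 1‖ ≤ 2 := by
    refine (norm_sub_le _ _).trans ?_
    rw [Complex.norm_exp, re_two_I_mul, norm_one]
    have : Real.exp (-(2 * k.im * t)) ≤ 1 :=
      Real.exp_le_one_iff.2 (by have := mul_nonneg hk ht; linarith)
    linarith
  rw [← h] at h2
  simp only [norm_mul, Complex.norm_I, Complex.norm_ofNat] at h2
  linarith

theorem hasDerivAt_expKernel (t : ℝ) (k : ℂ) :
    HasDerivAt (fun t => expKernel t k) (Complex.exp (2 * Complex.I * k * t)) t := by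
  by_cases h0 : k = 0
  · subst h0
    simp only [expKernel_zero_right, mul_zero, zero_mul, Complex.exp_zero]
    exact Complex.ofRealCLM.hasDerivAt
  have hne : 2 * Complex.I * k ≠ 0 := by simp [h0]
  have heq : (fun t : ℝ => expKernel t k)
      = fun t : ℝ => (Complex.exp (2 * Complex.I * k * t) - 1) / (2 * Complex.I * k) := by
    funext t
    rw [eq_div_iff hne, ← mul_expKernel]; ring
  rw [heq]
  have h1 : HasDerivAt (fun t : ℝ => 2 * Complex.I * k * (t : ℂ)) (2 * Complex.I * k) t := by
    simpa using (Complex.ofRealCLM.hasDerivAt (x := t)).const_mul (2 * Complex.I * k)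
  have h2 := ((h1.cexp).sub_const 1).div_const (2 * Complex.I * k)
  rwa [mul_div_cancel_right₀ _ hne] at h2

/-- Splitting off the exponential leaves a kernel bounded for `t ≥ 0` in the closed upper half
plane, so the equations for `e^{-ikx} ψ` and `e^{ikx} φ` have controlled kernels up to the real
axis. -/
theorem sinKernel_eq (k : ℂ) (t : ℝ) :
    sinKernel k t = Complex.exp (-(Complex.I * k * t)) * expKernel t k := by
  unfold sinKernel
  split_ifs with h0
  · subst h0; simp [expKernel_zero_right]
  · rw [div_eq_iff h0]
    have h := mul_expKernel t k
    have h3 : Complex.exp (-(Complex.I * k * t)) * expKernel t k * k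
        = Complex.exp (-(Complex.I * k * t)) * (Complex.exp (2 * Complex.I * k * t) - 1)
          / (2 * Complex.I) := by
      rw [← h]; field_simp
    rw [h3, mul_sub, ← Complex.exp_add, Complex.sin, eq_div_iff (by simp)]
    have e1 : -(Complex.I * k * t) + 2 * Complex.I * k * t = k * t * Complex.I := by ring
    have e2 : -(Complex.I * k * (t : ℂ)) = -(k * t) * Complex.I := by ring
    rw [e1, e2]
    linear_combination (Complex.exp (-(k * t) * Complex.I) - Complex.exp (k * t * Complex.I))
      * Complex.I_mul_I

theorem sinKernel_neg (k : ℂ) (t : ℝ) : sinKernel k (-t) = -sinKernel k t := by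
  unfold sinKernel
  split_ifs <;> simp [neg_div]

/-! ### Volterra equations depending on a spectral parameter -/

/-- A kernel on the half line, depending continuously on the parameters and analytically on
`k` in the upper half plane, that contracts by `1/2` in the norm with weight `θ`. -/
structure IsContractiveKernel (κ : ℝ → ℝ → ℂ → ℂ) (w θ : ℝ → ℝ) (Θ : ℝ) : Prop where
  cont : ∀ ξ, Continuous fun p : ℝ × ℂ => κ p.1 ξ p.2
  meas : ∀ x k, AEStronglyMeasurable (fun ξ => κ x ξ k) (volume.restrict (Ioi 0))
  bound : ∀ x ξ k, 0 < ξ → ‖κ x ξ k‖ ≤ w ξ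
  integrable : IntegrableOn w (Ioi 0)
  weight_cont : Continuous θ
  one_le : ∀ x, 1 ≤ θ x
  le : ∀ x, θ x ≤ Θ
  contract : ∀ x k, ∫ ξ in Ioi (0 : ℝ), ‖κ x ξ k‖ * θ ξ ≤ θ x / 2
  hol : ∀ x ξ, DifferentiableOn ℂ (κ x ξ) {k | 0 < k.im}

namespace IsContractiveKernel

variable {κ : ℝ → ℝ → ℂ → ℂ} {w θ : ℝ → ℝ} {Θ : ℝ}

/-- Let `S` be the supremum of `‖d‖ / θ`, finite because `d` is bounded. Inserting `‖d‖ ≤ S θ` under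
the integral and using `contract` gives `S ≤ S / 2`, hence `S = 0`. -/
theorem eq_zero_of_le (h : IsContractiveKernel κ w θ Θ) {k : ℂ} {d : ℝ → ℂ} {C : ℝ}
    (hd : ∀ x, 0 ≤ x → ‖d x‖ ≤ C)
    (hle : ∀ x, 0 ≤ x → ‖d x‖ ≤ ∫ ξ in Ioi (0 : ℝ), ‖κ x ξ k‖ * ‖d ξ‖) :
    ∀ x, 0 ≤ x → d x = 0 := by
  have hθ : ∀ x, 0 < θ x := fun x => one_pos.trans_le (h.one_le x)
  have hC : 0 ≤ C := (norm_nonneg _).trans (hd 0 le_rfl)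
  set A : Set ℝ := (fun x => ‖d x‖ / θ x) '' Ici 0
  have hA : BddAbove A := by
    refine ⟨C, ?_⟩
    rintro _ ⟨x, hx, rfl⟩
    exact (div_le_self (norm_nonneg _) (h.one_le x)).trans (hd x hx)
  have hle' : ∀ x, 0 ≤ x → ‖d x‖ ≤ sSup A * θ x := fun x hx =>
    (div_le_iff₀ (hθ x)).1 (le_csSup hA ⟨x, hx, rfl⟩)
  have hS : 0 ≤ sSup A := Real.sSup_nonneg (by
    rintro _ ⟨x, hx, rfl⟩
    exact div_nonneg (norm_nonneg _) (hθ x).le)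
  have hhalf : sSup A ≤ sSup A / 2 := by
    refine csSup_le ⟨_, 0, self_mem_Ici, rfl⟩ ?_
    rintro _ ⟨x, hx, rfl⟩
    simp only
    rw [div_le_iff₀ (hθ x)]
    calc ‖d x‖ ≤ ∫ ξ in Ioi (0 : ℝ), ‖κ x ξ k‖ * ‖d ξ‖ := hle x hx
      _ ≤ ∫ ξ in Ioi (0 : ℝ), sSup A * (‖κ x ξ k‖ * θ ξ) := by
        refine integral_mono_of_nonneg (Eventually.of_forall fun ξ => by positivity) ?_ ?_
        · refine Integrable.const_mul (Integrable.mono' (h.integrable.mul_const Θ)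
            ((h.meas x k).norm.mul h.weight_cont.aestronglyMeasurable) ?_) _
          filter_upwards [ae_restrict_mem measurableSet_Ioi] with ξ hξ
          rw [Pi.mul_apply, norm_mul, norm_norm, Real.norm_of_nonneg (hθ ξ).le]
          exact mul_le_mul (h.bound x ξ k hξ) (h.le ξ) (hθ ξ).le
            ((norm_nonneg _).trans (h.bound x ξ k hξ))
        · filter_upwards [ae_restrict_mem measurableSet_Ioi] with ξ hξ
          have := mul_le_mul_of_nonneg_left (hle' ξ (le_of_lt hξ)) (norm_nonneg (κ x ξ k))
          linarith
      _ = sSup A * ∫ ξ in Ioi (0 : ℝ), ‖κ x ξ k‖ * θ ξ := integral_const_mul _ _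
      _ ≤ sSup A * (θ x / 2) := mul_le_mul_of_nonneg_left (h.contract x k) hS
      _ = sSup A / 2 * θ x := by ring
  have hS0 : sSup A = 0 := by linarith
  intro x hx
  have := hle' x hx
  rw [hS0, zero_mul] at this
  exact norm_le_zero_iff.1 this

theorem norm_integrand_le (h : IsContractiveKernel κ w θ Θ) (r : ℝ × ℂ →ᵇ ℂ) (x : ℝ) (k : ℂ)
    {ξ : ℝ} (hξ : 0 < ξ) : ‖κ x ξ k * (θ ξ * r (ξ, k))‖ ≤ w ξ * (Θ * ‖r‖) := by
  have hθ : 0 ≤ θ ξ := zero_le_one.trans (h.one_le ξ)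
  rw [norm_mul, norm_mul, Complex.norm_real, Real.norm_of_nonneg hθ]
  exact mul_le_mul (h.bound x ξ k hξ)
    (mul_le_mul (h.le ξ) (r.norm_coe_le_norm _) (norm_nonneg _) (hθ.trans (h.le ξ)))
    (by positivity) ((norm_nonneg _).trans (h.bound x ξ k hξ))

theorem aestronglyMeasurable_integrand (h : IsContractiveKernel κ w θ Θ) (r : ℝ × ℂ →ᵇ ℂ)
    (x : ℝ) (k : ℂ) :
    AEStronglyMeasurable (fun ξ => κ x ξ k * (θ ξ * r (ξ, k))) (volume.restrict (Ioi 0)) := by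
  have h1 := h.weight_cont
  have : Continuous fun ξ : ℝ => (θ ξ : ℂ) * r (ξ, k) := by fun_prop
  exact (h.meas x k).mul this.aestronglyMeasurable

theorem integrable_integrand (h : IsContractiveKernel κ w θ Θ) (r : ℝ × ℂ →ᵇ ℂ) (x : ℝ) (k : ℂ) :
    IntegrableOn (fun ξ => κ x ξ k * (θ ξ * r (ξ, k))) (Ioi 0) := by
  refine Integrable.mono' (h.integrable.mul_const (Θ * ‖r‖))
    (h.aestronglyMeasurable_integrand r x k) ?_
  filter_upwards [ae_restrict_mem measurableSet_Ioi] with ξ hξ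
  exact h.norm_integrand_le r x k hξ

/-- The affine Volterra operator, conjugated by the weight. -/
noncomputable def operator (h : IsContractiveKernel κ w θ Θ) (ρ₀ : ℝ × ℂ →ᵇ ℂ)
    (r : ℝ × ℂ →ᵇ ℂ) : ℝ × ℂ →ᵇ ℂ :=
  BoundedContinuousFunction.ofNormedAddCommGroup
    (fun p => (ρ₀ p - ∫ ξ in Ioi (0 : ℝ), κ p.1 ξ p.2 * (θ ξ * r (ξ, p.2))) / θ p.1)
    (by
      have hθ := h.weight_cont
      refine Continuous.div (ρ₀.continuous.sub ?_) (by fun_prop) fun p => ?_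
      · refine continuous_of_dominated (bound := fun ξ => w ξ * (Θ * ‖r‖))
          (fun p => h.aestronglyMeasurable_integrand r p.1 p.2) (fun p => ?_)
          (h.integrable.mul_const _) (Eventually.of_forall fun ξ => ?_)
        · filter_upwards [ae_restrict_mem measurableSet_Ioi] with ξ hξ
          exact h.norm_integrand_le r p.1 p.2 hξ
        · have := h.cont ξ
          fun_prop
      · have := h.one_le p.1
        exact_mod_cast (by linarith : θ p.1 ≠ 0))
    (‖ρ₀‖ + ∫ ξ in Ioi (0 : ℝ), w ξ * (Θ * ‖r‖))
    (by
      intro p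
      rw [norm_div, Complex.norm_real, Real.norm_of_nonneg (zero_le_one.trans (h.one_le _))]
      refine (div_le_self (norm_nonneg _) (h.one_le _)).trans ((norm_sub_le _ _).trans ?_)
      refine add_le_add (ρ₀.norm_coe_le_norm p) ?_
      refine norm_integral_le_of_norm_le (h.integrable.mul_const _) ?_
      filter_upwards [ae_restrict_mem measurableSet_Ioi] with ξ hξ
      exact h.norm_integrand_le r p.1 p.2 hξ)

theorem operator_apply (h : IsContractiveKernel κ w θ Θ) (ρ₀ r : ℝ × ℂ →ᵇ ℂ) (p : ℝ × ℂ) :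
    h.operator ρ₀ r p
      = (ρ₀ p - ∫ ξ in Ioi (0 : ℝ), κ p.1 ξ p.2 * (θ ξ * r (ξ, p.2))) / θ p.1 := rfl

theorem contractingWith_operator (h : IsContractiveKernel κ w θ Θ) (ρ₀ : ℝ × ℂ →ᵇ ℂ) :
    ContractingWith (1 / 2) (h.operator ρ₀) := by
  refine ⟨by rw [← NNReal.coe_lt_coe]; norm_num, LipschitzWith.of_dist_le_mul fun r s => ?_⟩
  refine (BoundedContinuousFunction.dist_le (by positivity)).2 fun p => ?_
  have hθ : 0 < θ p.1 := one_pos.trans_le (h.one_le _)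
  rw [dist_eq_norm, operator_apply, operator_apply, ← sub_div, sub_sub_sub_cancel_left,
    ← integral_sub (h.integrable_integrand s _ _) (h.integrable_integrand r _ _), norm_div,
    Complex.norm_real, Real.norm_of_nonneg hθ.le, div_le_iff₀ hθ]
  have h1 : ‖∫ ξ in Ioi (0 : ℝ), (κ p.1 ξ p.2 * (θ ξ * s (ξ, p.2))
      - κ p.1 ξ p.2 * (θ ξ * r (ξ, p.2)))‖
      ≤ ∫ ξ in Ioi (0 : ℝ), dist r s * (‖κ p.1 ξ p.2‖ * θ ξ) := by
    refine norm_integral_le_of_norm_le ?_ ?_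
    · refine Integrable.const_mul (Integrable.mono' (h.integrable.mul_const Θ)
        ((h.meas _ _).norm.mul h.weight_cont.aestronglyMeasurable) ?_) _
      filter_upwards [ae_restrict_mem measurableSet_Ioi] with ξ hξ
      have hθ : 0 ≤ θ ξ := zero_le_one.trans (h.one_le ξ)
      rw [Pi.mul_apply, norm_mul, norm_norm, Real.norm_of_nonneg hθ]
      exact mul_le_mul (h.bound p.1 ξ p.2 hξ) (h.le ξ) hθ
        ((norm_nonneg _).trans (h.bound p.1 ξ p.2 hξ))
    · refine Eventually.of_forall fun ξ => ?_
      have hθ : 0 ≤ θ ξ := zero_le_one.trans (h.one_le ξ)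
      rw [← mul_sub, ← mul_sub, norm_mul, norm_mul, Complex.norm_real, Real.norm_of_nonneg hθ]
      have h2 : ‖s (ξ, p.2) - r (ξ, p.2)‖ ≤ dist r s := by
        rw [← dist_eq_norm, dist_comm]; exact BoundedContinuousFunction.dist_coe_le_dist _
      have := mul_le_mul_of_nonneg_left h2
        (mul_nonneg (norm_nonneg (κ p.1 ξ p.2)) hθ)
      linarith
  rw [integral_const_mul] at h1
  have h3 := mul_le_mul_of_nonneg_left (h.contract p.1 p.2) (dist_nonneg (x := r) (y := s))
  push_cast
  linarith

/-- Banach's fixed point theorem is applied in the space of bounded continuous functions of `(x, k)`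
jointly, so continuity in both variables and a bound uniform in `k` come at once. The iterates of
`0` are holomorphic in `k` by induction, and uniform convergence passes this to the limit. -/
theorem exists_solution (h : IsContractiveKernel κ w θ Θ) (ρ₀ : ℝ × ℂ →ᵇ ℂ)
    (hρ₀ : ∀ x, DifferentiableOn ℂ (fun k => ρ₀ (x, k)) {k | 0 < k.im}) :
    ∃ ρ : ℝ × ℂ →ᵇ ℂ,
      (∀ x k, ρ (x, k) = ρ₀ (x, k) - ∫ ξ in Ioi (0 : ℝ), κ x ξ k * ρ (ξ, k)) ∧
      ∀ x, DifferentiableOn ℂ (fun k => ρ (x, k)) {k | 0 < k.im} := by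
  have hc := h.contractingWith_operator ρ₀
  set r := ContractingWith.fixedPoint (h.operator ρ₀) hc with hr
  have hfix : h.operator ρ₀ r = r := hc.fixedPoint_isFixedPt
  have hU : IsOpen {k : ℂ | 0 < k.im} := isOpen_lt continuous_const Complex.continuous_im
  have hiter : ∀ (n : ℕ) (x : ℝ), DifferentiableOn ℂ
      (fun k => (h.operator ρ₀)^[n] 0 (x, k)) {k | 0 < k.im} := by
    intro n
    induction n with
    | zero => intro x; simp
    | succ n ih =>
      intro x
      simp only [Function.iterate_succ_apply', operator_apply]
      refine DifferentiableOn.div_const (DifferentiableOn.sub (hρ₀ x) ?_) _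
      set s := (h.operator ρ₀)^[n] 0
      refine differentiableOn_integral_of_dominated hU (bound := fun ξ => w ξ * (Θ * ‖s‖))
        (fun k _ => h.aestronglyMeasurable_integrand s x k) ?_ (h.integrable.mul_const _) ?_
      · filter_upwards [ae_restrict_mem measurableSet_Ioi] with ξ hξ k _
        exact h.norm_integrand_le s x k hξ
      · exact Eventually.of_forall fun ξ => (h.hol x ξ).mul ((ih ξ).const_mul _)
  have hlim : Tendsto (fun n => (h.operator ρ₀)^[n] 0) atTop (𝓝 r) :=
    hc.tendsto_iterate_fixedPoint 0
  have hrdiff : ∀ x, DifferentiableOn ℂ (fun k => r (x, k)) {k | 0 < k.im} := by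
    intro x
    have hu : TendstoUniformlyOn (fun n k => (h.operator ρ₀)^[n] 0 (x, k))
        (fun k => r (x, k)) atTop {k | 0 < k.im} := by
      have h1 := BoundedContinuousFunction.tendsto_iff_tendstoUniformly.1 hlim
      exact (h1.comp (fun k => (x, k))).tendstoUniformlyOn
    exact hu.tendstoLocallyUniformlyOn.differentiableOn
      (Eventually.of_forall fun n => hiter n x) hU
  have hθc : Continuous fun p : ℝ × ℂ => (θ p.1 : ℂ) * r p := by
    have := h.weight_cont
    fun_prop
  refine ⟨BoundedContinuousFunction.ofNormedAddCommGroup (fun p => (θ p.1 : ℂ) * r p) hθc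
    (Θ * ‖r‖) (fun p => ?_), fun x k => ?_, fun x => ?_⟩
  · have hθ : 0 ≤ θ p.1 := zero_le_one.trans (h.one_le _)
    rw [norm_mul, Complex.norm_real, Real.norm_of_nonneg hθ]
    exact mul_le_mul (h.le _) (r.norm_coe_le_norm p) (norm_nonneg _) (hθ.trans (h.le _))
  · have hθ : (θ x : ℂ) ≠ 0 := by
      have := h.one_le x
      exact_mod_cast (by linarith : θ x ≠ 0)
    change (θ x : ℂ) * r (x, k) = _ - ∫ ξ in Ioi (0 : ℝ), κ x ξ k * ((θ ξ : ℂ) * r (ξ, k))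
    conv_lhs => rw [← hfix, operator_apply]
    field_simp
  · exact (hrdiff x).const_mul (θ x : ℂ)

end IsContractiveKernel

/-! ### Potentials with a finite first moment -/

/-- A continuous potential with finite first moment on the half line. -/
structure IsPotential (u : ℝ → ℝ) : Prop where
  cont : Continuous u
  int : IntegrableOn (fun x => (1 + x) * |u x|) (Ioi 0)

/-- The projection of the plane onto the closed upper half plane. -/
noncomputable def upperClamp (k : ℂ) : ℂ := ⟨k.re, max k.im 0⟩

theorem upperClamp_im_nonneg (k : ℂ) : 0 ≤ (upperClamp k).im := le_max_right _ _

theorem upperClamp_of_nonneg {k : ℂ} (hk : 0 ≤ k.im) : upperClamp k = k := by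
  apply Complex.ext <;> simp [upperClamp, hk]

theorem continuous_upperClamp : Continuous upperClamp := by
  have : upperClamp = fun k : ℂ => ((k.re : ℂ) + ((max k.im 0 : ℝ) : ℂ) * Complex.I) := by
    funext k
    apply Complex.ext <;> simp [upperClamp]
  rw [this]
  fun_prop

theorem DifferentiableOn.comp_upperClamp {f : ℂ → ℂ} (hf : DifferentiableOn ℂ f {k | 0 < k.im}) :
    DifferentiableOn ℂ (fun k => f (upperClamp k)) {k | 0 < k.im} :=
  hf.congr fun k hk => by rw [upperClamp_of_nonneg (le_of_lt hk)]

theorem setIntegral_Ioi_eq_of_eq_zero {f g : ℝ → ℂ} {a b : ℝ} (hab : a ≤ b)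
    (h0 : ∀ ξ, a < ξ → ξ ≤ b → f ξ = 0) (hfg : ∀ ξ, b < ξ → f ξ = g ξ) :
    ∫ ξ in Ioi a, f ξ = ∫ ξ in Ioi b, g ξ := by
  have h1 : ∫ ξ in Ioi a, f ξ = ∫ ξ in Ioi a, (Ioi b).indicator g ξ := by
    refine setIntegral_congr_fun measurableSet_Ioi fun ξ hξ => ?_
    by_cases h : b < ξ
    · simp [indicator_of_mem (show ξ ∈ Ioi b from h), hfg ξ h]
    · simp [h, h0 ξ hξ (not_lt.1 h)]
  rw [h1, setIntegral_indicator measurableSet_Ioi, inter_eq_self_of_subset_right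
    (Ioi_subset_Ioi hab)]

theorem setIntegral_Ioi_eq_intervalIntegral {f g : ℝ → ℂ} {a b : ℝ} (hab : a ≤ b)
    (h0 : ∀ ξ, b < ξ → f ξ = 0) (hfg : ∀ ξ, a < ξ → ξ ≤ b → f ξ = g ξ) :
    ∫ ξ in Ioi a, f ξ = ∫ ξ in a..b, g ξ := by
  have h1 : ∫ ξ in Ioi a, f ξ = ∫ ξ in Ioi a, (Ioc a b).indicator g ξ := by
    refine setIntegral_congr_fun measurableSet_Ioi fun ξ hξ => ?_
    by_cases h : ξ ≤ b
    · simp [indicator_of_mem (show ξ ∈ Ioc a b from ⟨hξ, h⟩), hfg ξ hξ h]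
    · simp [h, h0 ξ (not_le.1 h)]
  rw [h1, setIntegral_indicator measurableSet_Ioc, inter_eq_self_of_subset_right
    Ioc_subset_Ioi_self, intervalIntegral.integral_of_le hab]

theorem hasDerivAt_integral_Ioi {g : ℝ → ℂ} (hg : Continuous g) (hint : IntegrableOn g (Ioi 0))
    (x : ℝ) : HasDerivAt (fun x => ∫ ξ in Ioi x, g ξ) (-g x) x := by
  have h : (fun x => ∫ ξ in Ioi x, g ξ)
      = fun x => (∫ ξ in Ioi (0 : ℝ), g ξ) - ∫ ξ in (0 : ℝ)..x, g ξ := by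
    funext y
    rw [eq_sub_iff_add_eq, add_comm]
    refine intervalIntegral.integral_interval_add_Ioi' ?_ ?_
    · exact hg.intervalIntegrable _ _
    · rcases le_total 0 y with h | h
      · exact hint.mono_set (Ioi_subset_Ioi h)
      · rw [← Ioc_union_Ioi_eq_Ioi h]
        exact (hg.integrableOn_Ioc).union hint
  rw [h]
  exact (intervalIntegral.integral_hasDerivAt_right (hg.intervalIntegrable _ _)
    hg.aestronglyMeasurable.stronglyMeasurableAtFilter hg.continuousAt).const_sub _

namespace IsPotential

variable {u : ℝ → ℝ}

/-- The weight `(1 + |ξ|) |u(ξ)|`. -/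
noncomputable def weight (u : ℝ → ℝ) (ξ : ℝ) : ℝ := (1 + |ξ|) * |u ξ|

theorem weight_nonneg (u : ℝ → ℝ) (ξ : ℝ) : 0 ≤ weight u ξ := by unfold weight; positivity

theorem continuous_weight (hu : IsPotential u) : Continuous (weight u) := by
  have := hu.cont
  unfold weight
  fun_prop

theorem integrableOn_weight (hu : IsPotential u) : IntegrableOn (weight u) (Ioi 0) := by
  refine hu.int.congr_fun (fun x hx => ?_) measurableSet_Ioi
  simp [weight, abs_of_pos (mem_Ioi.1 hx)]

theorem integral_weight_le (hu : IsPotential u) {x : ℝ} (hx : 0 ≤ x) :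
    ∫ ξ in (0 : ℝ)..x, weight u ξ ≤ ∫ ξ in Ioi (0 : ℝ), weight u ξ := by
  rw [intervalIntegral.integral_of_le hx]
  exact setIntegral_mono_set hu.integrableOn_weight
    (Eventually.of_forall fun ξ => weight_nonneg u ξ) Ioc_subset_Ioi_self.eventuallyLE

theorem integral_weight_nonneg (u : ℝ → ℝ) {x : ℝ} (hx : 0 ≤ x) :
    0 ≤ ∫ ξ in (0 : ℝ)..x, weight u ξ :=
  intervalIntegral.integral_nonneg hx fun ξ _ => weight_nonneg u ξ

theorem hasDerivAt_integral_weight (hu : IsPotential u) (x : ℝ) :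
    HasDerivAt (fun x => ∫ ξ in (0 : ℝ)..x, weight u ξ) (weight u x) x :=
  intervalIntegral.integral_hasDerivAt_right (hu.continuous_weight.intervalIntegrable _ _)
    hu.continuous_weight.aestronglyMeasurable.stronglyMeasurableAtFilter
    hu.continuous_weight.continuousAt

theorem continuous_integral_weight (hu : IsPotential u) :
    Continuous fun x => ∫ ξ in (0 : ℝ)..x, weight u ξ :=
  continuous_iff_continuousAt.2 fun x => (hu.hasDerivAt_integral_weight x).continuousAt

theorem abs_le_weight (u : ℝ → ℝ) {t ξ : ℝ} (hξ : 0 ≤ ξ) (ht : t ≤ 1 + ξ) :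
    t * |u ξ| ≤ weight u ξ := by
  rw [weight, abs_of_nonneg hξ]
  exact mul_le_mul_of_nonneg_right ht (abs_nonneg _)

/-- The Volterra kernel of the equation normalised at infinity. -/
noncomputable def tailKernel (u : ℝ → ℝ) (x ξ : ℝ) (k : ℂ) : ℂ :=
  expKernel (max (ξ - max x 0) 0) (upperClamp k) * u ξ

/-- The Volterra kernel of the equation normalised at the origin. -/
noncomputable def headKernel (u : ℝ → ℝ) (x ξ : ℝ) (k : ℂ) : ℂ :=
  expKernel (max (max x 0 - ξ) 0) (upperClamp k) * (((1 + |ξ|) / (1 + max x 0) : ℝ) * u ξ)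

theorem norm_tailKernel_le (u : ℝ → ℝ) (x : ℝ) {ξ : ℝ} (hξ : 0 < ξ) (k : ℂ) :
    ‖tailKernel u x ξ k‖ ≤ weight u ξ := by
  rw [tailKernel, norm_mul, Complex.norm_real, Real.norm_eq_abs]
  refine (mul_le_mul_of_nonneg_right (norm_expKernel_le (le_max_right _ _)
    (upperClamp_im_nonneg k)) (abs_nonneg _)).trans (abs_le_weight u hξ.le ?_)
  have := le_max_right x 0
  exact max_le (by linarith) (by linarith)

theorem tailKernel_eq_zero (u : ℝ → ℝ) {x ξ : ℝ} (hξ : ξ ≤ max x 0) (k : ℂ) :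
    tailKernel u x ξ k = 0 := by
  rw [tailKernel, max_eq_right (by linarith)]; simp

theorem norm_headKernel_le (u : ℝ → ℝ) (x : ℝ) {ξ : ℝ} (hξ : 0 < ξ) (k : ℂ) :
    ‖headKernel u x ξ k‖ ≤ weight u ξ := by
  have h0 := le_max_right x 0
  have h1 : max (max x 0 - ξ) 0 ≤ 1 + max x 0 := max_le (by linarith) (by linarith)
  rw [headKernel, norm_mul, norm_mul, Complex.norm_real, Complex.norm_real, Real.norm_eq_abs,
    Real.norm_eq_abs, abs_of_nonneg (show 0 ≤ (1 + |ξ|) / (1 + max x 0) by positivity), weight]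
  calc _ ≤ (1 + max x 0) * ((1 + |ξ|) / (1 + max x 0) * |u ξ|) := by
        refine mul_le_mul_of_nonneg_right ((norm_expKernel_le (le_max_right _ _)
          (upperClamp_im_nonneg k)).trans h1) (by positivity)
    _ = _ := by field_simp

theorem headKernel_eq_zero (u : ℝ → ℝ) {x ξ : ℝ} (hξ : max x 0 ≤ ξ) (k : ℂ) :
    headKernel u x ξ k = 0 := by
  rw [headKernel, max_eq_right (by linarith)]; simp

/-- The weight is `θ(x) = exp (2 ∫_x^∞ w)` with `w = weight u`. The kernel is at most `w(ξ)` for `ξ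
> x` and vanishes otherwise, and `∫_x^∞ w θ = (θ(x) - 1) / 2`, so no smallness of the potential is
needed. The truncations `max x 0` and `upperClamp` extend everything to all real `x` and complex
`k`. -/
theorem isContractiveKernel_tailKernel (hu : IsPotential u) :
    IsContractiveKernel (tailKernel u) (weight u)
      (fun x => Real.exp (2 * ((∫ ξ in Ioi (0 : ℝ), weight u ξ)
        - ∫ ξ in (0 : ℝ)..max x 0, weight u ξ)))
      (Real.exp (2 * ∫ ξ in Ioi (0 : ℝ), weight u ξ)) where
  cont ξ := by
    have h1 := continuous_expKernel
    have h2 := continuous_upperClamp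
    have h3 : Continuous fun p : ℝ × ℂ => (max (ξ - max p.1 0) 0, upperClamp p.2) := by fun_prop
    exact (h1.comp h3).mul continuous_const
  meas x k := by
    have h1 := continuous_expKernel
    have hu := hu.cont
    have h3 : Continuous fun ξ : ℝ => (max (ξ - max x 0) 0, upperClamp k) := by fun_prop
    exact ((h1.comp h3).mul (by fun_prop)).aestronglyMeasurable
  bound x ξ k hξ := norm_tailKernel_le u x hξ k
  integrable := hu.integrableOn_weight
  weight_cont := by
    have h := hu.continuous_integral_weight
    have : Continuous fun x : ℝ => ∫ ξ in (0 : ℝ)..max x 0, weight u ξ :=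
      h.comp (by fun_prop : Continuous fun x : ℝ => max x 0)
    fun_prop
  one_le x := Real.one_le_exp (by
    have := hu.integral_weight_le (le_max_right x 0); linarith)
  le x := Real.exp_le_exp.2 (by
    have := integral_weight_nonneg u (le_max_right x 0); linarith)
  contract x k := by
    set T := ∫ ξ in Ioi (0 : ℝ), weight u ξ with hT
    set W : ℝ → ℝ := fun x => ∫ ξ in (0 : ℝ)..x, weight u ξ with hW
    have hx0 := le_max_right x 0
    set X := max x 0 with hX
    have hlim : Tendsto W atTop (𝓝 T) :=
      intervalIntegral_tendsto_integral_Ioi 0 hu.integrableOn_weight tendsto_id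
    -- An explicit antiderivative of `w θ`; its limit at infinity is `-1 / 2`.
    have hder : ∀ y ∈ Ici X, HasDerivAt (fun y => -(Real.exp (2 * (T - W y)) / 2))
        (weight u y * Real.exp (2 * (T - W y))) y := by
      intro y _
      have := ((((hu.hasDerivAt_integral_weight y).const_sub T).const_mul 2).exp.div_const 2).neg
      exact this.congr_deriv (by ring)
    have hlim' : Tendsto (fun y => -(Real.exp (2 * (T - W y)) / 2)) atTop
        (𝓝 (-(Real.exp (2 * (T - T)) / 2))) := by
      have hc : Continuous fun z => -(Real.exp (2 * (T - z)) / 2) := by fun_prop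
      exact (hc.tendsto T).comp hlim
    have hbase := hu.integrableOn_weight.mono_set (Ioi_subset_Ioi hx0)
    have hint : IntegrableOn (fun y => weight u y * Real.exp (2 * (T - W y))) (Ioi X) := by
      refine Integrable.mono' (hbase.mul_const (Real.exp (2 * T))) ?_ ?_
      · have h1 := hu.continuous_weight
        have h2 : Continuous W := hu.continuous_integral_weight
        exact (by fun_prop : Continuous _).aestronglyMeasurable
      · filter_upwards [ae_restrict_mem measurableSet_Ioi] with y hy
        have hy0 : 0 ≤ y := hx0.trans (le_of_lt hy)
        rw [norm_mul, Real.norm_of_nonneg (weight_nonneg u y),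
          Real.norm_of_nonneg (Real.exp_pos _).le]
        refine mul_le_mul_of_nonneg_left (Real.exp_le_exp.2 ?_) (weight_nonneg u y)
        have : 0 ≤ W y := integral_weight_nonneg u hy0
        linarith
    have hval := integral_Ioi_of_hasDerivAt_of_tendsto' hder hint hlim'
    have hle : ∫ ξ in Ioi (0 : ℝ), ‖tailKernel u x ξ k‖ * Real.exp (2 * (T - W (max ξ 0)))
        ≤ ∫ ξ in Ioi (0 : ℝ), (Ioi X).indicator
          (fun y => weight u y * Real.exp (2 * (T - W y))) ξ := by
      refine integral_mono_of_nonneg (Eventually.of_forall fun ξ => by positivity) ?_ ?_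
      · exact ((integrable_indicator_iff measurableSet_Ioi).2 hint).restrict
      · filter_upwards [ae_restrict_mem measurableSet_Ioi] with ξ hξ
        by_cases h : X < ξ
        · simp only [indicator_of_mem (show ξ ∈ Ioi X from h), max_eq_left (le_of_lt (mem_Ioi.1 hξ))]
          exact mul_le_mul_of_nonneg_right (norm_tailKernel_le u x hξ k) (Real.exp_pos _).le
        · simp [h, tailKernel_eq_zero u (not_lt.1 h) k]
    refine hle.trans ?_
    rw [setIntegral_indicator measurableSet_Ioi, inter_eq_self_of_subset_right
      (Ioi_subset_Ioi hx0), hval]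
    simp
    linarith
  hol x ξ := ((differentiable_expKernel _).differentiableOn.comp_upperClamp).mul_const _

/-- The mirror image of the previous argument, with weight `exp (2 ∫_0^x w)`. Solutions started at
the origin may grow linearly when `k = 0`; the quotient `(1 + ξ) / (1 + x)` in the kernel comes from
dividing them by `1 + x`, which keeps the fixed point problem in bounded functions. -/
theorem isContractiveKernel_headKernel (hu : IsPotential u) :
    IsContractiveKernel (headKernel u) (weight u)
      (fun x => Real.exp (2 * ∫ ξ in (0 : ℝ)..max x 0, weight u ξ))
      (Real.exp (2 * ∫ ξ in Ioi (0 : ℝ), weight u ξ)) where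
  cont ξ := by
    have h1 := continuous_expKernel
    have h2 := continuous_upperClamp
    have h3 : Continuous fun p : ℝ × ℂ => (max (max p.1 0 - ξ) 0, upperClamp p.2) := by fun_prop
    have h4 : Continuous fun p : ℝ × ℂ => (1 + |ξ|) / (1 + max p.1 0) := by
      refine Continuous.div (by fun_prop) (by fun_prop) fun p => ?_
      have := le_max_right p.1 0
      linarith
    exact (h1.comp h3).mul (by fun_prop)
  meas x k := by
    have h1 := continuous_expKernel
    have hu := hu.cont
    have h3 : Continuous fun ξ : ℝ => (max (max x 0 - ξ) 0, upperClamp k) := by fun_prop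
    exact ((h1.comp h3).mul (by fun_prop)).aestronglyMeasurable
  bound x ξ k hξ := norm_headKernel_le u x hξ k
  integrable := hu.integrableOn_weight
  weight_cont := by
    have h := hu.continuous_integral_weight
    have : Continuous fun x : ℝ => ∫ ξ in (0 : ℝ)..max x 0, weight u ξ :=
      h.comp (by fun_prop : Continuous fun x : ℝ => max x 0)
    fun_prop
  one_le x := Real.one_le_exp (by
    have := integral_weight_nonneg u (le_max_right x 0); linarith)
  le x := Real.exp_le_exp.2 (by
    have := hu.integral_weight_le (le_max_right x 0); linarith)
  contract x k := by
    set W : ℝ → ℝ := fun x => ∫ ξ in (0 : ℝ)..x, weight u ξ with hW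
    have hx0 := le_max_right x 0
    set X := max x 0 with hX
    have hder : ∀ y ∈ uIcc 0 X, HasDerivAt (fun y => Real.exp (2 * W y) / 2)
        (weight u y * Real.exp (2 * W y)) y := by
      intro y _
      have := (((hu.hasDerivAt_integral_weight y).const_mul 2).exp.div_const 2)
      exact this.congr_deriv (by ring)
    have hc : Continuous fun y => weight u y * Real.exp (2 * W y) := by
      have h1 := hu.continuous_weight
      have h2 : Continuous W := hu.continuous_integral_weight
      fun_prop
    have hval := intervalIntegral.integral_eq_sub_of_hasDerivAt hder (hc.intervalIntegrable _ _)
    have hle : ∫ ξ in Ioi (0 : ℝ), ‖headKernel u x ξ k‖ * Real.exp (2 * W (max ξ 0))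
        ≤ ∫ ξ in Ioi (0 : ℝ), (Ioc 0 X).indicator
          (fun y => weight u y * Real.exp (2 * W y)) ξ := by
      refine integral_mono_of_nonneg (Eventually.of_forall fun ξ => by positivity) ?_ ?_
      · exact ((integrable_indicator_iff measurableSet_Ioc).2 hc.integrableOn_Ioc).restrict
      · filter_upwards [ae_restrict_mem measurableSet_Ioi] with ξ hξ
        by_cases h : ξ ≤ X
        · simp only [indicator_of_mem (show ξ ∈ Ioc 0 X from ⟨hξ, h⟩), max_eq_left (le_of_lt (mem_Ioi.1 hξ))]
          exact mul_le_mul_of_nonneg_right (norm_headKernel_le u x hξ k) (Real.exp_pos _).le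
        · simp [h, headKernel_eq_zero u (not_le.1 h).le k]
    refine hle.trans ?_
    rw [setIntegral_indicator measurableSet_Ioc, inter_eq_self_of_subset_right
      Ioc_subset_Ioi_self, ← intervalIntegral.integral_of_le hx0, hval]
    simp [hW]
  hol x ξ := ((differentiable_expKernel _).differentiableOn.comp_upperClamp).mul_const _

/-! ### The Jost solution -/

theorem exists_jost (hu : IsPotential u) : ∃ m : ℝ × ℂ →ᵇ ℂ,
    (∀ x k, m (x, k) = 1 - ∫ ξ in Ioi (0 : ℝ), tailKernel u x ξ k * m (ξ, k)) ∧
    ∀ x, DifferentiableOn ℂ (fun k => m (x, k)) {k | 0 < k.im} :=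
  hu.isContractiveKernel_tailKernel.exists_solution (BoundedContinuousFunction.const _ 1)
    fun _ => by simp

/-- The normalised Jost solution `e^{-ikx} ψ(x,k)`. -/
noncomputable def jost (hu : IsPotential u) : ℝ × ℂ →ᵇ ℂ := hu.exists_jost.choose

theorem jost_eqn (hu : IsPotential u) {x : ℝ} {k : ℂ} (hx : 0 ≤ x) (hk : 0 ≤ k.im) :
    hu.jost (x, k) = 1 - ∫ ξ in Ioi x, expKernel (ξ - x) k * u ξ * hu.jost (ξ, k) := by
  rw [jost, hu.exists_jost.choose_spec.1 x k]
  congr 1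
  refine setIntegral_Ioi_eq_of_eq_zero hx (fun ξ _ h => ?_) fun ξ h => ?_
  · rw [tailKernel_eq_zero u (by rwa [max_eq_left hx]), zero_mul]
  · rw [tailKernel, max_eq_left hx, max_eq_left (by linarith), upperClamp_of_nonneg hk]

theorem differentiableOn_jost (hu : IsPotential u) (x : ℝ) :
    DifferentiableOn ℂ (fun k => hu.jost (x, k)) {k | 0 < k.im} :=
  hu.exists_jost.choose_spec.2 x

end IsPotential

theorem GenLaplace.IsPsi.normalized_eqn {u : ℝ → ℝ} {k : ℂ} {χ : ℝ → ℂ} (h : IsPsi u k χ) {x : ℝ}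
    (hx : 0 ≤ x) : χ x * Complex.exp (-(Complex.I * k * x))
      = 1 - ∫ ξ in Ioi x, expKernel (ξ - x) k * u ξ
          * (χ ξ * Complex.exp (-(Complex.I * k * ξ))) := by
  conv_lhs => rw [h.eqn x hx]
  rw [add_mul, ← Complex.exp_add, add_neg_cancel, Complex.exp_zero, ← integral_mul_const,
    sub_eq_add_neg, ← integral_neg]
  congr 1
  refine integral_congr_ae (Eventually.of_forall fun ξ => ?_)
  have h1 : x - ξ = -(ξ - x) := by ring
  have h2 : Complex.exp (-(Complex.I * k * ((ξ - x : ℝ) : ℂ)))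
      * Complex.exp (-(Complex.I * k * x)) = Complex.exp (-(Complex.I * k * ξ)) := by
    rw [← Complex.exp_add]; congr 1; push_cast; ring
  simp only
  rw [h1, sinKernel_neg, sinKernel_eq, ← h2]
  ring

theorem isPsi_of_normalized {u : ℝ → ℝ} {k : ℂ} {m : ℝ → ℂ} {C : ℝ} (hm : ContinuousOn m (Ici 0))
    (hC : ∀ x, 0 ≤ x → ‖m x‖ ≤ C)
    (heq : ∀ x, 0 ≤ x → m x = 1 - ∫ ξ in Ioi x, expKernel (ξ - x) k * u ξ * m ξ) :
    IsPsi u k fun x => Complex.exp (Complex.I * k * x) * m x where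
  continuousOn := ContinuousOn.mul (by fun_prop) hm
  bounded := ⟨C, fun x hx => by
    rw [mul_right_comm, ← Complex.exp_add, add_neg_cancel, Complex.exp_zero, one_mul]
    exact hC x hx⟩
  eqn x hx := by
    rw [heq x hx, mul_sub, mul_one, sub_eq_add_neg, ← integral_const_mul, ← integral_neg]
    congr 1
    refine integral_congr_ae (Eventually.of_forall fun ξ => ?_)
    have h1 : x - ξ = -(ξ - x) := by ring
    have h2 : Complex.exp (-(Complex.I * k * ((ξ - x : ℝ) : ℂ)))
        * Complex.exp (Complex.I * k * ξ) = Complex.exp (Complex.I * k * x) := by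
      rw [← Complex.exp_add]; congr 1; push_cast; ring
    simp only
    rw [h1, sinKernel_neg, sinKernel_eq, ← h2]
    ring

namespace IsPotential

variable {u : ℝ → ℝ}

theorem isPsi_jost (hu : IsPotential u) {k : ℂ} (hk : 0 ≤ k.im) :
    IsPsi u k fun x => Complex.exp (Complex.I * k * x) * hu.jost (x, k) :=
  isPsi_of_normalized (by fun_prop) (fun x _ => hu.jost.norm_coe_le_norm _)
    fun _ hx => hu.jost_eqn hx hk

theorem integrableOn_expKernel_mul (hu : IsPotential u) {k : ℂ} (hk : 0 ≤ k.im) {x : ℝ}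
    (hx : 0 ≤ x) {m : ℝ → ℂ} {C : ℝ} (hm : ContinuousOn m (Ici 0))
    (hC : ∀ x, 0 ≤ x → ‖m x‖ ≤ C) :
    IntegrableOn (fun ξ => expKernel (ξ - x) k * u ξ * m ξ) (Ioi x) := by
  refine Integrable.mono' ((hu.integrableOn_weight.mono_set (Ioi_subset_Ioi hx)).mul_const C)
    ?_ ?_
  · have h1 := continuous_expKernel
    have hu := hu.cont
    have h3 : Continuous fun ξ : ℝ => (ξ - x, k) := by fun_prop
    refine ContinuousOn.aestronglyMeasurable (ContinuousOn.mul ?_ (hm.mono ?_)) measurableSet_Ioi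
    · exact ((h1.comp h3).mul (by fun_prop)).continuousOn
    · exact fun ξ hξ => hx.trans (le_of_lt hξ)
  · filter_upwards [ae_restrict_mem measurableSet_Ioi] with ξ hξ
    have hξ' : x < ξ := hξ
    rw [norm_mul, norm_mul, Complex.norm_real, Real.norm_eq_abs]
    refine mul_le_mul ?_ (hC ξ (by linarith)) (norm_nonneg _) (weight_nonneg u ξ)
    refine (mul_le_mul_of_nonneg_right (norm_expKernel_le (by linarith) hk)
      (abs_nonneg _)).trans (abs_le_weight u (by linarith) (by linarith))

/-- Boundedness of `e^{-ikx} χ` lets the difference of two normalised solutions enter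
`eq_zero_of_le` for the homogeneous equation. -/
theorem isPsi_unique (hu : IsPotential u) {k : ℂ} (hk : 0 ≤ k.im) {χ₁ χ₂ : ℝ → ℂ}
    (h₁ : IsPsi u k χ₁) (h₂ : IsPsi u k χ₂) : ∀ x, 0 ≤ x → χ₁ x = χ₂ x := by
  obtain ⟨C₁, hC₁⟩ := h₁.bounded
  obtain ⟨C₂, hC₂⟩ := h₂.bounded
  have hc : ∀ {χ : ℝ → ℂ}, IsPsi u k χ →
      ContinuousOn (fun x : ℝ => χ x * Complex.exp (-(Complex.I * k * x))) (Ici 0) :=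
    fun h => h.continuousOn.mul (by fun_prop)
  have key := hu.isContractiveKernel_tailKernel.eq_zero_of_le (k := k) (C := C₁ + C₂)
    (d := fun x => χ₁ x * Complex.exp (-(Complex.I * k * x))
      - χ₂ x * Complex.exp (-(Complex.I * k * x)))
    (fun x hx => (norm_sub_le _ _).trans (add_le_add (hC₁ x hx) (hC₂ x hx))) ?_
  · intro x hx
    have := key x hx
    rw [← sub_mul, mul_eq_zero, or_iff_left (Complex.exp_ne_zero _)] at this
    exact sub_eq_zero.1 this
  · intro x hx
    have heq : χ₁ x * Complex.exp (-(Complex.I * k * x)) - χ₂ x * Complex.exp (-(Complex.I * k * x))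
        = -∫ ξ in Ioi (0 : ℝ), tailKernel u x ξ k
          * (χ₁ ξ * Complex.exp (-(Complex.I * k * ξ))
            - χ₂ ξ * Complex.exp (-(Complex.I * k * ξ))) := by
      rw [h₁.normalized_eqn hx, h₂.normalized_eqn hx, sub_sub_sub_cancel_left,
        ← integral_sub (hu.integrableOn_expKernel_mul hk hx (hc h₂) hC₂)
          (hu.integrableOn_expKernel_mul hk hx (hc h₁) hC₁), ← integral_neg]
      symm
      refine setIntegral_Ioi_eq_of_eq_zero hx (fun ξ _ h => ?_) fun ξ h => ?_
      · rw [tailKernel_eq_zero u (by rwa [max_eq_left hx]), zero_mul, neg_zero]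
      · rw [tailKernel, max_eq_left hx, max_eq_left (by linarith), upperClamp_of_nonneg hk]
        ring
    simp only [heq, norm_neg, ← norm_mul]
    exact norm_integral_le_integral_norm _

/-- `psi` is defined by choice; uniqueness identifies it with the fixed point, so continuity,
holomorphy and bounds in `k` can be read off from `jost`. -/
theorem psi_eq (hu : IsPotential u) {k : ℂ} (hk : 0 ≤ k.im) {x : ℝ} (hx : 0 ≤ x) :
    psi u x k = Complex.exp (Complex.I * k * x) * hu.jost (x, k) := by
  have hex : ∃ χ, IsPsi u k χ := ⟨_, hu.isPsi_jost hk⟩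
  rw [psi, dif_pos hex]
  exact hu.isPsi_unique hk hex.choose_spec (hu.isPsi_jost hk) x hx

end IsPotential

/-! ### Differentiation of Volterra integrals -/

theorem integrableOn_Ioi_of_continuous {g : ℝ → ℂ} (hg : Continuous g)
    (hint : IntegrableOn g (Ioi 0)) (x : ℝ) : IntegrableOn g (Ioi x) := by
  rcases le_total 0 x with h | h
  · exact hint.mono_set (Ioi_subset_Ioi h)
  · rw [← Ioc_union_Ioi_eq_Ioi h]
    exact hg.integrableOn_Ioc.union hint

theorem norm_exp_two_I_mul_le_one {k : ℂ} (hk : 0 ≤ k.im) {t : ℝ} (ht : 0 ≤ t) :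
    ‖Complex.exp (2 * Complex.I * k * t)‖ ≤ 1 := by
  rw [Complex.norm_exp, re_two_I_mul]
  exact Real.exp_le_one_iff.2 (by have := mul_nonneg hk ht; linarith)

theorem hasDerivAt_cexp_mul (c : ℂ) (x : ℝ) :
    HasDerivAt (fun x : ℝ => Complex.exp (c * x)) (c * Complex.exp (c * x)) x := by
  have h1 : HasDerivAt (fun t : ℝ => c * (t : ℂ)) c x := by
    simpa using (Complex.ofRealCLM.hasDerivAt (x := x)).const_mul c
  exact h1.cexp.congr_deriv (mul_comm _ _)

theorem integrableOn_cexp_mul {g : ℝ → ℂ} (hg : Continuous g) (hint : IntegrableOn g (Ioi 0))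
    {k : ℂ} (hk : 0 ≤ k.im) :
    IntegrableOn (fun ξ : ℝ => Complex.exp (2 * Complex.I * k * ξ) * g ξ) (Ioi 0) := by
  refine Integrable.mono' hint.norm (by fun_prop) ?_
  filter_upwards [ae_restrict_mem measurableSet_Ioi] with ξ hξ
  rw [norm_mul]
  exact mul_le_of_le_one_left (norm_nonneg _) (norm_exp_two_I_mul_le_one hk (le_of_lt hξ))

theorem integral_cexp_tail_eq (g : ℝ → ℂ) (k : ℂ) (x : ℝ) :
    ∫ ξ in Ioi x, Complex.exp (2 * Complex.I * k * (ξ - x : ℝ)) * g ξ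
      = Complex.exp (-(2 * Complex.I * k) * x)
        * ∫ ξ in Ioi x, Complex.exp (2 * Complex.I * k * ξ) * g ξ := by
  rw [← integral_const_mul]
  refine integral_congr_ae (Eventually.of_forall fun ξ => ?_)
  simp only
  rw [← mul_assoc, ← Complex.exp_add]
  congr 2
  push_cast; ring

theorem hasDerivAt_integral_cexp_tail {g : ℝ → ℂ} (hg : Continuous g)
    (hint : IntegrableOn g (Ioi 0)) {k : ℂ} (hk : 0 ≤ k.im) (x : ℝ) :
    HasDerivAt (fun x : ℝ => ∫ ξ in Ioi x, Complex.exp (2 * Complex.I * k * (ξ - x : ℝ)) * g ξ)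
      (-(2 * Complex.I * k)
        * (∫ ξ in Ioi x, Complex.exp (2 * Complex.I * k * (ξ - x : ℝ)) * g ξ) - g x) x := by
  simp only [integral_cexp_tail_eq]
  have h := (hasDerivAt_cexp_mul (-(2 * Complex.I * k)) x).mul (hasDerivAt_integral_Ioi
    (by fun_prop : Continuous fun ξ : ℝ => Complex.exp (2 * Complex.I * k * ξ) * g ξ)
    (integrableOn_cexp_mul hg hint hk) x)
  refine h.congr_deriv ?_
  have h2 : Complex.exp (-(2 * Complex.I * k) * x) * Complex.exp (2 * Complex.I * k * x) = 1 := by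
    rw [← Complex.exp_add]; simp
  linear_combination -g x * h2

/-- The kernel vanishes on the diagonal, so only its `x`-derivative contributes. For `k ≠ 0` it
splits as `(exponential - 1) / (2ik)`, for `k = 0` as `ξ - x`; each piece is handled by the
fundamental theorem of calculus, and the second one needs the first moment of `g`. -/
theorem hasDerivAt_integral_expKernel_tail {g : ℝ → ℂ} (hg : Continuous g)
    (hint : IntegrableOn g (Ioi 0)) (hint' : IntegrableOn (fun ξ : ℝ => (ξ : ℂ) * g ξ) (Ioi 0))
    {k : ℂ} (hk : 0 ≤ k.im) (x : ℝ) :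
    HasDerivAt (fun x : ℝ => ∫ ξ in Ioi x, expKernel (ξ - x) k * g ξ)
      (-∫ ξ in Ioi x, Complex.exp (2 * Complex.I * k * (ξ - x : ℝ)) * g ξ) x := by
  have hG := hasDerivAt_integral_Ioi hg hint x
  by_cases h0 : k = 0
  · subst h0
    have hc : Continuous fun ξ : ℝ => (ξ : ℂ) * g ξ := by fun_prop
    have heq : (fun x : ℝ => ∫ ξ in Ioi x, expKernel (ξ - x) 0 * g ξ)
        = fun x : ℝ => (∫ ξ in Ioi x, (ξ : ℂ) * g ξ) - x * ∫ ξ in Ioi x, g ξ := by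
      funext y
      rw [← integral_const_mul, ← integral_sub (integrableOn_Ioi_of_continuous hc hint' y)
        ((integrableOn_Ioi_of_continuous hg hint y).const_mul _)]
      refine integral_congr_ae (Eventually.of_forall fun ξ => ?_)
      simp only [expKernel_zero_right]; push_cast; ring
    rw [heq]
    refine ((hasDerivAt_integral_Ioi hc hint' x).sub
      ((Complex.ofRealCLM.hasDerivAt (x := x)).mul hG)).congr_deriv ?_
    simp
  · have hne : 2 * Complex.I * k ≠ 0 := by simp [h0]
    have heq : (fun x : ℝ => ∫ ξ in Ioi x, expKernel (ξ - x) k * g ξ)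
        = fun x : ℝ => ((∫ ξ in Ioi x, Complex.exp (2 * Complex.I * k * (ξ - x : ℝ)) * g ξ)
          - ∫ ξ in Ioi x, g ξ) / (2 * Complex.I * k) := by
      funext y
      rw [eq_div_iff hne, ← integral_sub _ (integrableOn_Ioi_of_continuous hg hint y),
        ← integral_mul_const]
      · refine integral_congr_ae (Eventually.of_forall fun ξ => ?_)
        simp only
        linear_combination g ξ * mul_expKernel (ξ - y) k
      · have := (integrableOn_Ioi_of_continuous (by fun_prop : Continuous fun ξ : ℝ =>
          Complex.exp (2 * Complex.I * k * ξ) * g ξ) (integrableOn_cexp_mul hg hint hk) y).const_mul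
          (Complex.exp (-(2 * Complex.I * k) * y))
        refine this.congr (Eventually.of_forall fun ξ => ?_)
        simp only
        rw [← mul_assoc, ← Complex.exp_add]
        congr 2
        push_cast; ring
    rw [heq]
    refine (((hasDerivAt_integral_cexp_tail hg hint hk x).sub hG).div_const _).congr_deriv ?_
    field_simp
    ring

theorem integral_cexp_head_eq (g : ℝ → ℂ) (k : ℂ) (x : ℝ) :
    ∫ ξ in (0 : ℝ)..x, Complex.exp (2 * Complex.I * k * (x - ξ : ℝ)) * g ξ
      = Complex.exp (2 * Complex.I * k * x)
        * ∫ ξ in (0 : ℝ)..x, Complex.exp (-(2 * Complex.I * k) * ξ) * g ξ := by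
  rw [← intervalIntegral.integral_const_mul]
  refine intervalIntegral.integral_congr fun ξ _ => ?_
  rw [← mul_assoc, ← Complex.exp_add]
  congr 2
  push_cast; ring

theorem hasDerivAt_intervalIntegral {g : ℝ → ℂ} (hg : Continuous g) (x : ℝ) :
    HasDerivAt (fun x => ∫ ξ in (0 : ℝ)..x, g ξ) (g x) x :=
  intervalIntegral.integral_hasDerivAt_right (hg.intervalIntegrable _ _)
    hg.aestronglyMeasurable.stronglyMeasurableAtFilter hg.continuousAt

theorem hasDerivAt_integral_cexp_head {g : ℝ → ℂ} (hg : Continuous g) (k : ℂ) (x : ℝ) :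
    HasDerivAt (fun x : ℝ => ∫ ξ in (0 : ℝ)..x, Complex.exp (2 * Complex.I * k * (x - ξ : ℝ)) * g ξ)
      (2 * Complex.I * k
        * (∫ ξ in (0 : ℝ)..x, Complex.exp (2 * Complex.I * k * (x - ξ : ℝ)) * g ξ) + g x) x := by
  simp only [integral_cexp_head_eq]
  have h := (hasDerivAt_cexp_mul (2 * Complex.I * k) x).mul (hasDerivAt_intervalIntegral
    (by fun_prop : Continuous fun ξ : ℝ => Complex.exp (-(2 * Complex.I * k) * ξ) * g ξ) x)
  refine h.congr_deriv ?_
  have h2 : Complex.exp (2 * Complex.I * k * x) * Complex.exp (-(2 * Complex.I * k) * x) = 1 := by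
    rw [← Complex.exp_add]; simp
  linear_combination g x * h2

theorem hasDerivAt_integral_expKernel_head {g : ℝ → ℂ} (hg : Continuous g) (k : ℂ) (x : ℝ) :
    HasDerivAt (fun x : ℝ => ∫ ξ in (0 : ℝ)..x, expKernel (x - ξ) k * g ξ)
      (∫ ξ in (0 : ℝ)..x, Complex.exp (2 * Complex.I * k * (x - ξ : ℝ)) * g ξ) x := by
  have hG := hasDerivAt_intervalIntegral hg x
  by_cases h0 : k = 0
  · subst h0
    have hc : Continuous fun ξ : ℝ => (ξ : ℂ) * g ξ := by fun_prop
    have heq : (fun x : ℝ => ∫ ξ in (0 : ℝ)..x, expKernel (x - ξ) 0 * g ξ)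
        = fun x : ℝ => x * (∫ ξ in (0 : ℝ)..x, g ξ) - ∫ ξ in (0 : ℝ)..x, (ξ : ℂ) * g ξ := by
      funext y
      rw [← intervalIntegral.integral_const_mul, ← intervalIntegral.integral_sub
        ((hg.intervalIntegrable _ _).const_mul _) (hc.intervalIntegrable _ _)]
      refine intervalIntegral.integral_congr fun ξ _ => ?_
      simp only [expKernel_zero_right]; push_cast; ring
    rw [heq]
    refine (((Complex.ofRealCLM.hasDerivAt (x := x)).mul hG).sub
      (hasDerivAt_intervalIntegral hc x)).congr_deriv ?_
    simp
  · have hne : 2 * Complex.I * k ≠ 0 := by simp [h0]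
    have heq : (fun x : ℝ => ∫ ξ in (0 : ℝ)..x, expKernel (x - ξ) k * g ξ)
        = fun x : ℝ => ((∫ ξ in (0 : ℝ)..x, Complex.exp (2 * Complex.I * k * (x - ξ : ℝ)) * g ξ)
          - ∫ ξ in (0 : ℝ)..x, g ξ) / (2 * Complex.I * k) := by
      funext y
      rw [eq_div_iff hne, ← intervalIntegral.integral_sub _ (hg.intervalIntegrable _ _),
        ← intervalIntegral.integral_mul_const]
      · refine intervalIntegral.integral_congr fun ξ _ => ?_
        linear_combination g ξ * mul_expKernel (y - ξ) k
      · exact (by fun_prop : Continuous fun ξ : ℝ =>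
          Complex.exp (2 * Complex.I * k * (y - ξ : ℝ)) * g ξ).intervalIntegrable _ _
    rw [heq]
    refine (((hasDerivAt_integral_cexp_head hg k x).sub hG).div_const _).congr_deriv ?_
    field_simp
    ring

/-! ### Solutions of the differential equation -/

/-- `χ` solves `χ'' + (u + k²) χ = 0` on `[0, ∞)`, and `χ'` is its derivative. -/
structure IsEigenfunction (u : ℝ → ℝ) (k : ℂ) (χ χ' : ℝ → ℂ) : Prop where
  deriv_fst : ∀ x, 0 ≤ x → HasDerivWithinAt χ (χ' x) (Ici 0) x
  deriv_snd : ∀ x, 0 ≤ x → HasDerivWithinAt χ' (-((u x : ℂ) + k ^ 2) * χ x) (Ici 0) x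

namespace IsPotential

variable {u : ℝ → ℝ}

theorem integrableOn_abs (hu : IsPotential u) : IntegrableOn (fun x => |u x|) (Ioi 0) := by
  have := hu.cont
  refine Integrable.mono' hu.integrableOn_weight (by fun_prop) ?_
  filter_upwards [ae_restrict_mem measurableSet_Ioi] with ξ hξ
  have := abs_le_weight u (t := 1) (le_of_lt (mem_Ioi.1 hξ)) (by linarith [mem_Ioi.1 hξ])
  simpa using this

theorem integrableOn_mul_jost (hu : IsPotential u) (k : ℂ) :
    IntegrableOn (fun ξ => u ξ * hu.jost (ξ, k)) (Ioi 0) := by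
  have := hu.cont
  refine Integrable.mono' (hu.integrableOn_abs.mul_const ‖hu.jost‖)
    (by fun_prop : Continuous _).aestronglyMeasurable (Eventually.of_forall fun ξ => ?_)
  rw [norm_mul, Complex.norm_real, Real.norm_eq_abs]
  exact mul_le_mul_of_nonneg_left (hu.jost.norm_coe_le_norm _) (abs_nonneg _)

theorem integrableOn_self_mul_mul_jost (hu : IsPotential u) (k : ℂ) :
    IntegrableOn (fun ξ : ℝ => (ξ : ℂ) * (u ξ * hu.jost (ξ, k))) (Ioi 0) := by
  have := hu.cont
  refine Integrable.mono' (hu.integrableOn_weight.mul_const ‖hu.jost‖)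
    (by fun_prop : Continuous _).aestronglyMeasurable ?_
  filter_upwards [ae_restrict_mem measurableSet_Ioi] with ξ hξ
  have hξ' : 0 < ξ := hξ
  rw [norm_mul, norm_mul, Complex.norm_real, Complex.norm_real, Real.norm_eq_abs, Real.norm_eq_abs,
    ← mul_assoc]
  refine mul_le_mul ?_ (hu.jost.norm_coe_le_norm _) (norm_nonneg _) (weight_nonneg u ξ)
  rw [abs_of_pos hξ']
  exact abs_le_weight u hξ'.le (by linarith)

/-- The derivative in `x` of the normalised Jost solution. -/
noncomputable def jostDeriv (hu : IsPotential u) (x : ℝ) (k : ℂ) : ℂ :=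
  ∫ ξ in Ioi x, Complex.exp (2 * Complex.I * k * (ξ - x : ℝ)) * (u ξ * hu.jost (ξ, k))

theorem continuous_mul_jost (hu : IsPotential u) (k : ℂ) :
    Continuous fun ξ : ℝ => (u ξ : ℂ) * hu.jost (ξ, k) := by
  have := hu.cont
  fun_prop

theorem hasDerivWithinAt_jost (hu : IsPotential u) {k : ℂ} (hk : 0 ≤ k.im) {x : ℝ} (hx : 0 ≤ x) :
    HasDerivWithinAt (fun x => hu.jost (x, k)) (hu.jostDeriv x k) (Ici 0) x := by
  have h := ((hasDerivAt_integral_expKernel_tail (hu.continuous_mul_jost k)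
    (hu.integrableOn_mul_jost k) (hu.integrableOn_self_mul_mul_jost k) hk x).const_sub 1)
  rw [neg_neg] at h
  refine h.hasDerivWithinAt.congr (fun y hy => ?_) ?_
  · simp only [hu.jost_eqn (mem_Ici.1 hy) hk, mul_assoc]
  · simp only [hu.jost_eqn hx hk, mul_assoc]

theorem hasDerivAt_jostDeriv (hu : IsPotential u) {k : ℂ} (hk : 0 ≤ k.im) (x : ℝ) :
    HasDerivAt (fun x => hu.jostDeriv x k)
      (-(2 * Complex.I * k) * hu.jostDeriv x k - u x * hu.jost (x, k)) x :=
  hasDerivAt_integral_cexp_tail (hu.continuous_mul_jost k) (hu.integrableOn_mul_jost k) hk x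

/-- The derivative in `x` of the Jost solution. -/
noncomputable def psiDeriv (hu : IsPotential u) (x : ℝ) (k : ℂ) : ℂ :=
  Complex.exp (Complex.I * k * x) * (Complex.I * k * hu.jost (x, k) + hu.jostDeriv x k)

theorem isEigenfunction_psi (hu : IsPotential u) {k : ℂ} (hk : 0 ≤ k.im) :
    IsEigenfunction u k (fun x => psi u x k) (fun x => hu.psiDeriv x k) where
  deriv_fst x hx := by
    have h := (hasDerivAt_cexp_mul (Complex.I * k) x).hasDerivWithinAt.mul
      (hu.hasDerivWithinAt_jost hk hx)
    refine (h.congr (fun y hy => hu.psi_eq hk hy) (hu.psi_eq hk hx)).congr_deriv ?_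
    rw [psiDeriv]; ring
  deriv_snd x hx := by
    have h := (hasDerivAt_cexp_mul (Complex.I * k) x).hasDerivWithinAt.mul
      (((hu.hasDerivWithinAt_jost hk hx).const_mul (Complex.I * k)).add
      (hu.hasDerivAt_jostDeriv hk x).hasDerivWithinAt)
    refine h.congr_deriv ?_
    rw [hu.psi_eq hk hx]
    simp only [Pi.add_apply]
    linear_combination (Complex.exp (Complex.I * k * x) * hu.jost (x, k) * k ^ 2) * Complex.I_mul_I

theorem psiX0_eq (hu : IsPotential u) {k : ℂ} (hk : 0 ≤ k.im) :
    psiX0 u k = Complex.I * k * hu.jost (0, k) + hu.jostDeriv 0 k := by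
  have := ((hu.isEigenfunction_psi hk).deriv_fst 0 le_rfl).derivWithin
    (uniqueDiffOn_Ici (0 : ℝ) 0 self_mem_Ici)
  rw [psiX0, this, psiDeriv]; simp

theorem psi_zero_eq (hu : IsPotential u) {k : ℂ} (hk : 0 ≤ k.im) : psi u 0 k = hu.jost (0, k) := by
  rw [hu.psi_eq hk le_rfl]; simp

/-! ### Bounds for the Jost solution -/

theorem norm_exp_I_mul (k : ℂ) (x : ℝ) :
    ‖Complex.exp (Complex.I * k * x)‖ = Real.exp (-(k.im * x)) := by
  rw [Complex.norm_exp]; simp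

theorem norm_psi_le (hu : IsPotential u) {k : ℂ} (hk : 0 ≤ k.im) {x : ℝ} (hx : 0 ≤ x) :
    ‖psi u x k‖ ≤ ‖hu.jost‖ * Real.exp (-(k.im * x)) := by
  rw [hu.psi_eq hk hx, norm_mul, norm_exp_I_mul, mul_comm]
  exact mul_le_mul_of_nonneg_right (hu.jost.norm_coe_le_norm _) (Real.exp_pos _).le

theorem norm_jostDeriv_le_tail (hu : IsPotential u) {k : ℂ} (hk : 0 ≤ k.im) {x : ℝ} (hx : 0 ≤ x) :
    ‖hu.jostDeriv x k‖ ≤ (∫ ξ in Ioi x, weight u ξ) * ‖hu.jost‖ := by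
  rw [← integral_mul_const]
  refine norm_integral_le_of_norm_le
    ((hu.integrableOn_weight.mono_set (Ioi_subset_Ioi hx)).mul_const _) ?_
  filter_upwards [ae_restrict_mem measurableSet_Ioi] with ξ hξ
  have hξ' : x < ξ := hξ
  rw [norm_mul, norm_mul, Complex.norm_real, Real.norm_eq_abs, ← mul_assoc]
  refine mul_le_mul ?_ (hu.jost.norm_coe_le_norm _) (norm_nonneg _) (weight_nonneg u ξ)
  refine (mul_le_mul_of_nonneg_right (norm_exp_two_I_mul_le_one hk (by linarith))
      (abs_nonneg _)).trans (abs_le_weight u (by linarith) (by linarith))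

theorem norm_jost_sub_one_le_tail (hu : IsPotential u) {k : ℂ} (hk : 0 ≤ k.im) {x : ℝ}
    (hx : 0 ≤ x) : ‖hu.jost (x, k) - 1‖ ≤ (∫ ξ in Ioi x, weight u ξ) * ‖hu.jost‖ := by
  rw [hu.jost_eqn hx hk, sub_sub_cancel_left, norm_neg, ← integral_mul_const]
  refine norm_integral_le_of_norm_le
    ((hu.integrableOn_weight.mono_set (Ioi_subset_Ioi hx)).mul_const _) ?_
  filter_upwards [ae_restrict_mem measurableSet_Ioi] with ξ hξ
  have hξ' : x < ξ := hξ
  rw [norm_mul, norm_mul, Complex.norm_real, Real.norm_eq_abs]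
  refine mul_le_mul ?_ (hu.jost.norm_coe_le_norm _) (norm_nonneg _) (weight_nonneg u ξ)
  refine (mul_le_mul_of_nonneg_right (norm_expKernel_le (by linarith) hk)
      (abs_nonneg _)).trans (abs_le_weight u (by linarith) (by linarith))

/-- Same integral as before, estimated with the `1 / ‖k‖` bound for the kernel: the normalised Jost
solution tends to 1 as `k → ∞`, uniformly in `x`. -/
theorem norm_mul_norm_jost_sub_one_le (hu : IsPotential u) {k : ℂ} (hk : 0 ≤ k.im) {x : ℝ}
    (hx : 0 ≤ x) :
    ‖k‖ * ‖hu.jost (x, k) - 1‖ ≤ (∫ ξ in Ioi (0 : ℝ), weight u ξ) * ‖hu.jost‖ := by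
  have h1 : ‖k‖ * ‖hu.jost (x, k) - 1‖ ≤ (∫ ξ in Ioi x, weight u ξ) * ‖hu.jost‖ := by
    rw [hu.jost_eqn hx hk, sub_sub_cancel_left, norm_neg, ← norm_mul, ← integral_const_mul,
      ← integral_mul_const]
    refine norm_integral_le_of_norm_le
      ((hu.integrableOn_weight.mono_set (Ioi_subset_Ioi hx)).mul_const _) ?_
    filter_upwards [ae_restrict_mem measurableSet_Ioi] with ξ hξ
    have hξ' : x < ξ := hξ
    rw [norm_mul, norm_mul, norm_mul, Complex.norm_real, Real.norm_eq_abs, ← mul_assoc,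
      ← mul_assoc]
    refine mul_le_mul ?_ (hu.jost.norm_coe_le_norm _) (norm_nonneg _) (weight_nonneg u ξ)
    refine (mul_le_mul_of_nonneg_right (norm_mul_norm_expKernel_le (by linarith) hk)
      (abs_nonneg _)).trans (abs_le_weight u (by linarith) (by linarith))
  refine h1.trans (mul_le_mul_of_nonneg_right ?_ (norm_nonneg _))
  exact setIntegral_mono_set hu.integrableOn_weight
    (Eventually.of_forall fun ξ => weight_nonneg u ξ) (Ioi_subset_Ioi hx).eventuallyLE

theorem tendsto_integral_weight_tail (hu : IsPotential u) :
    Tendsto (fun x => ∫ ξ in Ioi x, weight u ξ) atTop (𝓝 0) := by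
  have h : ∀ x, ∫ ξ in Ioi x, weight u ξ
      = (∫ ξ in Ioi (0 : ℝ), weight u ξ) - ∫ ξ in (0 : ℝ)..x, weight u ξ := by
    intro x
    rw [eq_sub_iff_add_eq, add_comm]
    refine intervalIntegral.integral_interval_add_Ioi'
      (hu.continuous_weight.intervalIntegrable _ _) ?_
    rcases le_total 0 x with h | h
    · exact hu.integrableOn_weight.mono_set (Ioi_subset_Ioi h)
    · rw [← Ioc_union_Ioi_eq_Ioi h]
      exact hu.continuous_weight.integrableOn_Ioc.union hu.integrableOn_weight
  have h2 := (intervalIntegral_tendsto_integral_Ioi 0 hu.integrableOn_weight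
    tendsto_id).const_sub (∫ ξ in Ioi (0 : ℝ), weight u ξ)
  rw [sub_self] at h2
  exact h2.congr fun x => (h x).symm

/-- A bound for the derivative of the Jost solution. -/
theorem exists_norm_jostDeriv_le (hu : IsPotential u) :
    ∃ C, 0 ≤ C ∧ ∀ x k, 0 ≤ x → 0 ≤ k.im → ‖hu.jostDeriv x k‖ ≤ C := by
  refine ⟨(∫ ξ in Ioi (0 : ℝ), weight u ξ) * ‖hu.jost‖, mul_nonneg
    (setIntegral_nonneg measurableSet_Ioi fun ξ _ => weight_nonneg u ξ) (norm_nonneg _),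
    fun x k hx hk => (hu.norm_jostDeriv_le_tail hk hx).trans ?_⟩
  refine mul_le_mul_of_nonneg_right ?_ (norm_nonneg _)
  exact setIntegral_mono_set hu.integrableOn_weight
    (Eventually.of_forall fun ξ => weight_nonneg u ξ) (Ioi_subset_Ioi hx).eventuallyLE

theorem continuousOn_jostDeriv_zero (hu : IsPotential u) :
    ContinuousOn (hu.jostDeriv 0) {k | 0 ≤ k.im} := by
  have hc := hu.cont
  refine continuousOn_of_dominated (bound := fun ξ => weight u ξ * ‖hu.jost‖) (fun k _ => ?_)
    (fun k hk => ?_) (hu.integrableOn_weight.mul_const _) (Eventually.of_forall fun ξ => ?_)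
  · exact (by fun_prop : Continuous _).aestronglyMeasurable
  · filter_upwards [ae_restrict_mem measurableSet_Ioi] with ξ hξ
    have hξ' : 0 < ξ := hξ
    rw [norm_mul, norm_mul, Complex.norm_real, Real.norm_eq_abs, ← mul_assoc]
    refine mul_le_mul ?_ (hu.jost.norm_coe_le_norm _) (norm_nonneg _) (weight_nonneg u ξ)
    exact (mul_le_mul_of_nonneg_right (norm_exp_two_I_mul_le_one hk (by linarith))
      (abs_nonneg _)).trans (abs_le_weight u (by linarith) (by linarith))
  · exact (by fun_prop : Continuous _).continuousOn

theorem differentiableOn_jostDeriv_zero (hu : IsPotential u) :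
    DifferentiableOn ℂ (hu.jostDeriv 0) {k | 0 < k.im} := by
  have hc := hu.cont
  refine differentiableOn_integral_of_dominated
    (isOpen_lt continuous_const Complex.continuous_im)
    (bound := fun ξ => weight u ξ * ‖hu.jost‖) (fun k _ => ?_)
    ?_ (hu.integrableOn_weight.mul_const _) (Eventually.of_forall fun ξ => ?_)
  · exact (by fun_prop : Continuous _).aestronglyMeasurable
  · filter_upwards [ae_restrict_mem measurableSet_Ioi] with ξ hξ k hk
    have hξ' : 0 < ξ := hξ
    rw [norm_mul, norm_mul, Complex.norm_real, Real.norm_eq_abs, ← mul_assoc]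
    refine mul_le_mul ?_ (hu.jost.norm_coe_le_norm _) (norm_nonneg _) (weight_nonneg u ξ)
    exact (mul_le_mul_of_nonneg_right (norm_exp_two_I_mul_le_one (le_of_lt hk) (by linarith))
      (abs_nonneg _)).trans (abs_le_weight u (by linarith) (by linarith))
  · refine DifferentiableOn.mul ?_ ((hu.differentiableOn_jost ξ).const_mul _)
    exact (by fun_prop : Differentiable ℂ fun k : ℂ =>
      Complex.exp (2 * Complex.I * k * (ξ - 0 : ℝ))).differentiableOn

/-! ### Solutions normalised at the origin -/

/-- The inhomogeneous term for the initial values `χ(0) = a`, `χ'(0) = c - ika`. -/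
noncomputable def headData (a c : ℂ) : ℝ × ℂ →ᵇ ℂ :=
  BoundedContinuousFunction.ofNormedAddCommGroup
    (fun p => (a + c * expKernel (max p.1 0) (upperClamp p.2)) / ((1 + max p.1 0 : ℝ) : ℂ))
    (by
      have h1 := continuous_expKernel
      have h2 := continuous_upperClamp
      have h3 : Continuous fun p : ℝ × ℂ => expKernel (max p.1 0) (upperClamp p.2) :=
        h1.comp (by fun_prop : Continuous fun p : ℝ × ℂ => (max p.1 0, upperClamp p.2))
      refine Continuous.div (by fun_prop) (by fun_prop) fun p => ?_
      have := le_max_right p.1 0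
      exact_mod_cast (by linarith : 1 + max p.1 0 ≠ 0))
    (‖a‖ + ‖c‖)
    (by
      intro p
      have h0 := le_max_right p.1 0
      rw [norm_div, Complex.norm_real, Real.norm_of_nonneg (by linarith), div_le_iff₀ (by linarith)]
      refine (norm_add_le _ _).trans ?_
      rw [norm_mul]
      have h1 := mul_le_mul_of_nonneg_left
        (norm_expKernel_le h0 (upperClamp_im_nonneg p.2)) (norm_nonneg c)
      nlinarith [norm_nonneg a, norm_nonneg c])

theorem exists_head (hu : IsPotential u) (a c : ℂ) : ∃ ρ : ℝ × ℂ →ᵇ ℂ,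
    (∀ x k, ρ (x, k) = headData a c (x, k)
      - ∫ ξ in Ioi (0 : ℝ), headKernel u x ξ k * ρ (ξ, k)) ∧
    ∀ x, DifferentiableOn ℂ (fun k => ρ (x, k)) {k | 0 < k.im} :=
  hu.isContractiveKernel_headKernel.exists_solution _ fun x => by
    have := (((differentiable_expKernel (max x 0)).differentiableOn.comp_upperClamp).const_mul
      c).const_add a
    exact this.div_const ((1 + max x 0 : ℝ) : ℂ)

/-- `e^{ikx} χ(x,k) / (1 + x)` for the solution with `χ(0) = a`, `χ'(0) = c - ika`. -/
noncomputable def head (hu : IsPotential u) (a c : ℂ) : ℝ × ℂ →ᵇ ℂ := (hu.exists_head a c).choose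

/-- `e^{ikx} χ(x,k)` for the solution with `χ(0) = a`, `χ'(0) = c - ika`. -/
noncomputable def regNormalized (hu : IsPotential u) (a c : ℂ) (x : ℝ) (k : ℂ) : ℂ :=
  ((1 + max x 0 : ℝ) : ℂ) * hu.head a c (x, k)

theorem continuous_regNormalized (hu : IsPotential u) (a c : ℂ) :
    Continuous fun p : ℝ × ℂ => hu.regNormalized a c p.1 p.2 := by
  unfold regNormalized
  fun_prop

theorem differentiableOn_regNormalized (hu : IsPotential u) (a c : ℂ) (x : ℝ) :
    DifferentiableOn ℂ (hu.regNormalized a c x) {k | 0 < k.im} :=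
  ((hu.exists_head a c).choose_spec.2 x).const_mul _

theorem regNormalized_eqn (hu : IsPotential u) (a c : ℂ) {x : ℝ} {k : ℂ} (hx : 0 ≤ x)
    (hk : 0 ≤ k.im) : hu.regNormalized a c x k = a + c * expKernel x k
      - ∫ ξ in (0 : ℝ)..x, expKernel (x - ξ) k * (u ξ * hu.regNormalized a c ξ k) := by
  have hne : ((1 + x : ℝ) : ℂ) ≠ 0 := by exact_mod_cast (by linarith : 1 + x ≠ 0)
  have h1 : headData a c (x, k) = (a + c * expKernel x k) / ((1 + x : ℝ) : ℂ) := by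
    change (a + c * expKernel (max x 0) (upperClamp k)) / ((1 + max x 0 : ℝ) : ℂ) = _
    rw [max_eq_left hx, upperClamp_of_nonneg hk]
  rw [regNormalized, max_eq_left hx]
  conv_lhs => rw [head, (hu.exists_head a c).choose_spec.1 x k, h1]
  rw [mul_sub, mul_div_cancel₀ _ hne, ← integral_const_mul]
  congr 1
  refine setIntegral_Ioi_eq_intervalIntegral hx (fun ξ h => ?_) fun ξ h0 h => ?_
  · rw [headKernel_eq_zero u (by rw [max_eq_left hx]; exact h.le), zero_mul, mul_zero]
  · rw [headKernel, max_eq_left hx, max_eq_left (by linarith), upperClamp_of_nonneg hk,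
      regNormalized, max_eq_left h0.le, abs_of_pos h0]
    change _ * (_ * hu.head a c (ξ, k)) = _
    push_cast at hne ⊢
    field_simp

theorem norm_regNormalized_le (hu : IsPotential u) (a c : ℂ) {x : ℝ} (hx : 0 ≤ x) (k : ℂ) :
    ‖hu.regNormalized a c x k‖ ≤ (1 + x) * ‖hu.head a c‖ := by
  rw [regNormalized, max_eq_left hx, norm_mul, Complex.norm_real, Real.norm_of_nonneg (by linarith)]
  exact mul_le_mul_of_nonneg_left ((hu.head a c).norm_coe_le_norm _) (by linarith)

/-- The solution with `χ(0) = a`, `χ'(0) = c - ika`. -/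
noncomputable def reg (hu : IsPotential u) (a c : ℂ) (x : ℝ) (k : ℂ) : ℂ :=
  Complex.exp (-(Complex.I * k) * x) * hu.regNormalized a c x k

/-- The derivative in `x` of `reg`. -/
noncomputable def regDeriv (hu : IsPotential u) (a c : ℂ) (x : ℝ) (k : ℂ) : ℂ :=
  Complex.exp (-(Complex.I * k) * x) * (-(Complex.I * k) * hu.regNormalized a c x k
    + (c * Complex.exp (2 * Complex.I * k * x)
      - ∫ ξ in (0 : ℝ)..x, Complex.exp (2 * Complex.I * k * (x - ξ : ℝ))
        * (u ξ * hu.regNormalized a c ξ k)))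

theorem isEigenfunction_reg (hu : IsPotential u) (a c : ℂ) {k : ℂ} (hk : 0 ≤ k.im) :
    IsEigenfunction u k (fun x => hu.reg a c x k) (fun x => hu.regDeriv a c x k) := by
  have hc : Continuous fun ξ : ℝ => (u ξ : ℂ) * hu.regNormalized a c ξ k := by
    have h1 := hu.cont
    have h2 := (hu.continuous_regNormalized a c).comp (by fun_prop : Continuous fun ξ : ℝ => (ξ, k))
    exact (Complex.continuous_ofReal.comp h1).mul h2
  have hN : ∀ x : ℝ, 0 ≤ x → HasDerivWithinAt (fun x : ℝ => hu.regNormalized a c x k)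
      (c * Complex.exp (2 * Complex.I * k * x)
      - ∫ ξ in (0 : ℝ)..x, Complex.exp (2 * Complex.I * k * (x - ξ : ℝ))
        * (u ξ * hu.regNormalized a c ξ k)) (Ici 0) x := by
    intro x hx
    have h := (((hasDerivAt_expKernel x k).const_mul c).const_add a).sub
      (hasDerivAt_integral_expKernel_head hc k x)
    exact h.hasDerivWithinAt.congr (fun y hy => hu.regNormalized_eqn a c hy hk)
      (hu.regNormalized_eqn a c hx hk)
  refine ⟨fun x hx => ?_, fun x hx => ?_⟩
  · refine ((hasDerivAt_cexp_mul (-(Complex.I * k)) x).hasDerivWithinAt.mul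
      (hN x hx)).congr_deriv ?_
    rw [regDeriv]; ring
  · have h := (hasDerivAt_cexp_mul (-(Complex.I * k)) x).hasDerivWithinAt.mul
      (((hN x hx).const_mul (-(Complex.I * k))).add
        (((hasDerivAt_cexp_mul (2 * Complex.I * k) x).const_mul c).sub
          (hasDerivAt_integral_cexp_head hc k x)).hasDerivWithinAt)
    refine h.congr_deriv ?_
    simp only [Pi.add_apply, Pi.sub_apply, reg]
    linear_combination (Complex.exp (-(Complex.I * k) * x) * hu.regNormalized a c x k * k ^ 2)
      * Complex.I_mul_I

theorem reg_zero (hu : IsPotential u) (a c : ℂ) {k : ℂ} (hk : 0 ≤ k.im) : hu.reg a c 0 k = a := by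
  rw [reg, hu.regNormalized_eqn a c le_rfl hk]; simp

theorem regDeriv_zero (hu : IsPotential u) (a c : ℂ) {k : ℂ} (hk : 0 ≤ k.im) :
    hu.regDeriv a c 0 k = c - Complex.I * k * a := by
  rw [regDeriv, hu.regNormalized_eqn a c le_rfl hk]; simp; ring

end IsPotential

/-! ### Wronskian identities and uniqueness for the initial value problem. -/

namespace IsEigenfunction

variable {u : ℝ → ℝ} {k l : ℂ} {χ χ' η η' : ℝ → ℂ}

theorem continuousOn (h : IsEigenfunction u k χ χ') : ContinuousOn χ (Ici 0) :=
  fun x hx => (h.deriv_fst x hx).continuousWithinAt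

theorem continuousOn_deriv (h : IsEigenfunction u k χ χ') : ContinuousOn χ' (Ici 0) :=
  fun x hx => (h.deriv_snd x hx).continuousWithinAt

theorem hasDerivAt (h : IsEigenfunction u k χ χ') {x : ℝ} (hx : 0 < x) :
    HasDerivAt χ (χ' x) x :=
  (h.deriv_fst x hx.le).hasDerivAt (Ici_mem_nhds hx)

theorem hasDerivAt_deriv (h : IsEigenfunction u k χ χ') {x : ℝ} (hx : 0 < x) :
    HasDerivAt χ' (-((u x : ℂ) + k ^ 2) * χ x) x :=
  (h.deriv_snd x hx.le).hasDerivAt (Ici_mem_nhds hx)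

theorem linear (h : IsEigenfunction u k χ χ') (h' : IsEigenfunction u k η η') (a b : ℂ) :
    IsEigenfunction u k (fun x => a * χ x + b * η x) (fun x => a * χ' x + b * η' x) where
  deriv_fst x hx := ((h.deriv_fst x hx).const_mul a).add ((h'.deriv_fst x hx).const_mul b)
  deriv_snd x hx := (((h.deriv_snd x hx).const_mul a).add
    ((h'.deriv_snd x hx).const_mul b)).congr_deriv (by ring)

theorem of_sq_eq (h : IsEigenfunction u k χ χ') (hkl : k ^ 2 = l ^ 2) :
    IsEigenfunction u l χ χ' := ⟨h.deriv_fst, fun x hx => hkl ▸ h.deriv_snd x hx⟩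

theorem map_conj (h : IsEigenfunction u k χ χ') :
    IsEigenfunction u (conj k) (fun x => conj (χ x)) (fun x => conj (χ' x)) where
  deriv_fst x hx := (h.deriv_fst x hx).star
  deriv_snd x hx := (h.deriv_snd x hx).star.congr_deriv (by simp)

/-- The Wronskian `χ η' - χ' η` has derivative `(k² - l²) χ η`, the potential cancelling. -/
theorem wronskian_integral (h : IsEigenfunction u k χ χ') (h' : IsEigenfunction u l η η')
    {a b : ℝ} (ha : 0 ≤ a) (hab : a ≤ b) :
    ∫ x in a..b, (k ^ 2 - l ^ 2) * (χ x * η x)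
      = (χ b * η' b - χ' b * η b) - (χ a * η' a - χ' a * η a) := by
  have hsub : Icc a b ⊆ Ici 0 := fun x hx => ha.trans hx.1
  refine intervalIntegral.integral_eq_sub_of_hasDerivAt_of_le
    (f := fun x => χ x * η' x - χ' x * η x) hab ?_ (fun x hx => ?_) ?_
  · exact ((h.continuousOn.mul h'.continuousOn_deriv).sub
      (h.continuousOn_deriv.mul h'.continuousOn)).mono hsub
  · have hx0 : 0 < x := ha.trans_lt hx.1
    exact (((h.hasDerivAt hx0).mul (h'.hasDerivAt_deriv hx0)).sub
      ((h.hasDerivAt_deriv hx0).mul (h'.hasDerivAt hx0))).congr_deriv (by ring)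
  · refine ContinuousOn.intervalIntegrable ?_
    rw [uIcc_of_le hab]
    exact ((continuousOn_const.mul (h.continuousOn.mul h'.continuousOn))).mono hsub

/-- On `[0, X]` the potential is bounded, so the first order system for `(χ, χ')` is Lipschitz and
the zero solution is the only one with zero initial data. -/
theorem eq_zero (h : IsEigenfunction u k χ χ') (hu : Continuous u) (h0 : χ 0 = 0)
    (h0' : χ' 0 = 0) : ∀ x, 0 ≤ x → χ x = 0 := by
  intro X hX
  obtain ⟨B, hB⟩ := (isCompact_Icc (a := 0) (b := X)).exists_bound_of_continuousOn
    (f := fun x => ((u x : ℂ) + k ^ 2)) (by fun_prop)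
  let v : ℝ → ℂ × ℂ → ℂ × ℂ := fun x p => (p.2, -((u x : ℂ) + k ^ 2) * p.1)
  have hB0 : 0 ≤ B := (norm_nonneg _).trans (hB 0 ⟨le_rfl, hX⟩)
  have hv : ∀ t ∈ Ico 0 X, LipschitzOnWith (B + 1).toNNReal (v t) univ := by
    intro t ht
    refine LipschitzOnWith.of_dist_le_mul fun p _ r _ => ?_
    have h1 : dist p.1 r.1 ≤ dist p r := le_max_left _ _
    have h2 : dist p.2 r.2 ≤ dist p r := le_max_right _ _
    have hd : 0 ≤ dist p r := dist_nonneg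
    have hBt := hB t ⟨ht.1, ht.2.le⟩
    rw [Prod.dist_eq, Real.coe_toNNReal _ (by linarith)]
    refine max_le ?_ ?_
    · simp only [v]
      nlinarith
    · simp only [v]
      rw [dist_eq_norm, ← mul_sub, norm_mul, norm_neg, ← dist_eq_norm]
      have := mul_le_mul hBt h1 dist_nonneg hB0
      linarith
  have hder : ∀ t ∈ Ico 0 X, HasDerivWithinAt (fun x => (χ x, χ' x)) (v t (χ t, χ' t)) (Ici t) t :=
    fun t ht => ((h.deriv_fst t ht.1).prodMk (h.deriv_snd t ht.1)).mono (Ici_subset_Ici.2 ht.1)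
  have key := ODE_solution_unique_of_mem_Icc_right (f := fun x => (χ x, χ' x))
    (g := fun _ => (0, 0)) hv
    ((h.continuousOn.prodMk h.continuousOn_deriv).mono Icc_subset_Ici_self) hder
    (fun _ _ => mem_univ _) continuousOn_const
    (fun t _ => (hasDerivWithinAt_const t (Ici t) ((0, 0) : ℂ × ℂ)).congr_deriv (by ext <;> simp [v]))
    (fun _ _ => mem_univ _) (by simp [h0, h0'])
  exact congrArg Prod.fst (key ⟨hX, le_rfl⟩)

theorem eq_of_init (h : IsEigenfunction u k χ χ') (h' : IsEigenfunction u k η η')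
    (hu : Continuous u) (h0 : χ 0 = η 0) (h0' : χ' 0 = η' 0) : ∀ x, 0 ≤ x → χ x = η x := by
  intro x hx
  have := (h.linear h' 1 (-1)).eq_zero hu (by simp [h0]) (by simp [h0']) x hx
  linear_combination this

end IsEigenfunction

namespace IsPotential

variable {u : ℝ → ℝ}

/-! ### The solution `φ` and the spectral function `a` -/

/-- Causality removes the boundedness assumption of `eq_zero_of_le`: the kernel at `x` sees only `ξ
< x`, so cutting `d` off beyond `X` does not disturb the inequality on `[0, X]`. -/
theorem eqOn_of_head_le (hu : IsPotential u) {k : ℂ} {d : ℝ → ℂ}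
    (hd : ContinuousOn d (Ici 0))
    (hle : ∀ x, 0 ≤ x → ‖d x‖ ≤ ∫ ξ in Ioi (0 : ℝ), ‖headKernel u x ξ k‖ * ‖d ξ‖) :
    ∀ x, 0 ≤ x → d x = 0 := by
  intro X hX
  obtain ⟨C, hC⟩ := (isCompact_Icc (a := 0) (b := X)).exists_bound_of_continuousOn
    (hd.mono Icc_subset_Ici_self)
  have hC0 : 0 ≤ C := (norm_nonneg _).trans (hC 0 ⟨le_rfl, hX⟩)
  have key := hu.isContractiveKernel_headKernel.eq_zero_of_le (k := k) (C := C)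
    (d := (Iic X).indicator d) (fun x hx => ?_) (fun x hx => ?_) X hX
  · simpa using key
  · by_cases h : x ≤ X
    · rw [indicator_of_mem (show x ∈ Iic X from h)]; exact hC x ⟨hx, h⟩
    · simpa [h] using hC0
  · by_cases h : x ≤ X
    · rw [indicator_of_mem (show x ∈ Iic X from h)]
      refine (hle x hx).trans (le_of_eq (integral_congr_ae (Eventually.of_forall fun ξ => ?_)))
      by_cases h2 : ξ ≤ X
      · simp [h2]
      · simp only
        rw [headKernel_eq_zero u (by rw [max_eq_left hx]; linarith)]; simp
    · simp only [h, mem_Iic, not_false_eq_true, indicator_of_notMem, norm_zero]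
      positivity

theorem isPhi_reg (hu : IsPotential u) {k : ℂ} (hk : 0 ≤ k.im) :
    IsPhi u k fun x => hu.reg 1 0 x k where
  continuousOn := (hu.isEigenfunction_reg 1 0 hk).continuousOn
  eqn x hx := by
    simp only [reg]
    rw [hu.regNormalized_eqn 1 0 hx hk, mul_sub, ← intervalIntegral.integral_const_mul, neg_mul]
    congr 1
    · ring
    · refine intervalIntegral.integral_congr fun ξ _ => ?_
      have h2 : Complex.exp (-(Complex.I * k * ((x - ξ : ℝ) : ℂ)))
          * Complex.exp (-(Complex.I * k) * ξ) = Complex.exp (-(Complex.I * k * x)) := by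
        rw [← Complex.exp_add]; congr 1; push_cast; ring
      rw [sinKernel_eq, ← h2]
      ring

theorem normalized_isPhi_eqn {k : ℂ} {χ : ℝ → ℂ} (h : IsPhi u k χ) {x : ℝ} (hx : 0 ≤ x) :
    χ x * Complex.exp (Complex.I * k * x) = 1 - ∫ ξ in (0 : ℝ)..x, expKernel (x - ξ) k
      * (u ξ * (χ ξ * Complex.exp (Complex.I * k * ξ))) := by
  conv_lhs => rw [h.eqn x hx]
  rw [sub_mul, ← Complex.exp_add, neg_add_cancel, Complex.exp_zero,
    ← intervalIntegral.integral_mul_const]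
  congr 1
  refine intervalIntegral.integral_congr fun ξ _ => ?_
  have h2 : Complex.exp (-(Complex.I * k * ((x - ξ : ℝ) : ℂ)))
      * Complex.exp (Complex.I * k * x) = Complex.exp (Complex.I * k * ξ) := by
    rw [← Complex.exp_add]; congr 1; push_cast; ring
  rw [sinKernel_eq, ← h2]
  ring

theorem isPhi_unique (hu : IsPotential u) {k : ℂ} (hk : 0 ≤ k.im) {χ₁ χ₂ : ℝ → ℂ}
    (h₁ : IsPhi u k χ₁) (h₂ : IsPhi u k χ₂) : ∀ x, 0 ≤ x → χ₁ x = χ₂ x := by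
  have hc : ∀ {χ : ℝ → ℂ}, IsPhi u k χ →
      ContinuousOn (fun x : ℝ => χ x * Complex.exp (Complex.I * k * x)) (Ici 0) :=
    fun h => h.continuousOn.mul (by fun_prop)
  have hi : ∀ {χ : ℝ → ℂ} {x : ℝ}, IsPhi u k χ → 0 ≤ x → IntervalIntegrable
      (fun ξ : ℝ => expKernel (x - ξ) k * (u ξ * (χ ξ * Complex.exp (Complex.I * k * ξ))))
      volume 0 x := by
    intro χ x h hx
    refine ContinuousOn.intervalIntegrable ?_
    rw [uIcc_of_le hx]
    have h1 := hu.cont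
    have h2 := continuous_expKernel.comp (by fun_prop : Continuous fun ξ : ℝ => (x - ξ, k))
    exact h2.continuousOn.mul (ContinuousOn.mul (by fun_prop) ((hc h).mono Icc_subset_Ici_self))
  -- Division by `1 + x` turns the normalised equation into one with kernel `headKernel`.
  have key := hu.eqOn_of_head_le (k := k)
    (d := fun x => (χ₁ x * Complex.exp (Complex.I * k * x)
      - χ₂ x * Complex.exp (Complex.I * k * x)) / ((1 + x : ℝ) : ℂ)) ?_ ?_
  · intro x hx
    have h := key x hx
    have hne : ((1 + x : ℝ) : ℂ) ≠ 0 := by exact_mod_cast (by linarith : 1 + x ≠ 0)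
    rw [div_eq_zero_iff, or_iff_left hne, ← sub_mul, mul_eq_zero,
      or_iff_left (Complex.exp_ne_zero _)] at h
    exact sub_eq_zero.1 h
  · refine ContinuousOn.div ((hc h₁).sub (hc h₂)) (by fun_prop) fun x hx => ?_
    have : (0 : ℝ) ≤ x := hx
    exact_mod_cast (by linarith : 1 + x ≠ 0)
  · intro x hx
    have hne : ((1 + x : ℝ) : ℂ) ≠ 0 := by exact_mod_cast (by linarith : 1 + x ≠ 0)
    have heq : (χ₁ x * Complex.exp (Complex.I * k * x)
          - χ₂ x * Complex.exp (Complex.I * k * x)) / ((1 + x : ℝ) : ℂ)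
        = -∫ ξ in Ioi (0 : ℝ), headKernel u x ξ k
          * ((χ₁ ξ * Complex.exp (Complex.I * k * ξ)
            - χ₂ ξ * Complex.exp (Complex.I * k * ξ)) / ((1 + ξ : ℝ) : ℂ)) := by
      rw [div_eq_iff hne, normalized_isPhi_eqn h₁ hx, normalized_isPhi_eqn h₂ hx,
        sub_sub_sub_cancel_left, ← intervalIntegral.integral_sub (hi h₂ hx) (hi h₁ hx),
        ← integral_neg, ← integral_mul_const]
      symm
      refine setIntegral_Ioi_eq_intervalIntegral hx (fun ξ h => ?_) fun ξ h0 h => ?_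
      · rw [headKernel_eq_zero u (by rw [max_eq_left hx]; exact h.le)]; simp
      · rw [headKernel, max_eq_left hx, max_eq_left (by linarith), upperClamp_of_nonneg hk,
          abs_of_pos h0]
        have hne' : ((1 + ξ : ℝ) : ℂ) ≠ 0 := by exact_mod_cast (by linarith : 1 + ξ ≠ 0)
        push_cast at hne hne' ⊢
        field_simp
        ring
    simp only [heq, norm_neg, ← norm_mul]
    exact norm_integral_le_integral_norm _

theorem phi_eq (hu : IsPotential u) {k : ℂ} (hk : 0 ≤ k.im) {x : ℝ} (hx : 0 ≤ x) :
    phi u x k = hu.reg 1 0 x k := by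
  have hex : ∃ χ, IsPhi u k χ := ⟨_, hu.isPhi_reg hk⟩
  rw [phi, dif_pos hex]
  exact hu.isPhi_unique hk hex.choose_spec (hu.isPhi_reg hk) x hx

theorem phi_zero (hu : IsPotential u) {k : ℂ} (hk : 0 ≤ k.im) : phi u 0 k = 1 := by
  rw [hu.phi_eq hk le_rfl, hu.reg_zero 1 0 hk]

theorem phiX0_eq (hu : IsPotential u) {k : ℂ} (hk : 0 ≤ k.im) : phiX0 u k = -(Complex.I * k) := by
  have h := ((hu.isEigenfunction_reg 1 0 hk).deriv_fst 0 le_rfl).congr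
    (fun y hy => hu.phi_eq hk hy) (hu.phi_eq hk le_rfl)
  rw [phiX0, h.derivWithin (uniqueDiffOn_Ici (0 : ℝ) 0 self_mem_Ici), hu.regDeriv_zero 1 0 hk]
  simp

theorem specA_eq (hu : IsPotential u) {k : ℂ} (hk : 0 ≤ k.im) :
    specA u k = (psiX0 u k + Complex.I * k * psi u 0 k) / (2 * Complex.I * k) := by
  rw [specA, hu.phi_zero hk, hu.phiX0_eq hk]
  ring

/-! ### Symmetry and the Wronskian of `ψ` -/

/-- Since `u` is real, conjugating the Volterra equation at `k` gives the one at `-conj k`;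
uniqueness concludes. -/
theorem psi_neg_conj (hu : IsPotential u) {k : ℂ} (hk : 0 ≤ k.im) {x : ℝ} (hx : 0 ≤ x) :
    psi u x (-conj k) = conj (psi u x k) := by
  have hk' : 0 ≤ (-conj k).im := by simpa using hk
  have h := hu.isPsi_jost hk
  have he : ∀ x : ℝ, Complex.exp (-(Complex.I * -conj k * x))
      = conj (Complex.exp (-(Complex.I * k * x))) := by
    intro x
    rw [← Complex.exp_conj]
    simp
  have h2 : IsPsi u (-conj k)
      fun x => conj (Complex.exp (Complex.I * k * x) * hu.jost (x, k)) := by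
    refine ⟨h.continuousOn.star, ?_, fun x hx => ?_⟩
    · obtain ⟨C, hC⟩ := h.bounded
      refine ⟨C, fun x hx => ?_⟩
      rw [he, ← map_mul, RCLike.norm_conj]
      exact hC x hx
    · conv_lhs => rw [h.eqn x hx]
      rw [map_add, ← integral_conj, ← Complex.exp_conj]
      congr 1
      · simp
      · refine integral_congr_ae (Eventually.of_forall fun ξ => ?_)
        simp only [map_mul, Complex.conj_ofReal]
        congr 2
        unfold sinKernel
        by_cases h0 : k = 0
        · simp [h0]
        · rw [if_neg h0, if_neg (by simpa using h0), map_div₀, ← Complex.sin_conj]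
          simp [Complex.sin_neg]
  rw [psi, dif_pos ⟨_, h2⟩, hu.psi_eq hk hx]
  exact hu.isPsi_unique hk' (Exists.choose_spec (⟨_, h2⟩ : ∃ χ, IsPsi u (-conj k) χ)) h2 x hx

theorem psiDeriv_neg_conj (hu : IsPotential u) {k : ℂ} (hk : 0 ≤ k.im) {x : ℝ} (hx : 0 ≤ x) :
    hu.psiDeriv x (-conj k) = conj (hu.psiDeriv x k) := by
  have hk' : 0 ≤ (-conj k).im := by simpa using hk
  have h1 := (hu.isEigenfunction_psi hk').deriv_fst x hx
  have h2 := (hu.isEigenfunction_psi hk).map_conj.deriv_fst x hx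
  exact (uniqueDiffOn_Ici (0 : ℝ) x hx).eq_deriv _ h1
    (h2.congr (fun y hy => hu.psi_neg_conj hk hy) (hu.psi_neg_conj hk hx))

theorem psiX0_eq_psiDeriv (hu : IsPotential u) {k : ℂ} (hk : 0 ≤ k.im) :
    psiX0 u k = hu.psiDeriv 0 k := by
  rw [hu.psiX0_eq hk, psiDeriv]; simp

theorem tendsto_jost (hu : IsPotential u) {k : ℂ} (hk : 0 ≤ k.im) :
    Tendsto (fun x => hu.jost (x, k)) atTop (𝓝 1) := by
  rw [tendsto_iff_norm_sub_tendsto_zero]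
  have h := hu.tendsto_integral_weight_tail.mul_const ‖hu.jost‖
  rw [zero_mul] at h
  refine squeeze_zero' (Eventually.of_forall fun x => norm_nonneg _) ?_ h
  filter_upwards [eventually_ge_atTop 0] with x hx using hu.norm_jost_sub_one_le_tail hk hx

theorem tendsto_jostDeriv (hu : IsPotential u) {k : ℂ} (hk : 0 ≤ k.im) :
    Tendsto (fun x => hu.jostDeriv x k) atTop (𝓝 0) := by
  rw [tendsto_zero_iff_norm_tendsto_zero]
  have h := hu.tendsto_integral_weight_tail.mul_const ‖hu.jost‖
  rw [zero_mul] at h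
  refine squeeze_zero' (Eventually.of_forall fun x => norm_nonneg _) ?_ h
  filter_upwards [eventually_ge_atTop 0] with x hx using hu.norm_jostDeriv_le_tail hk hx

/-- The Wronskian of `ψ` and its conjugate for real `k`. -/
theorem wronskian_psi_conj (hu : IsPotential u) (k : ℝ) :
    psi u 0 k * conj (hu.psiDeriv 0 k) - hu.psiDeriv 0 k * conj (psi u 0 k)
      = -(2 * Complex.I * k) := by
  have hk : 0 ≤ (k : ℂ).im := by simp
  have h := hu.isEigenfunction_psi hk
  -- For real `k` both functions solve the same equation, so the Wronskian is constant. Its value is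
  -- read off at infinity, where `jost → 1` and `jostDeriv → 0`.
  have hW : ∀ x, 0 ≤ x → psi u x k * conj (hu.psiDeriv x k) - hu.psiDeriv x k * conj (psi u x k)
      = psi u 0 k * conj (hu.psiDeriv 0 k) - hu.psiDeriv 0 k * conj (psi u 0 k) := by
    intro x hx
    have := h.wronskian_integral h.map_conj le_rfl hx
    simp only [Complex.conj_ofReal, sub_self, zero_mul, intervalIntegral.integral_zero] at this
    exact (sub_eq_zero.1 this.symm)
  have hm := hu.tendsto_jost hk
  have hJ := hu.tendsto_jostDeriv hk
  have hcm := (Complex.continuous_conj.tendsto _).comp hm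
  have hD := (hm.const_mul (Complex.I * k)).add hJ
  have hcD := (Complex.continuous_conj.tendsto _).comp hD
  have hlim := (hm.mul hcD).sub (hD.mul hcm)
  refine tendsto_nhds_unique (tendsto_const_nhds.congr' ?_) (hlim.trans_eq ?_)
  · filter_upwards [eventually_ge_atTop 0] with x hx
    rw [← hW x hx, hu.psi_eq hk hx, psiDeriv]
    have he : Complex.exp (Complex.I * k * x) * conj (Complex.exp (Complex.I * k * x)) = 1 := by
      rw [← Complex.exp_conj, ← Complex.exp_add]
      simp
    simp only [Function.comp_apply, map_mul, map_add, Complex.conj_I, Complex.conj_ofReal]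
    linear_combination (-(hu.jost (x, k) * (-Complex.I * k * conj (hu.jost (x, k))
      + conj (hu.jostDeriv x k))) + (Complex.I * k * hu.jost (x, k) + hu.jostDeriv x k)
      * conj (hu.jost (x, k))) * (-he)
  · congr 1
    simp
    ring

/-! ### `ψ(0,k)` does not vanish -/

theorem psi_zero_ne_zero_of_real (hu : IsPotential u) {k : ℝ} (hk : k ≠ 0) : psi u 0 k ≠ 0 := by
  intro h0
  have := hu.wronskian_psi_conj k
  rw [h0] at this
  simp [hk] at this

theorem norm_psiDeriv_le (hu : IsPotential u) {C : ℝ}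
    (hC : ∀ x k, 0 ≤ x → 0 ≤ k.im → ‖hu.jostDeriv x k‖ ≤ C) {k : ℂ} (hk : 0 ≤ k.im) {x : ℝ}
    (hx : 0 ≤ x) : ‖hu.psiDeriv x k‖ ≤ (‖k‖ * ‖hu.jost‖ + C) * Real.exp (-(k.im * x)) := by
  rw [psiDeriv, norm_mul, norm_exp_I_mul, mul_comm]
  refine mul_le_mul_of_nonneg_right ((norm_add_le _ _).trans (add_le_add ?_ (hC x k hx hk)))
    (Real.exp_pos _).le
  rw [norm_mul, norm_mul, Complex.norm_I, one_mul]
  exact mul_le_mul_of_nonneg_left (hu.jost.norm_coe_le_norm _) (norm_nonneg _)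

/-- `ψ(·, l)` and its derivative decay exponentially because `Im l > 0`, which beats any bounded
pair `(χ, χ')`. -/
theorem tendsto_wronskian (hu : IsPotential u) {l : ℂ} (hl : 0 < l.im)
    {χ χ' : ℝ → ℂ} {A B : ℝ} (hA : ∀ x, 0 ≤ x → ‖χ x‖ ≤ A) (hB : ∀ x, 0 ≤ x → ‖χ' x‖ ≤ B) :
    Tendsto (fun x => χ x * hu.psiDeriv x l - χ' x * psi u x l) atTop (𝓝 0) := by
  obtain ⟨C, hC0, hC⟩ := hu.exists_norm_jostDeriv_le
  have hA0 : 0 ≤ A := (norm_nonneg _).trans (hA 0 le_rfl)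
  have hB0 : 0 ≤ B := (norm_nonneg _).trans (hB 0 le_rfl)
  have hexp : Tendsto (fun x => (A * (‖l‖ * ‖hu.jost‖ + C) + B * ‖hu.jost‖)
      * Real.exp (-(l.im * x))) atTop (𝓝 0) := by
    have := (Real.tendsto_exp_neg_atTop_nhds_zero.comp (tendsto_id.const_mul_atTop hl)).const_mul
      (A * (‖l‖ * ‖hu.jost‖ + C) + B * ‖hu.jost‖)
    simpa using this
  refine squeeze_zero_norm' ?_ hexp
  filter_upwards [eventually_ge_atTop 0] with x hx
  refine (norm_sub_le _ _).trans ?_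
  rw [norm_mul, norm_mul]
  have h1 := mul_le_mul (hA x hx) (hu.norm_psiDeriv_le hC hl.le hx) (norm_nonneg _) hA0
  have h2 := mul_le_mul (hB x hx) (hu.norm_psi_le hl.le hx) (norm_nonneg _) hB0
  linarith

/-- Far out the normalised solution is close to 1 uniformly in `k`, so `ψ` has no zeros there. This
makes the integrals of `ψ²` below strictly positive. -/
theorem exists_jost_re_ge (hu : IsPotential u) :
    ∃ X, 0 < X ∧ ∀ x k, X ≤ x → 0 ≤ k.im → 1 / 2 ≤ (hu.jost (x, k)).re := by
  have h := hu.tendsto_integral_weight_tail.mul_const ‖hu.jost‖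
  rw [zero_mul] at h
  obtain ⟨X, hX⟩ := (eventually_atTop.1 (h.eventually (gt_mem_nhds (by norm_num : (0 : ℝ) < 1 / 2))))
  refine ⟨max X 1, by positivity, fun x k hx hk => ?_⟩
  have hx0 : 0 ≤ x := by linarith [le_max_right X 1]
  have h1 := hu.norm_jost_sub_one_le_tail hk hx0
  have h2 := hX x ((le_max_left _ _).trans hx)
  have h3 := (Complex.abs_re_le_norm (hu.jost (x, k) - 1)).trans (h1.trans h2.le)
  rw [Complex.sub_re, Complex.one_re] at h3
  linarith [(abs_le.1 h3).1]

/-- If `ψ(0,k) = 0`, then `ψ` is a decaying Dirichlet eigenfunction with eigenvalue `k²`, which is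
not real. The Wronskian of `conj ψ` and `ψ` equals `(conj k² - k²) ∫_0^x |ψ|²` and tends to 0,
forcing `ψ = 0`; but `ψ` does not vanish far out. -/
theorem psi_zero_ne_zero_of_re_ne_zero (hu : IsPotential u) {k : ℂ} (hk : 0 < k.im)
    (hre : k.re ≠ 0) : psi u 0 k ≠ 0 := by
  intro h0
  have h := hu.isEigenfunction_psi hk.le
  obtain ⟨X, hX0, hX⟩ := hu.exists_jost_re_ge
  set V : ℝ → ℝ := fun x => ∫ t in (0 : ℝ)..x, ‖psi u t k‖ ^ 2
  have hcont : ContinuousOn (fun t => ‖psi u t k‖ ^ 2) (Ici 0) := h.continuousOn.norm.pow 2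
  have hI : ∀ a b, 0 ≤ a → a ≤ b → IntervalIntegrable (fun t => ‖psi u t k‖ ^ 2) volume a b := by
    intro a b ha hab
    refine ContinuousOn.intervalIntegrable ?_
    rw [uIcc_of_le hab]
    exact hcont.mono fun x hx => ha.trans hx.1
  set c : ℂ := conj k ^ 2 - k ^ 2 with hc
  have hc0 : c ≠ 0 := by
    intro h
    have := congrArg Complex.im h
    simp [hc, pow_two] at this
    rcases (by nlinarith : k.re * k.im = 0) |> mul_eq_zero.1 with h | h
    · exact hre h
    · exact hk.ne' h
  have hV : ∀ x, 0 ≤ x → c * V x = conj (psi u x k) * hu.psiDeriv x k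
      - conj (hu.psiDeriv x k) * psi u x k := by
    intro x hx
    have := h.map_conj.wronskian_integral h le_rfl hx
    simp only [h0, map_zero, zero_mul, mul_zero, sub_zero] at this
    rw [← this, intervalIntegral.integral_const_mul]
    congr 1
    rw [← intervalIntegral.integral_ofReal]
    refine intervalIntegral.integral_congr fun t _ => ?_
    rw [Complex.conj_mul']
    push_cast; rfl
  obtain ⟨C, hC0, hC⟩ := hu.exists_norm_jostDeriv_le
  have hlim := hu.tendsto_wronskian hk (χ := fun x => conj (psi u x k))
    (χ' := fun x => conj (hu.psiDeriv x k)) (A := ‖hu.jost‖) (B := ‖k‖ * ‖hu.jost‖ + C)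
    (fun x hx => ?_) (fun x hx => ?_)
  · have hVlim : Tendsto V atTop (𝓝 0) := by
      have h1 : Tendsto (fun x => c * (V x : ℂ)) atTop (𝓝 0) := by
        refine hlim.congr' ?_
        filter_upwards [eventually_ge_atTop 0] with x hx using (hV x hx).symm
      have h2 := h1.const_mul c⁻¹
      simp only [inv_mul_cancel_left₀ hc0, mul_zero] at h2
      simpa [Function.comp_def] using (Complex.continuous_re.tendsto _).comp h2
    have hpos : 0 < V X := by
      refine intervalIntegral.integral_pos hX0 (hcont.mono Icc_subset_Ici_self)
        (fun x _ => by positivity) ⟨X, ⟨hX0.le, le_rfl⟩, ?_⟩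
      have : psi u X k ≠ 0 := by
        rw [hu.psi_eq hk.le hX0.le]
        refine mul_ne_zero (Complex.exp_ne_zero _) fun h => ?_
        have := hX X k le_rfl hk.le
        rw [h] at this
        norm_num at this
      positivity
    have hge : V X ≤ 0 := by
      refine ge_of_tendsto hVlim ?_
      filter_upwards [eventually_ge_atTop X] with x hx
      have h3 : V X + ∫ t in X..x, ‖psi u t k‖ ^ 2 = V x :=
        intervalIntegral.integral_add_adjacent_intervals (hI 0 X le_rfl hX0.le) (hI X x hX0.le hx)
      have h4 : 0 ≤ ∫ t in X..x, ‖psi u t k‖ ^ 2 :=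
        intervalIntegral.integral_nonneg hx fun t _ => by positivity
      linarith
    linarith
  · rw [RCLike.norm_conj]
    refine (hu.norm_psi_le hk.le hx).trans (mul_le_of_le_one_right (norm_nonneg _) ?_)
    exact Real.exp_le_one_iff.2 (by have := mul_nonneg hk.le hx; linarith)
  · rw [RCLike.norm_conj]
    refine (hu.norm_psiDeriv_le hC hk.le hx).trans (mul_le_of_le_one_right (by positivity) ?_)
    exact Real.exp_le_one_iff.2 (by have := mul_nonneg hk.le hx; linarith)

/-! #### The imaginary axis -/

theorem ofReal_re_psi (hu : IsPotential u) {κ : ℝ} (hκ : 0 ≤ κ) {x : ℝ} (hx : 0 ≤ x) :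
    ((psi u x (κ * Complex.I)).re : ℂ) = psi u x (κ * Complex.I) := by
  have h := hu.psi_neg_conj (k := κ * Complex.I) (by simpa using hκ) hx
  rw [map_mul, Complex.conj_I, Complex.conj_ofReal, mul_neg, neg_neg] at h
  exact Complex.conj_eq_iff_re.1 h.symm

theorem ofReal_re_psiDeriv (hu : IsPotential u) {κ : ℝ} (hκ : 0 ≤ κ) {x : ℝ} (hx : 0 ≤ x) :
    ((hu.psiDeriv x (κ * Complex.I)).re : ℂ) = hu.psiDeriv x (κ * Complex.I) := by
  have h := hu.psiDeriv_neg_conj (k := κ * Complex.I) (by simpa using hκ) hx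
  rw [map_mul, Complex.conj_I, Complex.conj_ofReal, mul_neg, neg_neg] at h
  exact Complex.conj_eq_iff_re.1 h.symm

theorem continuousOn_psi_zero (hu : IsPotential u) :
    ContinuousOn (fun k => psi u 0 k) {k | 0 ≤ k.im} :=
  (by fun_prop : Continuous fun k => hu.jost (0, k)).continuousOn.congr
    fun _ hk => hu.psi_zero_eq hk

theorem continuousOn_psiX0 (hu : IsPotential u) :
    ContinuousOn (psiX0 u) {k | 0 ≤ k.im} := by
  refine ContinuousOn.congr (ContinuousOn.add ?_ hu.continuousOn_jostDeriv_zero)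
    fun _ hk => hu.psiX0_eq hk
  fun_prop

theorem mapsTo_mul_I : MapsTo (fun κ : ℝ => (κ : ℂ) * Complex.I) (Ici 0) {k | 0 ≤ k.im} :=
  fun κ hκ => by simpa using hκ

/-- At `k = iκ` this quantity equals `2κ a(k)`, so it never vanishes. It is real and continuous in
`κ` and positive for large `κ`, where it behaves like `2κ`; the intermediate value theorem gives its
sign for every `κ > 0`. -/
theorem robin_pos (hu : IsPotential u) (ha : ∀ k : ℂ, 0 ≤ k.im → k ≠ 0 → specA u k ≠ 0) {κ : ℝ}
    (hκ : 0 < κ) :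
    0 < κ * (psi u 0 (κ * Complex.I)).re - (hu.psiDeriv 0 (κ * Complex.I)).re := by
  set E : ℝ → ℝ := fun κ => κ * (psi u 0 (κ * Complex.I)).re
    - (psiX0 u (κ * Complex.I)).re with hE
  have hEeq : ∀ κ, 0 ≤ κ → E κ
      = κ * (psi u 0 (κ * Complex.I)).re - (hu.psiDeriv 0 (κ * Complex.I)).re := by
    intro κ hκ
    simp only [hE]
    rw [hu.psiX0_eq_psiDeriv (mapsTo_mul_I hκ)]
  have hcont : ContinuousOn E (Ici 0) := by
    have h1 := Complex.continuous_re.comp_continuousOn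
      (hu.continuousOn_psi_zero.comp (f := fun κ : ℝ => (κ : ℂ) * Complex.I) (by fun_prop)
        mapsTo_mul_I)
    have h2 := Complex.continuous_re.comp_continuousOn
      (hu.continuousOn_psiX0.comp (f := fun κ : ℝ => (κ : ℂ) * Complex.I) (by fun_prop)
        mapsTo_mul_I)
    exact (continuousOn_id.mul h1).sub h2
  have hne : ∀ κ, 0 < κ → E κ ≠ 0 := by
    intro κ hκ h0
    have hk : 0 ≤ ((κ : ℂ) * Complex.I).im := mapsTo_mul_I hκ.le
    refine ha (κ * Complex.I) hk (by simp [hκ.ne']) ?_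
    rw [hu.specA_eq hk, hu.psiX0_eq_psiDeriv hk, ← hu.ofReal_re_psi hκ.le le_rfl,
      ← hu.ofReal_re_psiDeriv hκ.le le_rfl, div_eq_zero_iff]
    left
    rw [hEeq κ hκ.le] at h0
    have h1 : ((κ * (psi u 0 (κ * Complex.I)).re - (hu.psiDeriv 0 (κ * Complex.I)).re : ℝ) : ℂ)
      = 0 := by rw [h0]; simp
    push_cast at h1
    linear_combination -h1
      + (κ * ((psi u 0 (κ * Complex.I)).re : ℂ)) * Complex.I_mul_I
  obtain ⟨C, hC0, hC⟩ := hu.exists_norm_jostDeriv_le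
  set T := (∫ ξ in Ioi (0 : ℝ), weight u ξ) * ‖hu.jost‖ with hT
  have hT0 : 0 ≤ T := mul_nonneg
    (setIntegral_nonneg measurableSet_Ioi fun ξ _ => weight_nonneg u ξ) (norm_nonneg _)
  have hlarge : ∀ κ, T + C < κ → 0 < E κ := by
    intro κ hκ'
    have hκ0 : 0 ≤ κ := by linarith
    have hk : 0 ≤ ((κ : ℂ) * Complex.I).im := mapsTo_mul_I hκ0
    have h1 := hu.norm_mul_norm_jost_sub_one_le hk le_rfl
    rw [norm_mul, Complex.norm_real, Complex.norm_I, mul_one, Real.norm_of_nonneg hκ0] at h1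
    have h2 := (Complex.abs_re_le_norm _).trans (hC 0 _ le_rfl hk)
    have h3 := mul_le_mul_of_nonneg_left
      (Complex.abs_re_le_norm (hu.jost (0, κ * Complex.I) - 1)) hκ0
    rw [Complex.sub_re, Complex.one_re] at h3
    have h4 : κ * (1 - (hu.jost (0, κ * Complex.I)).re) ≤ T := by
      refine le_trans (mul_le_mul_of_nonneg_left ?_ hκ0) (h3.trans h1)
      rw [abs_sub_comm]; exact le_abs_self _
    have h5 := le_of_abs_le h2
    simp only [hE, hu.psi_zero_eq hk, hu.psiX0_eq hk]
    have h6 : Complex.I * (κ * Complex.I) = -(κ : ℂ) := by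
      linear_combination (κ : ℂ) * Complex.I_mul_I
    rw [h6, Complex.add_re, neg_mul, Complex.neg_re, Complex.re_ofReal_mul]
    nlinarith
  rw [← hEeq κ hκ.le]
  by_contra hle
  rw [not_lt] at hle
  set K := max κ (T + C + 1)
  have hK := hlarge K (by linarith [le_max_right κ (T + C + 1)])
  obtain ⟨c, hc, hc0⟩ := intermediate_value_Icc (le_max_left κ (T + C + 1))
    (hcont.mono fun x hx => hκ.le.trans hx.1) ⟨hle, hK.le⟩
  exact hne c (hκ.trans_le hc.1) hc0

/-- A Sturm comparison. If positivity fails, let `κ₀` be the largest `κ ≥ 0` with `ψ(0,iκ) ≤ 0`.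
Then `ψ(0,iκ₀) = 0`, and `robin_pos` forces `ψ_x(0,iκ₀) ≤ 0`. For `κ > κ₀` let `w` be the Wronskian
of `ψ(·,iκ₀)` and `ψ(·,iκ)`. It tends to 0 at infinity and increases beyond `X`, where both
functions are positive, so `w(X) ≤ 0`; at the origin `w(0) ≥ 0`. Hence the product of the two
functions has integral at most 0 over `[0, X]`. Letting `κ` decrease to `κ₀` gives `∫_0^X ψ(x,iκ₀)²
dx ≤ 0`, a contradiction. -/
theorem psi_zero_imaginary_pos (hu : IsPotential u)
    (ha : ∀ k : ℂ, 0 ≤ k.im → k ≠ 0 → specA u k ≠ 0) {κ : ℝ} (hκ : 0 ≤ κ) :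
    0 < (psi u 0 (κ * Complex.I)).re := by
  by_contra hneg
  rw [not_lt] at hneg
  set P : ℝ → ℝ := fun κ => (hu.jost (0, κ * Complex.I)).re with hP
  have hPc : Continuous P := by fun_prop
  have hPeq : ∀ κ : ℝ, 0 ≤ κ → (psi u 0 (κ * Complex.I)).re = P κ := fun κ hκ => by
    rw [hu.psi_zero_eq (mapsTo_mul_I hκ)]
  set T := (∫ ξ in Ioi (0 : ℝ), weight u ξ) * ‖hu.jost‖ with hT
  have hT0 : 0 ≤ T := mul_nonneg
    (setIntegral_nonneg measurableSet_Ioi fun ξ _ => weight_nonneg u ξ) (norm_nonneg _)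
  set Z : Set ℝ := {κ | 0 ≤ κ ∧ P κ ≤ 0} with hZ
  have hZne : Z.Nonempty := ⟨κ, hκ, by rw [← hPeq κ hκ]; exact hneg⟩
  have hZb : BddAbove Z := by
    refine ⟨T, fun κ hκ => ?_⟩
    have h1 := hu.norm_mul_norm_jost_sub_one_le (mapsTo_mul_I hκ.1) le_rfl
    rw [norm_mul, Complex.norm_real, Complex.norm_I, mul_one, Real.norm_of_nonneg hκ.1] at h1
    refine le_trans (le_mul_of_one_le_right hκ.1 ?_) h1
    have h3 := Complex.abs_re_le_norm (hu.jost (0, κ * Complex.I) - 1)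
    rw [Complex.sub_re, Complex.one_re] at h3
    have := (abs_le.1 h3).1
    have h4 : (hu.jost (0, κ * Complex.I)).re ≤ 0 := hκ.2
    linarith
  have hZc : IsClosed Z := (isClosed_le continuous_const continuous_id).inter
    (isClosed_le hPc continuous_const)
  set κ₀ := sSup Z with hκ₀
  have hmem : κ₀ ∈ Z := hZc.csSup_mem hZne hZb
  have hpos : ∀ κ, κ₀ < κ → 0 < P κ := by
    intro κ h
    by_contra h'
    exact absurd (le_csSup hZb ⟨hmem.1.trans h.le, not_lt.1 h'⟩) (not_le.2 h)
  have hP0 : P κ₀ = 0 := by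
    refine le_antisymm hmem.2 (ge_of_tendsto (hPc.continuousWithinAt (s := Ioi κ₀)) ?_)
    filter_upwards [self_mem_nhdsWithin] with κ h using (hpos κ h).le
  -- `robin_pos` holds only for positive `κ`; the limit from the right also covers `κ₀ = 0`.
  have hd0 : (hu.psiDeriv 0 (κ₀ * Complex.I)).re ≤ 0 := by
    have hc : ContinuousWithinAt (fun κ : ℝ => κ * P κ - (psiX0 u (κ * Complex.I)).re)
        (Ioi κ₀) κ₀ := by
      have h2 := Complex.continuous_re.comp_continuousOn
        (hu.continuousOn_psiX0.comp (f := fun κ : ℝ => (κ : ℂ) * Complex.I) (by fun_prop)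
          mapsTo_mul_I)
      exact (continuous_id.mul hPc).continuousWithinAt.sub
        ((h2 κ₀ hmem.1).mono fun x hx => hmem.1.trans (le_of_lt hx))
    have h0 : 0 ≤ κ₀ * P κ₀ - (psiX0 u (κ₀ * Complex.I)).re := by
      refine ge_of_tendsto hc ?_
      filter_upwards [self_mem_nhdsWithin] with κ h
      have hκ0 : 0 < κ := hmem.1.trans_lt h
      have := hu.robin_pos ha hκ0
      rw [hPeq κ hκ0.le, ← hu.psiX0_eq_psiDeriv (mapsTo_mul_I hκ0.le)] at this
      exact this.le
    rw [hP0, mul_zero, hu.psiX0_eq_psiDeriv (mapsTo_mul_I hmem.1)] at h0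
    linarith
  obtain ⟨X, hX0, hX⟩ := hu.exists_jost_re_ge
  set p : ℝ → ℝ → ℝ := fun κ x => Real.exp (-(κ * x)) * (hu.jost (x, κ * Complex.I)).re with hp
  have hpeq : ∀ κ x : ℝ, 0 ≤ κ → 0 ≤ x → psi u x (κ * Complex.I) = p κ x := by
    intro κ x hκ hx
    rw [← hu.ofReal_re_psi hκ hx, hu.psi_eq (mapsTo_mul_I hκ) hx]
    have : Complex.I * (κ * Complex.I) * x = ((-(κ * x) : ℝ) : ℂ) := by
      push_cast; linear_combination (κ * x : ℂ) * Complex.I_mul_I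
    rw [this, ← Complex.ofReal_exp, Complex.re_ofReal_mul]
  have hppos : ∀ κ x : ℝ, 0 ≤ κ → X ≤ x → 0 < p κ x := fun κ x hκ hx =>
    mul_pos (Real.exp_pos _) (by linarith [hX x _ hx (mapsTo_mul_I hκ)])
  have hpc : Continuous fun z : ℝ × ℝ => p z.1 z.2 := by
    simp only [hp]; fun_prop
  obtain ⟨C, hC0, hC⟩ := hu.exists_norm_jostDeriv_le
  have hint : ∀ κ, κ₀ < κ → ∫ x in (0 : ℝ)..X, p κ₀ x * p κ x ≤ 0 := by
    intro κ hκ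
    have hκ0 : 0 < κ := hmem.1.trans_lt hκ
    have h₀ := hu.isEigenfunction_psi (mapsTo_mul_I hmem.1)
    have h₁ := hu.isEigenfunction_psi (mapsTo_mul_I hκ0.le)
    have hsq : ((κ₀ : ℂ) * Complex.I) ^ 2 - ((κ : ℂ) * Complex.I) ^ 2
        = ((κ ^ 2 - κ₀ ^ 2 : ℝ) : ℂ) := by
      push_cast; linear_combination ((κ₀ : ℂ) ^ 2 - (κ : ℂ) ^ 2) * Complex.I_mul_I
    have hdpos : 0 < κ ^ 2 - κ₀ ^ 2 := by nlinarith [hmem.1]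
    set w : ℝ → ℝ := fun x => p κ₀ x * (hu.psiDeriv x (κ * Complex.I)).re
      - (hu.psiDeriv x (κ₀ * Complex.I)).re * p κ x with hw
    have hweq : ∀ x, 0 ≤ x → psi u x (κ₀ * Complex.I) * hu.psiDeriv x (κ * Complex.I)
        - hu.psiDeriv x (κ₀ * Complex.I) * psi u x (κ * Complex.I) = w x := by
      intro x hx
      rw [hpeq _ x hmem.1 hx, hpeq _ x hκ0.le hx, ← hu.ofReal_re_psiDeriv hmem.1 hx,
        ← hu.ofReal_re_psiDeriv hκ0.le hx]
      push_cast [hw]; rfl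
    have hwint : ∀ a b : ℝ, 0 ≤ a → a ≤ b →
        (κ ^ 2 - κ₀ ^ 2) * ∫ x in a..b, p κ₀ x * p κ x = w b - w a := by
      intro a b h0 hab
      have h := h₀.wronskian_integral h₁ h0 hab
      rw [hweq a h0, hweq b (h0.trans hab), hsq, intervalIntegral.integral_const_mul] at h
      have h2 : ∫ x in a..b, psi u x (κ₀ * Complex.I) * psi u x (κ * Complex.I)
          = ((∫ x in a..b, p κ₀ x * p κ x : ℝ) : ℂ) := by
        rw [← intervalIntegral.integral_ofReal]
        refine intervalIntegral.integral_congr fun x hx => ?_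
        rw [uIcc_of_le hab] at hx
        rw [hpeq _ x hmem.1 (h0.trans hx.1), hpeq _ x hκ0.le (h0.trans hx.1)]
        push_cast; rfl
      rw [h2] at h
      exact_mod_cast h
    have hwlim : Tendsto w atTop (𝓝 0) := by
      have h := hu.tendsto_wronskian (l := κ * Complex.I)
        (by simpa using hκ0) (χ := fun x => psi u x (κ₀ * Complex.I))
        (χ' := fun x => hu.psiDeriv x (κ₀ * Complex.I)) (A := ‖hu.jost‖)
        (B := ‖(κ₀ : ℂ) * Complex.I‖ * ‖hu.jost‖ + C) (fun x hx => ?_) (fun x hx => ?_)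
      · have h2 : Tendsto (fun x => (w x : ℂ)) atTop (𝓝 ((0 : ℝ) : ℂ)) := by
          refine h.congr' ?_
          filter_upwards [eventually_ge_atTop 0] with x hx using hweq x hx
        simpa [Function.comp_def] using (Complex.continuous_re.tendsto _).comp h2
      · refine (hu.norm_psi_le (mapsTo_mul_I hmem.1) hx).trans
          (mul_le_of_le_one_right (norm_nonneg _) (Real.exp_le_one_iff.2 ?_))
        have := mul_nonneg (mapsTo_mul_I hmem.1) hx
        linarith
      · refine (hu.norm_psiDeriv_le hC (mapsTo_mul_I hmem.1) hx).trans
          (mul_le_of_le_one_right (by positivity) (Real.exp_le_one_iff.2 ?_))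
        have := mul_nonneg (mapsTo_mul_I hmem.1) hx
        linarith
    have hwX : w X ≤ 0 := by
      refine ge_of_tendsto hwlim ?_
      filter_upwards [eventually_ge_atTop X] with x hx
      have h1 := hwint X x hX0.le hx
      have h2 : 0 ≤ ∫ x in X..x, p κ₀ x * p κ x := intervalIntegral.integral_nonneg hx
        fun t ht => (mul_pos (hppos _ t hmem.1 ht.1) (hppos _ t hκ0.le ht.1)).le
      nlinarith
    have hw0 : 0 ≤ w 0 := by
      have h1 : p κ₀ 0 = 0 := by simpa [hp, hP] using hP0
      have h2 : p κ 0 = P κ := by simp [hp, hP]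
      simp only [hw, h1, h2, zero_mul, zero_sub]
      have := mul_nonneg (neg_nonneg.2 hd0) (hpos κ hκ).le
      linarith
    have h1 := hwint 0 X le_rfl hX0.le
    by_contra h2
    rw [not_le] at h2
    have := mul_pos hdpos h2
    linarith
  have hcont : Continuous fun κ => ∫ x in (0 : ℝ)..X, p κ₀ x * p κ x := by
    refine intervalIntegral.continuous_parametric_intervalIntegral_of_continuous' ?_ 0 X
    have h1 := hpc.comp (by fun_prop : Continuous fun z : ℝ × ℝ => (κ₀, z.2))
    exact h1.mul hpc
  have hle : ∫ x in (0 : ℝ)..X, p κ₀ x * p κ₀ x ≤ 0 := by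
    refine le_of_tendsto (hcont.continuousWithinAt (s := Ioi κ₀) (x := κ₀)) ?_
    filter_upwards [self_mem_nhdsWithin] with κ h using hint κ h
  have hgt : 0 < ∫ x in (0 : ℝ)..X, p κ₀ x * p κ₀ x := by
    refine intervalIntegral.integral_pos hX0 ?_ (fun x _ => mul_self_nonneg _)
      ⟨X, ⟨hX0.le, le_rfl⟩, mul_pos (hppos _ X hmem.1 le_rfl) (hppos _ X hmem.1 le_rfl)⟩
    have h1 := hpc.comp (by fun_prop : Continuous fun z : ℝ => (κ₀, z))
    exact (h1.mul h1).continuousOn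
  linarith

theorem psi_zero_ne_zero (hu : IsPotential u)
    (ha : ∀ k : ℂ, 0 ≤ k.im → k ≠ 0 → specA u k ≠ 0) {k : ℂ} (hk : 0 ≤ k.im) :
    psi u 0 k ≠ 0 := by
  by_cases hre : k.re = 0
  · have h : k = k.im * Complex.I := by apply Complex.ext <;> simp [hre]
    intro h0
    have := hu.psi_zero_imaginary_pos ha hk
    rw [← h, h0] at this
    simp at this
  · rcases hk.lt_or_eq with h | h
    · exact hu.psi_zero_ne_zero_of_re_ne_zero h hre
    · have h2 : k = (k.re : ℂ) := by apply Complex.ext <;> simp [← h]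
      rw [h2]
      exact hu.psi_zero_ne_zero_of_real hre

end IsPotential

/-! ### Contour integrals along squares in the first quadrant -/

/-- The closed first quadrant. -/
def closedQuadrant : Set ℂ := {k | 0 ≤ k.re ∧ 0 ≤ k.im}

/-- The open first quadrant. -/
def openQuadrant : Set ℂ := {k | 0 < k.re ∧ 0 < k.im}

theorem integral_square_eq_zero {f : ℂ → ℂ} (hc : ContinuousOn f closedQuadrant)
    (hd : DifferentiableOn ℂ f openQuadrant) {R : ℝ} (hR : 0 ≤ R) :
    (∫ t in (0 : ℝ)..R, f t) - (∫ t in (0 : ℝ)..R, f (t + R * Complex.I))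
      + Complex.I * (∫ t in (0 : ℝ)..R, f (R + t * Complex.I))
      - Complex.I * (∫ t in (0 : ℝ)..R, f (t * Complex.I)) = 0 := by
  have h := Complex.integral_boundary_rect_eq_zero_of_continuousOn_of_differentiableOn f 0 (⟨R, R⟩)
    (hc.mono fun z hz => ?_) (hd.mono fun z hz => ?_)
  · simpa using h
  · rw [Complex.mem_reProdIm] at hz
    simp only [Complex.zero_re, Complex.zero_im, uIcc_of_le hR] at hz
    exact ⟨hz.1.1, hz.2.1⟩
  · rw [Complex.mem_reProdIm] at hz
    simp only [Complex.zero_re, Complex.zero_im, min_eq_left hR] at hz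
    exact ⟨hz.1.1, hz.2.1⟩

theorem integral_exp_neg_mul_le {x R : ℝ} (hx : 0 < x) :
    ∫ t in (0 : ℝ)..R, Real.exp (-(x * t)) ≤ 1 / x := by
  have h : ∀ t ∈ uIcc 0 R, HasDerivAt (fun t => -(Real.exp (-(x * t)) / x))
      (Real.exp (-(x * t))) t := by
    intro t _
    have h1 : HasDerivAt (fun t => -(x * t)) (-x) t := by
      exact ((hasDerivAt_id t).const_mul x).neg.congr_deriv (by simp)
    exact (h1.exp.div_const x).neg.congr_deriv (by field_simp)
  rw [intervalIntegral.integral_eq_sub_of_hasDerivAt h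
    (Continuous.intervalIntegrable (by fun_prop) _ _)]
  simp only [mul_zero, neg_zero, Real.exp_zero]
  have := div_pos (Real.exp_pos (-(x * R))) hx
  linarith

theorem le_norm_add_mul_I_left {a b : ℝ} (ha : 0 ≤ a) : a ≤ ‖(a + b * Complex.I : ℂ)‖ := by
  have := Complex.abs_re_le_norm (a + b * Complex.I)
  simpa [abs_of_nonneg ha] using this

theorem le_norm_add_mul_I_right {a b : ℝ} (hb : 0 ≤ b) : b ≤ ‖(a + b * Complex.I : ℂ)‖ := by
  have := Complex.abs_im_le_norm (a + b * Complex.I)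
  simpa [abs_of_nonneg hb] using this

/-- A Jordan lemma for squares: the bottom and left sides balance in the limit. -/
theorem tendsto_integral_bottom_sub_left {f : ℂ → ℂ} (hc : ContinuousOn f closedQuadrant)
    (hd : DifferentiableOn ℂ f openQuadrant) {C x : ℝ} (hx : 0 < x)
    (hf : ∀ k ∈ closedQuadrant, ‖k‖ * ‖f k‖ ≤ C * Real.exp (-(x * k.im))) :
    Tendsto (fun R : ℝ => (∫ t in (0 : ℝ)..R, f t)
      - Complex.I * ∫ t in (0 : ℝ)..R, f (t * Complex.I)) atTop (𝓝 0) := by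
  have hC : 0 ≤ C := by
    have := hf 0 ⟨le_rfl, le_rfl⟩
    simpa using this
  -- The first term bounds the top side (length `R`, integrand at most `C e^{-xR} / R`), the second
  -- the right side, where `e^{-x Im k}` is integrated.
  have hlim : Tendsto (fun R : ℝ => C * Real.exp (-(x * R)) + C / R * (1 / x)) atTop (𝓝 0) := by
    have h1 := (Real.tendsto_exp_neg_atTop_nhds_zero.comp
      (tendsto_id.const_mul_atTop hx)).const_mul C
    have h2 : Tendsto (fun R : ℝ => C / R) atTop (𝓝 0) := tendsto_const_nhds.div_atTop tendsto_id
    simpa using h1.add (h2.mul_const (1 / x))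
  refine squeeze_zero_norm' ?_ hlim
  filter_upwards [eventually_gt_atTop 0] with R hR
  have h := integral_square_eq_zero hc hd hR.le
  have heq : (∫ t in (0 : ℝ)..R, f t) - Complex.I * ∫ t in (0 : ℝ)..R, f (t * Complex.I)
      = (∫ t in (0 : ℝ)..R, f (t + R * Complex.I))
        - Complex.I * ∫ t in (0 : ℝ)..R, f (R + t * Complex.I) := by
    linear_combination h
  rw [heq]
  refine (norm_sub_le _ _).trans (add_le_add ?_ ?_)
  · have : ∀ t ∈ uIoc 0 R, ‖f (t + R * Complex.I)‖ ≤ C * Real.exp (-(x * R)) / R := by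
      intro t ht
      rw [uIoc_of_le hR.le] at ht
      have h1 := hf (t + R * Complex.I) ⟨by simpa using ht.1.le, by simpa using hR.le⟩
      have h2 := mul_le_mul_of_nonneg_right (le_norm_add_mul_I_right (a := t) hR.le)
        (norm_nonneg (f (t + R * Complex.I)))
      rw [le_div_iff₀ hR, mul_comm]
      refine (h2.trans h1).trans_eq ?_
      simp
    refine (intervalIntegral.norm_integral_le_of_norm_le_const this).trans_eq ?_
    rw [sub_zero, abs_of_pos hR]
    field_simp
  · rw [norm_mul, Complex.norm_I, one_mul]
    have h3 : ‖∫ t in (0 : ℝ)..R, f (R + t * Complex.I)‖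
        ≤ ∫ t in (0 : ℝ)..R, C / R * Real.exp (-(x * t)) := by
      refine intervalIntegral.norm_integral_le_of_norm_le hR.le
        (Eventually.of_forall fun t ht => ?_)
        (Continuous.intervalIntegrable (by fun_prop) _ _)
      have h1 := hf (R + t * Complex.I) ⟨by simpa using hR.le, by simpa using ht.1.le⟩
      have h2 := mul_le_mul_of_nonneg_right (le_norm_add_mul_I_left (b := t) hR.le)
        (norm_nonneg (f (R + t * Complex.I)))
      rw [div_mul_eq_mul_div, le_div_iff₀ hR, mul_comm]
      refine (h2.trans h1).trans_eq ?_
      simp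
    rw [intervalIntegral.integral_const_mul] at h3
    exact h3.trans (mul_le_mul_of_nonneg_left (integral_exp_neg_mul_le hx) (by positivity))

theorem integral_div_sq_add_sq_eq_pi_div_four {R : ℝ} (hR : 0 < R) :
    ∫ t in (0 : ℝ)..R, R / (R ^ 2 + t ^ 2) = Real.pi / 4 := by
  rw [integral_div_sq_add_sq, div_self hR.ne', Real.arctan_one]
  simp

/-- Rescaling to `[0, 1]` makes this dominated convergence. -/
theorem tendsto_integral_mean {ω : ℝ → ℝ} (hω : ContinuousOn ω (Ici 0)) {B : ℝ}
    (hB : ∀ κ, 0 ≤ κ → |ω κ| ≤ B) (hlim : Tendsto ω atTop (𝓝 0)) :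
    Tendsto (fun R : ℝ => R⁻¹ * ∫ t in (0 : ℝ)..R, ω t) atTop (𝓝 0) := by
  have h1 : Tendsto (fun R : ℝ => ∫ τ in (0 : ℝ)..1, ω (R * τ)) atTop
      (𝓝 (∫ _ in (0 : ℝ)..1, (0 : ℝ))) := by
    refine intervalIntegral.tendsto_integral_filter_of_dominated_convergence (fun _ => B) ?_ ?_ ?_ ?_
    · filter_upwards [eventually_gt_atTop 0] with R hR
      rw [uIoc_of_le zero_le_one]
      refine ContinuousOn.aestronglyMeasurable (hω.comp (by fun_prop) fun τ hτ => ?_)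
        measurableSet_Ioc
      exact mul_nonneg hR.le hτ.1.le
    · filter_upwards [eventually_gt_atTop 0] with R hR
      refine Eventually.of_forall fun τ hτ => ?_
      rw [uIoc_of_le zero_le_one] at hτ
      exact hB _ (mul_nonneg hR.le hτ.1.le)
    · exact intervalIntegrable_const
    · refine Eventually.of_forall fun τ hτ => ?_
      rw [uIoc_of_le zero_le_one] at hτ
      exact hlim.comp (tendsto_id.atTop_mul_const hτ.1)
  rw [intervalIntegral.integral_zero] at h1
  refine h1.congr' ?_
  filter_upwards [eventually_gt_atTop 0] with R hR
  rw [intervalIntegral.integral_comp_mul_left (fun t => ω t) hR.ne']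
  simp

/-- If `k f(k)` is asymptotically the constant `-b`, and `i f` is real on the imaginary axis, then
the imaginary part of the integral of `f` along the positive axis converges to `π b / 2`. -/
theorem tendsto_im_integral_of_asymptotic {f : ℂ → ℂ} (hc : ContinuousOn f closedQuadrant)
    (hd : DifferentiableOn ℂ f openQuadrant) {b B k₀ : ℝ} {ω : ℝ → ℝ}
    (hω : ContinuousOn ω (Ici 0)) (hB : ∀ κ, 0 ≤ κ → |ω κ| ≤ B) (hlim : Tendsto ω atTop (𝓝 0))
    (hf : ∀ k ∈ closedQuadrant, k₀ ≤ ‖k‖ → ‖k * f k + b‖ ≤ ω k.im)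
    (hreal : ∀ t : ℝ, 0 ≤ t → (f (t * Complex.I)).re = 0) :
    Tendsto (fun R : ℝ => ∫ t in (0 : ℝ)..R, (f t).im) atTop (𝓝 (Real.pi / 2 * b)) := by
  have hbd : Tendsto (fun R : ℝ => ω R + R⁻¹ * ∫ t in (0 : ℝ)..R, ω t) atTop (𝓝 0) := by
    simpa using hlim.add (tendsto_integral_mean hω hB hlim)
  rw [tendsto_iff_norm_sub_tendsto_zero]
  refine squeeze_zero' (Eventually.of_forall fun _ => norm_nonneg _) ?_ hbd
  filter_upwards [eventually_gt_atTop 0, eventually_ge_atTop k₀] with R hR hRk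
  have hbot : ContinuousOn (fun t : ℝ => f t) (uIcc 0 R) := by
    rw [uIcc_of_le hR.le]
    exact hc.comp (by fun_prop) fun t ht => ⟨by simpa using ht.1, by simp⟩
  have htop : ContinuousOn (fun t : ℝ => f (t + R * Complex.I)) (uIcc 0 R) := by
    rw [uIcc_of_le hR.le]
    exact hc.comp (by fun_prop) fun t ht => ⟨by simpa using ht.1, by simpa using hR.le⟩
  have hright : ContinuousOn (fun t : ℝ => f (R + t * Complex.I)) (uIcc 0 R) := by
    rw [uIcc_of_le hR.le]
    exact hc.comp (by fun_prop) fun t ht => ⟨by simpa using hR.le, by simpa using ht.1⟩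
  have hleft : ContinuousOn (fun t : ℝ => f (t * Complex.I)) (uIcc 0 R) := by
    rw [uIcc_of_le hR.le]
    exact hc.comp (by fun_prop) fun t ht => ⟨by simp, by simpa using ht.1⟩
  have him : ∀ {g : ℝ → ℂ}, IntervalIntegrable g volume 0 R →
      (∫ t in (0 : ℝ)..R, g t).im = ∫ t in (0 : ℝ)..R, (g t).im := fun hg => by
    rw [← RCLike.im_eq_complex_im, ← intervalIntegral.intervalIntegral_im hg]
  have hre : ∀ {g : ℝ → ℂ}, IntervalIntegrable g volume 0 R →
      (∫ t in (0 : ℝ)..R, g t).re = ∫ t in (0 : ℝ)..R, (g t).re := fun hg => by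
    rw [← RCLike.re_eq_complex_re, ← intervalIntegral.intervalIntegral_re hg]
  have hnt : ∀ t : ℝ, (t + R * Complex.I : ℂ) ≠ 0 := fun t h => by
    have := congrArg Complex.im h; simp at this; exact hR.ne' this
  have hnr : ∀ t : ℝ, (R + t * Complex.I : ℂ) ≠ 0 := fun t h => by
    have := congrArg Complex.re h; simp at this; exact hR.ne' this
  have hit : IntervalIntegrable (fun t : ℝ => (b : ℂ) / (t + R * Complex.I)) volume 0 R :=
    (Continuous.div (by fun_prop) (by fun_prop) hnt).intervalIntegrable _ _
  have hir : IntervalIntegrable (fun t : ℝ => (b : ℂ) / (R + t * Complex.I)) volume 0 R :=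
    (Continuous.div (by fun_prop) (by fun_prop) hnr).intervalIntegrable _ _
  have hsq := integral_square_eq_zero hc hd hR.le
  -- The left side of the square drops out of the imaginary part, `f` being purely imaginary there.
  have hI : (Complex.I * ∫ t in (0 : ℝ)..R, f (t * Complex.I)).im = 0 := by
    rw [Complex.I_mul_im, hre hleft.intervalIntegrable]
    have : ∫ t in (0 : ℝ)..R, (f (t * Complex.I)).re = ∫ t in (0 : ℝ)..R, (0 : ℝ) := by
      refine intervalIntegral.integral_congr fun t ht => ?_
      rw [uIcc_of_le hR.le] at ht
      exact hreal t ht.1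
    rw [this, intervalIntegral.integral_zero]
  -- The model function `b / k` on the top and right sides: each contributes `π / 4` times `b`,
  -- through the arctangent integral.
  have hmain : ((∫ t in (0 : ℝ)..R, (b : ℂ) / (t + R * Complex.I))
      - Complex.I * ∫ t in (0 : ℝ)..R, (b : ℂ) / (R + t * Complex.I)).im
        = -(Real.pi / 2 * b) := by
    rw [Complex.sub_im, Complex.I_mul_im, him hit, hre hir]
    have e1 : ∀ t : ℝ, ((b : ℂ) / (t + R * Complex.I)).im = -b * (R / (R ^ 2 + t ^ 2)) := by
      intro t
      rw [Complex.div_im]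
      simp [Complex.normSq_apply]
      field_simp
      ring_nf
    have e2 : ∀ t : ℝ, ((b : ℂ) / (R + t * Complex.I)).re = b * (R / (R ^ 2 + t ^ 2)) := by
      intro t
      rw [Complex.div_re]
      simp [Complex.normSq_apply]
      field_simp
    simp only [e1, e2, intervalIntegral.integral_const_mul, integral_div_sq_add_sq_eq_pi_div_four hR]
    ring
  have hval : (∫ t in (0 : ℝ)..R, (f t).im) - Real.pi / 2 * b
      = ((∫ t in (0 : ℝ)..R, (f (t + R * Complex.I) + b / (t + R * Complex.I)))
        - Complex.I * ∫ t in (0 : ℝ)..R, (f (R + t * Complex.I) + b / (R + t * Complex.I))).im := by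
    rw [← him hbot.intervalIntegrable, intervalIntegral.integral_add htop.intervalIntegrable hit,
      intervalIntegral.integral_add hright.intervalIntegrable hir]
    have h2 := congrArg Complex.im hsq
    simp only [Complex.add_im, Complex.sub_im, mul_add] at h2 hmain hI ⊢
    simp only [Complex.zero_im] at h2
    linarith
  rw [hval, Real.norm_eq_abs]
  refine (Complex.abs_im_le_norm _).trans ((norm_sub_le _ _).trans (add_le_add ?_ ?_))
  · have : ∀ t ∈ uIoc 0 R, ‖f (t + R * Complex.I) + b / (t + R * Complex.I)‖ ≤ ω R / R := by
      intro t ht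
      rw [uIoc_of_le hR.le] at ht
      have h0 := le_norm_add_mul_I_right (a := t) hR.le
      have h1 := hf (t + R * Complex.I) ⟨by simpa using ht.1.le, by simpa using hR.le⟩
        (hRk.trans h0)
      have h2 := mul_le_mul_of_nonneg_right h0
        (norm_nonneg (f (t + R * Complex.I) + b / (t + R * Complex.I)))
      rw [le_div_iff₀ hR, mul_comm]
      refine h2.trans (le_trans (le_of_eq ?_) (h1.trans_eq (by simp)))
      rw [← norm_mul, mul_add, mul_div_cancel₀ _ (hnt t)]
    refine (intervalIntegral.norm_integral_le_of_norm_le_const this).trans_eq ?_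
    rw [sub_zero, abs_of_pos hR]
    field_simp
  · rw [norm_mul, Complex.norm_I, one_mul, ← intervalIntegral.integral_const_mul]
    refine intervalIntegral.norm_integral_le_of_norm_le hR.le
      (Eventually.of_forall fun t ht => ?_) ?_
    · have h0 := le_norm_add_mul_I_left (b := t) hR.le
      have h1 := hf (R + t * Complex.I) ⟨by simpa using hR.le, by simpa using ht.1.le⟩
        (hRk.trans h0)
      have h2 := mul_le_mul_of_nonneg_right h0
        (norm_nonneg (f (R + t * Complex.I) + b / (R + t * Complex.I)))
      rw [inv_mul_eq_div, le_div_iff₀ hR, mul_comm]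
      refine h2.trans (le_trans (le_of_eq ?_) (h1.trans_eq (by simp)))
      rw [← norm_mul, mul_add, mul_div_cancel₀ _ (hnr t)]
    · refine ContinuousOn.intervalIntegrable ?_
      rw [uIcc_of_le hR.le]
      exact continuousOn_const.mul (hω.mono Icc_subset_Ici_self)

/-! ### The free Green function -/

/-- A function on the half line, `C¹` up to the boundary, integrable together with its derivative
and vanishing at infinity. -/
structure IsAdmissible (h h' : ℝ → ℝ) : Prop where
  cont : ContinuousOn h (Ici 0)
  cont_deriv : ContinuousOn h' (Ici 0)
  hasDerivAt : ∀ ξ, 0 < ξ → HasDerivAt h (h' ξ) ξ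
  int : IntegrableOn h (Ioi 0)
  int_deriv : IntegrableOn h' (Ioi 0)
  tendsto : Tendsto h atTop (𝓝 0)

/-- The Dirichlet Green function of `-d²/dx² - k²`. -/
noncomputable def freeGreen (x ξ : ℝ) (k : ℂ) : ℂ :=
  Complex.exp (Complex.I * k * |x - ξ|) * expKernel (min x ξ) k

theorem norm_exp_I_mul_abs (k : ℂ) (t : ℝ) :
    ‖Complex.exp (Complex.I * k * |t|)‖ = Real.exp (-(k.im * |t|)) := by
  rw [Complex.norm_exp]; simp

theorem hasDerivAt_half_line_primitive (c d : ℂ) (a : ℂ) (ξ : ℝ) :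
    HasDerivAt (fun ξ : ℝ => a * Complex.exp (c + d * ξ)) (a * d * Complex.exp (c + d * ξ)) ξ := by
  have h1 : HasDerivAt (fun t : ℝ => c + d * (t : ℂ)) d ξ := by
    simpa using ((Complex.ofRealCLM.hasDerivAt (x := ξ)).const_mul d).const_add c
  exact (h1.cexp.const_mul a).congr_deriv (by ring)

theorem integrableOn_continuous_mul {h : ℝ → ℝ} {s : Set ℝ} (hs : MeasurableSet s)
    (hh : IntegrableOn h s) {F : ℝ → ℂ} (hF : Continuous F) {C : ℝ}
    (hC : ∀ ξ ∈ s, ‖F ξ‖ ≤ C) : IntegrableOn (fun ξ => F ξ * h ξ) s := by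
  refine Integrable.mono' (hh.norm.const_mul C)
    (hF.aestronglyMeasurable.mul (Complex.continuous_ofReal.comp_aestronglyMeasurable
      hh.aestronglyMeasurable)) ?_
  filter_upwards [ae_restrict_mem hs] with ξ hξ
  rw [norm_mul, Complex.norm_real]
  exact mul_le_mul_of_nonneg_right (hC ξ hξ) (norm_nonneg _)

theorem continuous_exp_I_mul_abs (x : ℝ) (k : ℂ) :
    Continuous fun ξ : ℝ => Complex.exp (Complex.I * k * |x - ξ|) := by fun_prop

theorem continuous_freeGreen (x : ℝ) (k : ℂ) : Continuous fun ξ => freeGreen x ξ k := by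
  have h := continuous_expKernel.comp (by fun_prop : Continuous fun ξ : ℝ => (min x ξ, k))
  exact (continuous_exp_I_mul_abs x k).mul h

theorem norm_exp_I_mul_abs_le_one {k : ℂ} (hk : 0 ≤ k.im) (t : ℝ) :
    ‖Complex.exp (Complex.I * k * |t|)‖ ≤ 1 := by
  rw [norm_exp_I_mul_abs]
  exact Real.exp_le_one_iff.2 (by have := mul_nonneg hk (abs_nonneg t); linarith)

/-- One integration by parts: `k² freeGreen` is an exact derivative in `ξ` on `[0, x]`. Keeping the
factor `k²` makes the identity valid at `k = 0` as well. -/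
theorem integral_freeGreen_head {h h' : ℝ → ℝ} (hh : IsAdmissible h h') {x : ℝ} (hx : 0 < x)
    (k : ℂ) :
    k ^ 2 * ∫ ξ in (0 : ℝ)..x, freeGreen x ξ k * h ξ
      = -(1 / 2) * (Complex.exp (2 * Complex.I * k * x) + 1) * h x
        + Complex.exp (Complex.I * k * x) * h 0
        + ∫ ξ in (0 : ℝ)..x, (1 / 2) * (Complex.exp (Complex.I * k * x + Complex.I * k * ξ)
          + Complex.exp (Complex.I * k * x + -(Complex.I * k) * ξ)) * h' ξ := by
  -- The antiderivative of `k² freeGreen` for `ξ ≤ x`.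
  set A : ℝ → ℂ := fun ξ => (-(1 / 2)) * Complex.exp (Complex.I * k * x + Complex.I * k * ξ)
    + (-(1 / 2)) * Complex.exp (Complex.I * k * x + -(Complex.I * k) * ξ) with hA
  have hAd : ∀ ξ : ℝ, HasDerivAt A (-(1 / 2) * (Complex.I * k)
      * Complex.exp (Complex.I * k * x + Complex.I * k * ξ)
      + -(1 / 2) * (-(Complex.I * k)) * Complex.exp (Complex.I * k * x + -(Complex.I * k) * ξ)) ξ :=
    fun ξ => (hasDerivAt_half_line_primitive _ _ _ ξ).add (hasDerivAt_half_line_primitive _ _ _ ξ)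
  have hAe : ∀ ξ ∈ Icc 0 x, -(1 / 2) * (Complex.I * k)
      * Complex.exp (Complex.I * k * x + Complex.I * k * ξ)
      + -(1 / 2) * (-(Complex.I * k)) * Complex.exp (Complex.I * k * x + -(Complex.I * k) * ξ)
      = k ^ 2 * freeGreen x ξ k := by
    intro ξ hξ
    rw [freeGreen, min_eq_right hξ.2, abs_of_nonneg (sub_nonneg.2 hξ.2)]
    have e1 : Complex.exp (Complex.I * k * x + Complex.I * k * ξ)
        = Complex.exp (Complex.I * k * (x - ξ : ℝ)) * Complex.exp (2 * Complex.I * k * ξ) := by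
      rw [← Complex.exp_add]; congr 1; push_cast; ring
    have e2 : Complex.exp (Complex.I * k * x + -(Complex.I * k) * ξ)
        = Complex.exp (Complex.I * k * (x - ξ : ℝ)) := by
      congr 1; push_cast; ring
    have e3 := mul_expKernel ξ k
    rw [e1, e2]
    linear_combination (Complex.I * k / 2 * Complex.exp (Complex.I * k * (x - ξ : ℝ))) * e3
      - (k ^ 2 * Complex.exp (Complex.I * k * (x - ξ : ℝ)) * expKernel ξ k) * Complex.I_mul_I
  have hi1 : IntervalIntegrable (fun ξ => k ^ 2 * freeGreen x ξ k * h ξ) volume 0 x := by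
    refine ContinuousOn.intervalIntegrable ?_
    rw [uIcc_of_le hx.le]
    exact ((continuous_const.mul (continuous_freeGreen x k)).continuousOn).mul
      (Complex.continuous_ofReal.comp_continuousOn (hh.cont.mono Icc_subset_Ici_self))
  have hi2 : IntervalIntegrable (fun ξ => A ξ * h' ξ) volume 0 x := by
    refine ContinuousOn.intervalIntegrable ?_
    rw [uIcc_of_le hx.le]
    exact ((by fun_prop : Continuous A).continuousOn).mul
      (Complex.continuous_ofReal.comp_continuousOn (hh.cont_deriv.mono Icc_subset_Ici_self))
  have hFTC := intervalIntegral.integral_eq_sub_of_hasDerivAt_of_le (f := fun ξ => A ξ * h ξ)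
    (f' := fun ξ => k ^ 2 * freeGreen x ξ k * h ξ + A ξ * h' ξ) hx.le
    (((by fun_prop : Continuous A).continuousOn).mul
      (Complex.continuous_ofReal.comp_continuousOn (hh.cont.mono Icc_subset_Ici_self)))
    (fun ξ hξ => by
      rw [← hAe ξ ⟨hξ.1.le, hξ.2.le⟩]
      exact (hAd ξ).mul (hh.hasDerivAt ξ hξ.1).ofReal_comp) (hi1.add hi2)
  rw [intervalIntegral.integral_add hi1 hi2] at hFTC
  have h3 : ∫ ξ in (0 : ℝ)..x, k ^ 2 * freeGreen x ξ k * h ξ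
      = k ^ 2 * ∫ ξ in (0 : ℝ)..x, freeGreen x ξ k * h ξ := by
    rw [← intervalIntegral.integral_const_mul]
    exact intervalIntegral.integral_congr fun ξ _ => by simp only [mul_assoc]
  have h4 : ∫ ξ in (0 : ℝ)..x, A ξ * h' ξ
      = -∫ ξ in (0 : ℝ)..x, (1 / 2) * (Complex.exp (Complex.I * k * x + Complex.I * k * ξ)
          + Complex.exp (Complex.I * k * x + -(Complex.I * k) * ξ)) * h' ξ := by
    rw [← intervalIntegral.integral_neg]
    exact intervalIntegral.integral_congr fun ξ _ => by simp only [hA]; ring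
  have hAx : A x = -(1 / 2) * (Complex.exp (2 * Complex.I * k * x) + 1) := by
    have e1 : Complex.I * k * x + Complex.I * k * x = 2 * Complex.I * k * x := by ring
    have e2 : Complex.I * k * x + -(Complex.I * k) * x = 0 := by ring
    simp only [hA, e1, e2, Complex.exp_zero]; ring
  have hA0 : A 0 = -Complex.exp (Complex.I * k * x) := by
    simp only [hA, Complex.ofReal_zero, mul_zero, add_zero]; ring
  rw [h3, h4] at hFTC
  simp only [hAx, hA0] at hFTC
  linear_combination hFTC

/-- The counterpart on `[x, ∞)`. The boundary terms at `x` of the two pieces add up to `-h x`; the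
one at infinity vanishes with `h`. -/
theorem integral_freeGreen_tail {h h' : ℝ → ℝ} (hh : IsAdmissible h h') {x : ℝ} (hx : 0 < x)
    {k : ℂ} (hk : 0 ≤ k.im) :
    k ^ 2 * ∫ ξ in Ioi x, freeGreen x ξ k * h ξ
      = (1 / 2) * (Complex.exp (2 * Complex.I * k * x) - 1) * h x
        + ∫ ξ in Ioi x, (1 / 2) * (Complex.exp (2 * Complex.I * k * x) - 1)
          * Complex.exp (Complex.I * k * |x - ξ|) * h' ξ := by
  set b : ℂ := -(1 / 2) * (Complex.exp (2 * Complex.I * k * x) - 1) with hb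
  set A : ℝ → ℂ := fun ξ => b * Complex.exp (-(Complex.I * k * x) + Complex.I * k * ξ) with hA
  have hAd : ∀ ξ : ℝ, HasDerivAt A (b * (Complex.I * k)
      * Complex.exp (-(Complex.I * k * x) + Complex.I * k * ξ)) ξ :=
    fun ξ => hasDerivAt_half_line_primitive _ _ _ ξ
  have hE : ∀ ξ, x ≤ ξ → Complex.exp (-(Complex.I * k * x) + Complex.I * k * ξ)
      = Complex.exp (Complex.I * k * |x - ξ|) := by
    intro ξ hξ
    rw [abs_sub_comm, abs_of_nonneg (sub_nonneg.2 hξ)]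
    congr 1; push_cast; ring
  have hAe : ∀ ξ, x ≤ ξ → b * (Complex.I * k)
      * Complex.exp (-(Complex.I * k * x) + Complex.I * k * ξ) = k ^ 2 * freeGreen x ξ k := by
    intro ξ hξ
    rw [hE ξ hξ, freeGreen, min_eq_left hξ, hb]
    linear_combination (Complex.I * k / 2 * Complex.exp (Complex.I * k * |x - ξ|))
      * mul_expKernel x k
      - (k ^ 2 * Complex.exp (Complex.I * k * |x - ξ|) * expKernel x k) * Complex.I_mul_I
  have hnorm : ∀ ξ ∈ Ioi x, ‖A ξ‖ ≤ ‖b‖ := by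
    intro ξ hξ
    simp only [hA]
    rw [hE ξ (le_of_lt hξ), norm_mul]
    exact mul_le_of_le_one_right (norm_nonneg _) (norm_exp_I_mul_abs_le_one hk _)
  have hAc : Continuous A := by fun_prop
  have hint1 : IntegrableOn (fun ξ => k ^ 2 * freeGreen x ξ k * h ξ) (Ioi x) := by
    refine integrableOn_continuous_mul measurableSet_Ioi (hh.int.mono_set (Ioi_subset_Ioi hx.le))
      (continuous_const.mul (continuous_freeGreen x k)) (C := ‖k ^ 2‖ * x) fun ξ hξ => ?_
    rw [norm_mul, freeGreen, norm_mul, min_eq_left (le_of_lt (mem_Ioi.1 hξ))]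
    refine mul_le_mul_of_nonneg_left ?_ (norm_nonneg _)
    calc _ ≤ 1 * x := mul_le_mul (norm_exp_I_mul_abs_le_one hk _) (norm_expKernel_le hx.le hk)
          (norm_nonneg _) zero_le_one
      _ = x := one_mul x
  have hint2 : IntegrableOn (fun ξ => A ξ * h' ξ) (Ioi x) :=
    integrableOn_continuous_mul measurableSet_Ioi
      (hh.int_deriv.mono_set (Ioi_subset_Ioi hx.le)) hAc hnorm
  have hFTC := integral_Ioi_of_hasDerivAt_of_tendsto' (a := x) (f := fun ξ => A ξ * h ξ)
    (f' := fun ξ => k ^ 2 * freeGreen x ξ k * h ξ + A ξ * h' ξ) (m := 0)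
    (fun ξ hξ => by
      rw [← hAe ξ hξ]
      exact (hAd ξ).mul (hh.hasDerivAt ξ (hx.trans_le hξ)).ofReal_comp) (hint1.add hint2) ?_
  · rw [integral_add hint1 hint2] at hFTC
    have h3 : ∫ ξ in Ioi x, k ^ 2 * freeGreen x ξ k * h ξ
        = k ^ 2 * ∫ ξ in Ioi x, freeGreen x ξ k * h ξ := by
      rw [← integral_const_mul]
      exact integral_congr_ae (Eventually.of_forall fun ξ => by simp only [mul_assoc])
    have h4 : ∫ ξ in Ioi x, A ξ * h' ξ
        = -∫ ξ in Ioi x, (1 / 2) * (Complex.exp (2 * Complex.I * k * x) - 1)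
          * Complex.exp (Complex.I * k * |x - ξ|) * h' ξ := by
      rw [← integral_neg]
      refine setIntegral_congr_fun measurableSet_Ioi fun ξ hξ => ?_
      simp only [hA, hb]
      rw [hE ξ (le_of_lt hξ)]
      ring
    have hAx : A x = b := by simp [hA]
    rw [h3, h4, hAx, hb] at hFTC
    linear_combination hFTC
  · have h1 : Tendsto (fun ξ => ‖b‖ * |h ξ|) atTop (𝓝 0) := by
      simpa using (hh.tendsto.abs).const_mul ‖b‖
    refine squeeze_zero_norm' ?_ h1
    filter_upwards [eventually_gt_atTop x] with ξ hξ
    rw [norm_mul, Complex.norm_real, Real.norm_eq_abs]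
    exact mul_le_mul_of_nonneg_right (hnorm ξ hξ) (abs_nonneg _)

theorem norm_half_exp_add_le {k : ℂ} (hk : 0 ≤ k.im) {x ξ : ℝ} (h0 : 0 ≤ ξ) (hξ : ξ ≤ x) :
    ‖(1 / 2 : ℂ) * (Complex.exp (Complex.I * k * x + Complex.I * k * ξ)
      + Complex.exp (Complex.I * k * x + -(Complex.I * k) * ξ))‖
      ≤ Real.exp (-(k.im * |x - ξ|)) := by
  have e1 : Complex.exp (Complex.I * k * x + Complex.I * k * ξ)
      = Complex.exp (Complex.I * k * |x - ξ|) * Complex.exp (2 * Complex.I * k * ξ) := by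
    rw [← Complex.exp_add, abs_of_nonneg (sub_nonneg.2 hξ)]; congr 1; push_cast; ring
  have e2 : Complex.exp (Complex.I * k * x + -(Complex.I * k) * ξ)
      = Complex.exp (Complex.I * k * |x - ξ|) := by
    rw [abs_of_nonneg (sub_nonneg.2 hξ)]; congr 1; push_cast; ring
  rw [e1, e2, ← norm_exp_I_mul_abs]
  have h3 : (1 / 2 : ℂ) * (Complex.exp (Complex.I * k * |x - ξ|)
      * Complex.exp (2 * Complex.I * k * ξ) + Complex.exp (Complex.I * k * |x - ξ|))
      = Complex.exp (Complex.I * k * |x - ξ|)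
        * ((1 / 2) * (Complex.exp (2 * Complex.I * k * ξ) + 1)) := by ring
  rw [h3, norm_mul]
  refine mul_le_of_le_one_right (norm_nonneg _) ?_
  rw [norm_mul]
  have h4 : ‖Complex.exp (2 * Complex.I * k * ξ) + 1‖ ≤ 2 := by
    refine (norm_add_le _ _).trans ?_
    rw [norm_one]
    linarith [norm_exp_two_I_mul_le_one hk h0]
  have h5 : ‖(1 / 2 : ℂ)‖ = 1 / 2 := by simp
  rw [h5]; linarith

theorem norm_half_exp_sub_mul_le {k : ℂ} (hk : 0 ≤ k.im) {x : ℝ} (hx : 0 ≤ x) (t : ℝ) :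
    ‖(1 / 2 : ℂ) * (Complex.exp (2 * Complex.I * k * x) - 1)
      * Complex.exp (Complex.I * k * |t|)‖ ≤ Real.exp (-(k.im * |t|)) := by
  rw [norm_mul, norm_exp_I_mul_abs]
  refine mul_le_of_le_one_left (Real.exp_pos _).le ?_
  rw [norm_mul]
  have h4 : ‖Complex.exp (2 * Complex.I * k * x) - 1‖ ≤ 2 := by
    refine (norm_sub_le _ _).trans ?_
    rw [norm_one]
    linarith [norm_exp_two_I_mul_le_one hk hx]
  have h5 : ‖(1 / 2 : ℂ)‖ = 1 / 2 := by simp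
  rw [h5]; linarith

theorem integrableOn_exp_neg_mul_abs {h : ℝ → ℝ} {s : Set ℝ} (hh : IntegrableOn h s) {κ : ℝ}
    (hκ : 0 ≤ κ) (x : ℝ) : IntegrableOn (fun ξ => Real.exp (-(κ * |x - ξ|)) * |h ξ|) s := by
  refine Integrable.mono' hh.norm ((by fun_prop : Continuous fun ξ =>
    Real.exp (-(κ * |x - ξ|))).aestronglyMeasurable.mul hh.norm.aestronglyMeasurable)
    (Eventually.of_forall fun ξ => ?_)
  rw [norm_mul, Real.norm_of_nonneg (Real.exp_pos _).le, Real.norm_eq_abs, abs_abs]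
  refine mul_le_of_le_one_left (abs_nonneg _) (Real.exp_le_one_iff.2 ?_)
  have := mul_nonneg hκ (abs_nonneg (x - ξ))
  linarith

/-- The free Green function times `-k²` approximates the identity. After the integration by parts
the error is the boundary term `e^{ikx} h(0)` plus an integral of `h'` against a kernel of size at
most `e^{-Im k |x-ξ|}`. -/
theorem norm_integral_freeGreen_add_le {h h' : ℝ → ℝ} (hh : IsAdmissible h h') {x : ℝ}
    (hx : 0 < x) {k : ℂ} (hk : 0 ≤ k.im) :
    ‖k ^ 2 * (∫ ξ in Ioi (0 : ℝ), freeGreen x ξ k * h ξ) + h x‖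
      ≤ |h 0| * Real.exp (-(x * k.im))
        + ∫ ξ in Ioi (0 : ℝ), Real.exp (-(k.im * |x - ξ|)) * |h' ξ| := by
  have hint : IntegrableOn (fun ξ => freeGreen x ξ k * h ξ) (Ioi 0) := by
    refine integrableOn_continuous_mul measurableSet_Ioi hh.int (continuous_freeGreen x k)
      (C := x) fun ξ hξ => ?_
    have hm : 0 ≤ min x ξ := le_min hx.le (le_of_lt hξ)
    rw [freeGreen, norm_mul]
    calc _ ≤ 1 * x := mul_le_mul (norm_exp_I_mul_abs_le_one hk _)
          ((norm_expKernel_le hm hk).trans (min_le_left _ _)) (norm_nonneg _) zero_le_one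
      _ = x := one_mul x
  have hg := integrableOn_exp_neg_mul_abs hh.int_deriv hk x
  have hsplit : ∫ ξ in Ioi (0 : ℝ), freeGreen x ξ k * h ξ
      = (∫ ξ in (0 : ℝ)..x, freeGreen x ξ k * h ξ) + ∫ ξ in Ioi x, freeGreen x ξ k * h ξ := by
    rw [intervalIntegral.integral_of_le hx.le, ← setIntegral_union Ioc_disjoint_Ioi_same
      measurableSet_Ioi (hint.mono_set Ioc_subset_Ioi_self)
      (hint.mono_set (Ioi_subset_Ioi hx.le)), Ioc_union_Ioi_eq_Ioi hx.le]
  have hsplit' : ∫ ξ in Ioi (0 : ℝ), Real.exp (-(k.im * |x - ξ|)) * |h' ξ|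
      = (∫ ξ in (0 : ℝ)..x, Real.exp (-(k.im * |x - ξ|)) * |h' ξ|)
        + ∫ ξ in Ioi x, Real.exp (-(k.im * |x - ξ|)) * |h' ξ| := by
    rw [intervalIntegral.integral_of_le hx.le, ← setIntegral_union Ioc_disjoint_Ioi_same
      measurableSet_Ioi (hg.mono_set Ioc_subset_Ioi_self)
      (hg.mono_set (Ioi_subset_Ioi hx.le)), Ioc_union_Ioi_eq_Ioi hx.le]
  rw [hsplit, hsplit', mul_add, integral_freeGreen_head hh hx k, integral_freeGreen_tail hh hx hk]
  have h1 : ‖∫ ξ in (0 : ℝ)..x, (1 / 2) * (Complex.exp (Complex.I * k * x + Complex.I * k * ξ)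
          + Complex.exp (Complex.I * k * x + -(Complex.I * k) * ξ)) * h' ξ‖
      ≤ ∫ ξ in (0 : ℝ)..x, Real.exp (-(k.im * |x - ξ|)) * |h' ξ| := by
    refine intervalIntegral.norm_integral_le_of_norm_le hx.le (Eventually.of_forall fun ξ hξ => ?_)
      ((intervalIntegrable_iff_integrableOn_Ioc_of_le hx.le).2 (hg.mono_set Ioc_subset_Ioi_self))
    rw [norm_mul, Complex.norm_real, Real.norm_eq_abs]
    exact mul_le_mul_of_nonneg_right (norm_half_exp_add_le hk hξ.1.le hξ.2) (abs_nonneg _)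
  have h2 : ‖∫ ξ in Ioi x, (1 / 2) * (Complex.exp (2 * Complex.I * k * x) - 1)
          * Complex.exp (Complex.I * k * |x - ξ|) * h' ξ‖
      ≤ ∫ ξ in Ioi x, Real.exp (-(k.im * |x - ξ|)) * |h' ξ| := by
    refine norm_integral_le_of_norm_le (hg.mono_set (Ioi_subset_Ioi hx.le))
      (Eventually.of_forall fun ξ => ?_)
    rw [norm_mul, Complex.norm_real, Real.norm_eq_abs]
    exact mul_le_mul_of_nonneg_right (norm_half_exp_sub_mul_le hk hx.le _) (abs_nonneg _)
  have h3 : ‖Complex.exp (Complex.I * k * x) * h 0‖ = |h 0| * Real.exp (-(x * k.im)) := by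
    rw [norm_mul, IsPotential.norm_exp_I_mul, Complex.norm_real, Real.norm_eq_abs, mul_comm k.im,
      mul_comm]
  rw [← h3]
  refine le_trans (le_of_eq ?_) ((norm_add₃_le (a := Complex.exp (Complex.I * k * x) * h 0)
    (b := _) (c := _)).trans (le_of_le_of_eq (add_le_add_three le_rfl h1 h2) (add_assoc _ _ _)))
  congr 1
  ring

namespace IsPotential

variable {u : ℝ → ℝ}

/-! ### The Green function of the potential -/

/-- On a half disc compactness applies, there being no zeros; outside it the `1 / ‖k‖` estimate
keeps the value within `1 / 2` of 1. -/
theorem exists_le_norm_jost_zero (hu : IsPotential u)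
    (hψ : ∀ k : ℂ, 0 ≤ k.im → psi u 0 k ≠ 0) :
    ∃ c, 0 < c ∧ ∀ k : ℂ, 0 ≤ k.im → c ≤ ‖hu.jost (0, k)‖ := by
  set T := (∫ ξ in Ioi (0 : ℝ), weight u ξ) * ‖hu.jost‖ with hT
  have hT0 : 0 ≤ T := mul_nonneg
    (setIntegral_nonneg measurableSet_Ioi fun ξ _ => weight_nonneg u ξ) (norm_nonneg _)
  have hcomp : IsCompact (Metric.closedBall (0 : ℂ) (2 * T + 1) ∩ {k | 0 ≤ k.im}) :=
    (isCompact_closedBall _ _).inter_right (isClosed_le continuous_const Complex.continuous_im)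
  obtain ⟨k₁, hk₁, hmin⟩ := hcomp.exists_isMinOn
    ⟨0, Metric.mem_closedBall_self (by linarith), by simp⟩
    (by fun_prop : Continuous fun k => ‖hu.jost (0, k)‖).continuousOn
  have hpos : 0 < ‖hu.jost (0, k₁)‖ := by
    rw [norm_pos_iff, ← hu.psi_zero_eq hk₁.2]
    exact hψ k₁ hk₁.2
  refine ⟨min (1 / 2) ‖hu.jost (0, k₁)‖, lt_min (by norm_num) hpos, fun k hk => ?_⟩
  by_cases hkn : ‖k‖ ≤ 2 * T + 1
  · exact (min_le_right _ _).trans (hmin ⟨by simpa using hkn, hk⟩)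
  · refine (min_le_left _ _).trans ?_
    rw [not_le] at hkn
    have h1 := hu.norm_mul_norm_jost_sub_one_le hk le_rfl
    have h2 : ‖hu.jost (0, k) - 1‖ ≤ 1 / 2 := by
      by_contra h
      rw [not_le] at h
      nlinarith
    have h3 := norm_sub_norm_le (1 : ℂ) (hu.jost (0, k))
    rw [norm_one, norm_sub_rev] at h3
    linarith

/-- Let `M` be the maximum of `‖k‖ ‖regNormalized‖` on `[0, x]`. The Volterra equation with the `1 /
‖k‖` kernel bound gives `M ≤ 1 + (T / ‖k‖) M ≤ 1 + M / 2`. -/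
theorem norm_mul_norm_regNormalized_le (hu : IsPotential u) {k : ℂ} (hk : 0 ≤ k.im)
    (hk0 : 0 < ‖k‖) (hkT : 2 * (∫ ξ in Ioi (0 : ℝ), weight u ξ) ≤ ‖k‖) {x : ℝ} (hx : 0 ≤ x) :
    ‖k‖ * ‖hu.regNormalized 0 1 x k‖ ≤ 2 := by
  set T := ∫ ξ in Ioi (0 : ℝ), weight u ξ with hT
  have hc : Continuous fun y => ‖k‖ * ‖hu.regNormalized 0 1 y k‖ := by
    have := (hu.continuous_regNormalized 0 1).comp (by fun_prop : Continuous fun y : ℝ => (y, k))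
    exact continuous_const.mul this.norm
  obtain ⟨z, hz, hmax⟩ := (isCompact_Icc (a := 0) (b := x)).exists_isMaxOn ⟨0, le_rfl, hx⟩
    hc.continuousOn
  set M := ‖k‖ * ‖hu.regNormalized 0 1 z k‖ with hM
  have hM0 : 0 ≤ M := by positivity
  have hMle : M ≤ 1 + M / 2 := by
    have h1 : k * hu.regNormalized 0 1 z k = k * expKernel z k
        - ∫ ξ in (0 : ℝ)..z, expKernel (z - ξ) k * (u ξ * (k * hu.regNormalized 0 1 ξ k)) := by
      rw [hu.regNormalized_eqn 0 1 hz.1 hk, mul_sub, ← intervalIntegral.integral_const_mul]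
      congr 1
      · ring
      · exact intervalIntegral.integral_congr fun ξ _ => by ring
    have h2 : ‖∫ ξ in (0 : ℝ)..z, expKernel (z - ξ) k * (u ξ * (k * hu.regNormalized 0 1 ξ k))‖
        ≤ ∫ ξ in (0 : ℝ)..z, weight u ξ * (‖k‖⁻¹ * M) := by
      refine intervalIntegral.norm_integral_le_of_norm_le hz.1 (Eventually.of_forall fun ξ hξ => ?_)
        ((hu.continuous_weight.mul continuous_const).intervalIntegrable _ _)
      rw [norm_mul, norm_mul, norm_mul, Complex.norm_real, Real.norm_eq_abs]
      have h3 : ‖expKernel (z - ξ) k‖ ≤ ‖k‖⁻¹ := by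
        rw [← one_div, le_div_iff₀ hk0, mul_comm]
        exact norm_mul_norm_expKernel_le (sub_nonneg.2 hξ.2) hk
      have h4 : ‖k‖ * ‖hu.regNormalized 0 1 ξ k‖ ≤ M := hmax ⟨hξ.1.le, hξ.2.trans hz.2⟩
      have h5 : |u ξ| ≤ weight u ξ := by
        simpa using abs_le_weight u (t := 1) hξ.1.le (by linarith [hξ.1])
      calc _ ≤ ‖k‖⁻¹ * (weight u ξ * M) := by
            refine mul_le_mul h3 (mul_le_mul h5 h4 (by positivity) (weight_nonneg u ξ))
              (by positivity) (by positivity)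
        _ = _ := by ring
    rw [intervalIntegral.integral_mul_const] at h2
    have h6 := hu.integral_weight_le hz.1
    have h7 : (∫ ξ in (0 : ℝ)..z, weight u ξ) * (‖k‖⁻¹ * M) ≤ M / 2 := by
      calc _ ≤ T * (‖k‖⁻¹ * M) := mul_le_mul_of_nonneg_right h6 (by positivity)
        _ = T / ‖k‖ * M := by ring
        _ ≤ 1 / 2 * M := by
          refine mul_le_mul_of_nonneg_right ?_ hM0
          rw [div_le_iff₀ hk0]; linarith
        _ = M / 2 := by ring
    have h8 : M = ‖k * hu.regNormalized 0 1 z k‖ := by rw [norm_mul]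
    refine (h8.trans (congrArg norm h1)).le.trans ?_
    refine (norm_sub_le _ _).trans (add_le_add ?_ (h2.trans h7))
    rw [norm_mul]
    exact norm_mul_norm_expKernel_le hz.1 hk
  have : ‖k‖ * ‖hu.regNormalized 0 1 x k‖ ≤ M := hmax ⟨hx, le_rfl⟩
  linarith

theorem norm_sq_mul_norm_regNormalized_sub_le (hu : IsPotential u) {k : ℂ} (hk : 0 ≤ k.im)
    (hk0 : 0 < ‖k‖) (hkT : 2 * (∫ ξ in Ioi (0 : ℝ), weight u ξ) ≤ ‖k‖) {x : ℝ} (hx : 0 ≤ x) :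
    ‖k‖ ^ 2 * ‖hu.regNormalized 0 1 x k - expKernel x k‖
      ≤ 2 * ∫ ξ in Ioi (0 : ℝ), weight u ξ := by
  have h1 : k ^ 2 * (hu.regNormalized 0 1 x k - expKernel x k)
      = -∫ ξ in (0 : ℝ)..x, (k * expKernel (x - ξ) k)
        * (u ξ * (k * hu.regNormalized 0 1 ξ k)) := by
    rw [hu.regNormalized_eqn 0 1 hx hk, zero_add, one_mul, sub_sub_cancel_left, mul_neg,
      ← intervalIntegral.integral_const_mul]
    congr 1
    exact intervalIntegral.integral_congr fun ξ _ => by ring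
  rw [← norm_pow, ← norm_mul, h1, norm_neg]
  have h2 : ‖∫ ξ in (0 : ℝ)..x, (k * expKernel (x - ξ) k)
      * (u ξ * (k * hu.regNormalized 0 1 ξ k))‖ ≤ ∫ ξ in (0 : ℝ)..x, weight u ξ * 2 := by
    refine intervalIntegral.norm_integral_le_of_norm_le hx (Eventually.of_forall fun ξ hξ => ?_)
      ((hu.continuous_weight.mul continuous_const).intervalIntegrable _ _)
    rw [norm_mul, norm_mul, norm_mul, norm_mul, Complex.norm_real, Real.norm_eq_abs]
    have h3 := norm_mul_norm_expKernel_le (sub_nonneg.2 hξ.2) hk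
    have h4 := hu.norm_mul_norm_regNormalized_le hk hk0 hkT hξ.1.le
    have h5 : |u ξ| ≤ weight u ξ := by
      simpa using abs_le_weight u (t := 1) hξ.1.le (by linarith [hξ.1])
    calc _ ≤ 1 * (weight u ξ * 2) := mul_le_mul h3
          (mul_le_mul h5 h4 (by positivity) (weight_nonneg u ξ)) (by positivity) zero_le_one
      _ = _ := one_mul _
  rw [intervalIntegral.integral_mul_const] at h2
  have := hu.integral_weight_le hx
  linarith

/-- The Dirichlet Green function of `-d²/dx² - u - k²`. -/
noncomputable def green (hu : IsPotential u) (x ξ : ℝ) (k : ℂ) : ℂ :=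
  Complex.exp (Complex.I * k * |x - ξ|)
    * (hu.jost (max x ξ, k) * hu.regNormalized 0 1 (min x ξ) k / hu.jost (0, k))

theorem norm_green_le (hu : IsPotential u) {c : ℝ} (hc : 0 < c)
    (hcm : ∀ k : ℂ, 0 ≤ k.im → c ≤ ‖hu.jost (0, k)‖) {x ξ : ℝ} (hx : 0 < x) (hξ : 0 < ξ) {k : ℂ}
    (hk : 0 ≤ k.im) : ‖hu.green x ξ k‖ ≤ ‖hu.jost‖ * ((1 + x) * ‖hu.head 0 1‖) / c := by
  rw [green, norm_mul]
  refine (mul_le_of_le_one_left (norm_nonneg _) (norm_exp_I_mul_abs_le_one hk _)).trans ?_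
  rw [norm_div, norm_mul]
  have hm : 0 ≤ min x ξ := le_min hx.le hξ.le
  refine div_le_div₀ (by positivity) (mul_le_mul (hu.jost.norm_coe_le_norm _) ?_ (norm_nonneg _)
    (norm_nonneg _)) hc (hcm k hk)
  refine (hu.norm_regNormalized_le 0 1 hm k).trans (mul_le_mul_of_nonneg_right ?_ (norm_nonneg _))
  linarith [min_le_left x ξ]

theorem continuousOn_green (hu : IsPotential u) (hψ : ∀ k : ℂ, 0 ≤ k.im → psi u 0 k ≠ 0)
    (x ξ : ℝ) : ContinuousOn (hu.green x ξ) {k | 0 ≤ k.im} := by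
  have h1 := (hu.continuous_regNormalized 0 1).comp
    (by fun_prop : Continuous fun k : ℂ => (min x ξ, k))
  refine ContinuousOn.mul (by fun_prop) (ContinuousOn.div ?_ (by fun_prop) fun k hk => ?_)
  · exact (by fun_prop : Continuous fun k : ℂ => hu.jost (max x ξ, k)).continuousOn.mul
      h1.continuousOn
  · rw [← hu.psi_zero_eq hk]; exact hψ k hk

theorem continuous_green_right (hu : IsPotential u) (x : ℝ) (k : ℂ) :
    Continuous fun ξ => hu.green x ξ k := by
  have h1 := (hu.continuous_regNormalized 0 1).comp
    (by fun_prop : Continuous fun ξ : ℝ => (min x ξ, k))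
  have h2 : Continuous fun ξ : ℝ => hu.jost (max x ξ, k) := by fun_prop
  exact (continuous_exp_I_mul_abs x k).mul ((h2.mul h1).div_const _)

theorem differentiableOn_green (hu : IsPotential u) (hψ : ∀ k : ℂ, 0 ≤ k.im → psi u 0 k ≠ 0)
    (x ξ : ℝ) : DifferentiableOn ℂ (hu.green x ξ) {k | 0 < k.im} := by
  refine DifferentiableOn.mul
    (by fun_prop : Differentiable ℂ fun k : ℂ => Complex.exp (Complex.I * k * |x - ξ|)).differentiableOn
    (DifferentiableOn.div ((hu.differentiableOn_jost _).mul (hu.differentiableOn_regNormalized 0 1 _))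
      (hu.differentiableOn_jost _) fun k hk => ?_)
  rw [← hu.psi_zero_eq (le_of_lt hk)]; exact hψ k (le_of_lt hk)

/-- Replacing either Jost factor by 1 costs `1 / ‖k‖` and multiplies a term that is itself `O(1 /
‖k‖)`; replacing the regular solution by the free one costs `1 / ‖k‖²`. The denominator is bounded
below by `exists_le_norm_jost_zero`. -/
theorem exists_norm_green_sub_le (hu : IsPotential u) (hψ : ∀ k : ℂ, 0 ≤ k.im → psi u 0 k ≠ 0) :
    ∃ k₀ C : ℝ, 0 < k₀ ∧ 0 ≤ C ∧ ∀ x ξ : ℝ, 0 < x → 0 < ξ → ∀ k : ℂ, 0 ≤ k.im → k₀ ≤ ‖k‖ →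
      ‖k‖ ^ 2 * ‖hu.green x ξ k - freeGreen x ξ k‖ ≤ C * Real.exp (-(k.im * |x - ξ|)) := by
  obtain ⟨c, hc, hcm⟩ := hu.exists_le_norm_jost_zero hψ
  set T := ∫ ξ in Ioi (0 : ℝ), weight u ξ with hT
  have hT0 : 0 ≤ T := setIntegral_nonneg measurableSet_Ioi fun ξ _ => weight_nonneg u ξ
  refine ⟨2 * T + 1, (T * ‖hu.jost‖ * 2 + 2 * T + T * ‖hu.jost‖) / c, by linarith, by positivity,
    fun x ξ hx hξ k hk hkn => ?_⟩
  have hk0 : 0 < ‖k‖ := by linarith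
  have hm : 0 ≤ min x ξ := le_min hx.le hξ.le
  have hM : 0 ≤ max x ξ := hx.le.trans (le_max_left _ _)
  have hne : hu.jost (0, k) ≠ 0 := by rw [← hu.psi_zero_eq hk]; exact hψ k hk
  have heq : hu.green x ξ k - freeGreen x ξ k = Complex.exp (Complex.I * k * |x - ξ|)
      * (((hu.jost (max x ξ, k) - 1) * hu.regNormalized 0 1 (min x ξ) k
        + (hu.regNormalized 0 1 (min x ξ) k - expKernel (min x ξ) k)
        - expKernel (min x ξ) k * (hu.jost (0, k) - 1)) / hu.jost (0, k)) := by
    rw [green, freeGreen]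
    field_simp
    ring
  have h1 := hu.norm_mul_norm_jost_sub_one_le hk hM
  have h2 := hu.norm_mul_norm_jost_sub_one_le hk le_rfl
  have h3 := hu.norm_mul_norm_regNormalized_le hk hk0 (by linarith) hm
  have h4 := hu.norm_sq_mul_norm_regNormalized_sub_le hk hk0 (by linarith) hm
  have h5 := norm_mul_norm_expKernel_le hm hk
  rw [heq, norm_mul, norm_exp_I_mul_abs, norm_div]
  have hnum : ‖k‖ ^ 2 * ‖(hu.jost (max x ξ, k) - 1) * hu.regNormalized 0 1 (min x ξ) k
        + (hu.regNormalized 0 1 (min x ξ) k - expKernel (min x ξ) k)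
        - expKernel (min x ξ) k * (hu.jost (0, k) - 1)‖
      ≤ T * ‖hu.jost‖ * 2 + 2 * T + T * ‖hu.jost‖ := by
    have h6 := (norm_sub_le ((hu.jost (max x ξ, k) - 1) * hu.regNormalized 0 1 (min x ξ) k
        + (hu.regNormalized 0 1 (min x ξ) k - expKernel (min x ξ) k))
        (expKernel (min x ξ) k * (hu.jost (0, k) - 1))).trans
      (add_le_add_left (norm_add_le _ _) _)
    rw [norm_mul, norm_mul] at h6
    have h7 := mul_le_mul h1 h3 (by positivity) (by positivity)
    have h8 := mul_le_mul h5 h2 (by positivity) zero_le_one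
    have h9 := mul_le_mul_of_nonneg_left h6 (by positivity : 0 ≤ ‖k‖ ^ 2)
    linarith
  calc _ = Real.exp (-(k.im * |x - ξ|)) * ((‖k‖ ^ 2
        * ‖(hu.jost (max x ξ, k) - 1) * hu.regNormalized 0 1 (min x ξ) k
        + (hu.regNormalized 0 1 (min x ξ) k - expKernel (min x ξ) k)
        - expKernel (min x ξ) k * (hu.jost (0, k) - 1)‖) / ‖hu.jost (0, k)‖) := by ring
    _ ≤ Real.exp (-(k.im * |x - ξ|))
        * ((T * ‖hu.jost‖ * 2 + 2 * T + T * ‖hu.jost‖) / c) := by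
      refine mul_le_mul_of_nonneg_left ?_ (Real.exp_pos _).le
      exact div_le_div₀ (by positivity) hnum hc (hcm k hk)
    _ = _ := mul_comm _ _

end IsPotential

/-- The real solution `Im (ψ(ξ,t) conj ψ(0,t))` vanishing at the origin, for real `t`. -/
noncomputable def sineFn (u : ℝ → ℝ) (ξ t : ℝ) : ℝ := (psi u ξ t * conj (psi u 0 t)).im

theorem ofReal_sineFn (u : ℝ → ℝ) (ξ t : ℝ) : (sineFn u ξ t : ℂ)
    = conj (psi u 0 t) / (2 * Complex.I) * psi u ξ t
      + -(psi u 0 t) / (2 * Complex.I) * conj (psi u ξ t) := by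
  rw [sineFn, Complex.im_eq_sub_conj]
  simp
  ring

theorem im_div_eq_sineFn (u : ℝ → ℝ) (ξ t : ℝ) :
    (psi u ξ t / psi u 0 t).im = sineFn u ξ t / Complex.normSq (psi u 0 t) := by
  rw [Complex.div_im, sineFn, Complex.mul_im, Complex.conj_re, Complex.conj_im]
  ring

/-! ### The real solution vanishing at the origin, and the Green function on the two axes. -/

namespace IsPotential

variable {u : ℝ → ℝ}

/-- The derivative in `ξ` of `sineFn`. -/
noncomputable def sineDeriv (hu : IsPotential u) (ξ t : ℝ) : ℂ :=
  conj (psi u 0 t) / (2 * Complex.I) * hu.psiDeriv ξ t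
      + -(psi u 0 t) / (2 * Complex.I) * conj (hu.psiDeriv ξ t)

theorem ofReal_im_nonneg (t : ℝ) : 0 ≤ (t : ℂ).im := by simp

theorem isEigenfunction_sineFn (hu : IsPotential u) (t : ℝ) :
    IsEigenfunction u t (fun ξ => (sineFn u ξ t : ℂ)) (fun ξ => hu.sineDeriv ξ t) := by
  have h := hu.isEigenfunction_psi (ofReal_im_nonneg t)
  have hc := h.map_conj
  rw [Complex.conj_ofReal] at hc
  simp only [ofReal_sineFn]
  exact h.linear hc _ _

theorem sineFn_zero (u : ℝ → ℝ) (t : ℝ) : sineFn u 0 t = 0 := by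
  rw [sineFn, Complex.mul_conj]; simp

theorem sineDeriv_zero (hu : IsPotential u) (t : ℝ) : hu.sineDeriv 0 t = t := by
  have h := hu.wronskian_psi_conj t
  have h2 : (2 * Complex.I : ℂ) ≠ 0 := by simp
  rw [sineDeriv, div_mul_eq_mul_div, div_mul_eq_mul_div, ← add_div, div_eq_iff h2]
  linear_combination -h

theorem norm_psi_real_le (hu : IsPotential u) (t : ℝ) {ξ : ℝ} (hξ : 0 ≤ ξ) :
    ‖psi u ξ t‖ ≤ ‖hu.jost‖ := by
  have := hu.norm_psi_le (ofReal_im_nonneg t) hξ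
  simpa using this

theorem abs_sineFn_le (hu : IsPotential u) (t : ℝ) {ξ : ℝ} (hξ : 0 ≤ ξ) :
    |sineFn u ξ t| ≤ ‖hu.jost‖ ^ 2 := by
  refine (Complex.abs_im_le_norm _).trans ?_
  rw [norm_mul, RCLike.norm_conj, pow_two]
  exact mul_le_mul (hu.norm_psi_real_le t hξ) (hu.norm_psi_real_le t le_rfl) (norm_nonneg _)
    (norm_nonneg _)

theorem exists_norm_sineDeriv_le (hu : IsPotential u) (t : ℝ) :
    ∃ C, ∀ ξ, 0 ≤ ξ → ‖hu.sineDeriv ξ t‖ ≤ C := by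
  obtain ⟨C, hC0, hC⟩ := hu.exists_norm_jostDeriv_le
  refine ⟨‖conj (psi u 0 t) / (2 * Complex.I)‖ * (‖(t : ℂ)‖ * ‖hu.jost‖ + C)
    + ‖-(psi u 0 t) / (2 * Complex.I)‖ * (‖(t : ℂ)‖ * ‖hu.jost‖ + C), fun ξ hξ => ?_⟩
  have h := hu.norm_psiDeriv_le hC (ofReal_im_nonneg t) hξ
  simp only [Complex.ofReal_im, zero_mul, neg_zero, Real.exp_zero, mul_one] at h
  refine (norm_add_le _ _).trans (add_le_add ?_ ?_)
  · rw [norm_mul]; exact mul_le_mul_of_nonneg_left h (norm_nonneg _)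
  · rw [norm_mul, RCLike.norm_conj]; exact mul_le_mul_of_nonneg_left h (norm_nonneg _)

/-- Both sides solve the equation with value 0 and derivative `t` at the origin. -/
theorem mul_reg_eq_sineFn (hu : IsPotential u) (t : ℝ) {ξ : ℝ} (hξ : 0 ≤ ξ) :
    t * hu.reg 0 1 ξ t = sineFn u ξ t := by
  have hk := ofReal_im_nonneg t
  have h := hu.isEigenfunction_reg 0 1 hk
  have h2 := (h.linear h t 0).eq_of_init (hu.isEigenfunction_sineFn t) hu.cont ?_ ?_ ξ hξ
  · linear_combination h2
  · simp [hu.reg_zero 0 1 hk, sineFn_zero]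
  · simp [hu.regDeriv_zero 0 1 hk, hu.sineDeriv_zero]

theorem continuousOn_psi (hu : IsPotential u) {x : ℝ} (hx : 0 ≤ x) :
    ContinuousOn (fun k => psi u x k) {k | 0 ≤ k.im} :=
  (by fun_prop : Continuous fun k => Complex.exp (Complex.I * k * x)
    * hu.jost (x, k)).continuousOn.congr fun _ hk => hu.psi_eq hk hx

theorem continuous_psi_real (hu : IsPotential u) {x : ℝ} (hx : 0 ≤ x) :
    Continuous fun t : ℝ => psi u x t :=
  (hu.continuousOn_psi hx).comp_continuous Complex.continuous_ofReal ofReal_im_nonneg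

theorem continuous_sineFn (hu : IsPotential u) {x : ℝ} (hx : 0 ≤ x) : Continuous (sineFn u x) :=
  Complex.continuous_im.comp ((hu.continuous_psi_real hx).mul
    (Complex.continuous_conj.comp (hu.continuous_psi_real le_rfl)))

theorem continuousOn_sineFn_left (hu : IsPotential u) (t : ℝ) :
    ContinuousOn (fun ξ => sineFn u ξ t) (Ici 0) := by
  have := (hu.isEigenfunction_psi (ofReal_im_nonneg t)).continuousOn
  exact Complex.continuous_im.comp_continuousOn (this.mul continuousOn_const)

/-- Since `|x - ξ| = max - min`, the exponential is just what normalises the decaying and the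
regular solution: this is the classical resolvent kernel. -/
theorem green_eq (hu : IsPotential u) {x ξ : ℝ} (hx : 0 ≤ x) {k : ℂ}
    (hk : 0 ≤ k.im) :
    hu.green x ξ k = psi u (max x ξ) k * hu.reg 0 1 (min x ξ) k / psi u 0 k := by
  have hM : 0 ≤ max x ξ := hx.trans (le_max_left _ _)
  rw [green, hu.psi_eq hk hM, hu.psi_zero_eq hk, reg]
  have h : |x - ξ| = max x ξ - min x ξ := by
    rcases le_total x ξ with h | h
    · rw [max_eq_right h, min_eq_left h, abs_sub_comm, abs_of_nonneg (sub_nonneg.2 h)]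
    · rw [max_eq_left h, min_eq_right h, abs_of_nonneg (sub_nonneg.2 h)]
  have e : Complex.exp (Complex.I * k * |x - ξ|)
      = Complex.exp (Complex.I * k * (max x ξ : ℝ))
        * Complex.exp (-(Complex.I * k) * (min x ξ : ℝ)) := by
    rw [← Complex.exp_add, h, Complex.ofReal_sub]; congr 1; ring
  rw [e]; ring

/-- For real `t` the regular factor times `t` is the real function `sineFn`, and `Im (ψ/ψ(0))` is
`sineFn / |ψ(0)|²`. The result is symmetric in `x` and `ξ`, so the distinction between `min` and
`max` disappears and the variables separate. -/
theorem im_mul_green (hu : IsPotential u) {x ξ : ℝ} (hx : 0 ≤ x) (hξ : 0 ≤ ξ) (t : ℝ) :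
    (t * hu.green x ξ t).im = (psi u x t / psi u 0 t).im * sineFn u ξ t := by
  have hm : 0 ≤ min x ξ := le_min hx hξ
  rw [hu.green_eq hx (ofReal_im_nonneg t)]
  have h1 : t * (psi u (max x ξ) t * hu.reg 0 1 (min x ξ) t / psi u 0 t)
      = (sineFn u (min x ξ) t : ℂ) * (psi u (max x ξ) t / psi u 0 t) := by
    rw [← hu.mul_reg_eq_sineFn t hm]; ring
  rw [h1, Complex.im_ofReal_mul, im_div_eq_sineFn, im_div_eq_sineFn]
  rcases le_total x ξ with h | h
  · rw [max_eq_right h, min_eq_left h]; ring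
  · rw [max_eq_left h, min_eq_right h]; ring

theorem conj_reg_imaginary (hu : IsPotential u) {t : ℝ} (ht : 0 ≤ t) {ξ : ℝ} (hξ : 0 ≤ ξ) :
    conj (hu.reg 0 1 ξ (t * Complex.I)) = hu.reg 0 1 ξ (t * Complex.I) := by
  have hk : 0 ≤ (t * Complex.I).im := by simpa using ht
  have h := hu.isEigenfunction_reg 0 1 hk
  refine (h.map_conj.of_sq_eq (l := t * Complex.I) (by simp [mul_pow])).eq_of_init h hu.cont
    ?_ ?_ ξ hξ
  · simp [hu.reg_zero 0 1 hk]
  · simp [hu.regDeriv_zero 0 1 hk]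

theorem conj_psi_imaginary (hu : IsPotential u) {t : ℝ} (ht : 0 ≤ t) {ξ : ℝ} (hξ : 0 ≤ ξ) :
    conj (psi u ξ (t * Complex.I)) = psi u ξ (t * Complex.I) := by
  rw [← hu.ofReal_re_psi ht hξ, Complex.conj_ofReal]

theorem conj_green_imaginary (hu : IsPotential u) {t : ℝ} (ht : 0 ≤ t) {x ξ : ℝ} (hx : 0 ≤ x)
    (hξ : 0 ≤ ξ) : conj (hu.green x ξ (t * Complex.I)) = hu.green x ξ (t * Complex.I) := by
  rw [hu.green_eq hx (by simpa using ht), map_div₀, map_mul,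
    hu.conj_psi_imaginary ht (hx.trans (le_max_left _ _)), hu.conj_psi_imaginary ht le_rfl,
    hu.conj_reg_imaginary ht (le_min hx hξ)]

/-! ### The expansion in the functions `sineFn` -/

/-- The inversion formula of the Dirichlet transform, in the absence of bound states. -/
theorem tendsto_sine_inversion (hu : IsPotential u) (hψ : ∀ k : ℂ, 0 ≤ k.im → psi u 0 k ≠ 0)
    {h h' : ℝ → ℝ} (hh : IsAdmissible h h') {x : ℝ} (hx : 0 < x) :
    Tendsto (fun R : ℝ => ∫ t in (0 : ℝ)..R, (psi u x t / psi u 0 t).im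
      * ∫ ξ in Ioi (0 : ℝ), sineFn u ξ t * h ξ) atTop (𝓝 (Real.pi / 2 * h x)) := by
  obtain ⟨c, hc, hcm⟩ := hu.exists_le_norm_jost_zero hψ
  obtain ⟨k₀, C, hk₀, hC0, hC⟩ := hu.exists_norm_green_sub_le hψ
  set G := ‖hu.jost‖ * ((1 + x) * ‖hu.head 0 1‖) / c with hG
  have hmeas : ∀ k, AEStronglyMeasurable (fun ξ => hu.green x ξ k * (h ξ : ℂ))
      (volume.restrict (Ioi 0)) := fun k =>
    (hu.continuous_green_right x k).aestronglyMeasurable.mul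
      (Complex.continuous_ofReal.comp_aestronglyMeasurable hh.int.aestronglyMeasurable)
  have hbd : ∀ k : ℂ, 0 ≤ k.im → ∀ ξ, 0 < ξ → ‖hu.green x ξ k * (h ξ : ℂ)‖ ≤ G * ‖h ξ‖ := by
    intro k hk ξ hξ
    rw [norm_mul, Complex.norm_real]
    exact mul_le_mul_of_nonneg_right (hu.norm_green_le hc hcm hx hξ hk) (norm_nonneg _)
  have hint : ∀ k : ℂ, 0 ≤ k.im → IntegrableOn (fun ξ => hu.green x ξ k * (h ξ : ℂ)) (Ioi 0) := by
    intro k hk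
    refine Integrable.mono' (hh.int.norm.const_mul G) (hmeas k) ?_
    filter_upwards [ae_restrict_mem measurableSet_Ioi] with ξ hξ using hbd k hk ξ hξ
  -- `Im f` on the real axis is the wanted integrand, `f` is imaginary on the imaginary axis, and `k
  -- f(k)` is asymptotically `-h(x)`. Holomorphy in the quadrant is where the absence of zeros of
  -- `ψ(0,k)` enters.
  set f : ℂ → ℂ := fun k => k * ∫ ξ in Ioi (0 : ℝ), hu.green x ξ k * (h ξ : ℂ) with hf
  have hcont : ContinuousOn f closedQuadrant := by
    refine ContinuousOn.mono (s := {k : ℂ | 0 ≤ k.im}) ?_ fun k hk => hk.2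
    refine continuousOn_id.mul (continuousOn_of_dominated (bound := fun ξ => G * ‖h ξ‖)
      (fun k _ => hmeas k) (fun k hk => ?_) (hh.int.norm.const_mul G)
      (Eventually.of_forall fun ξ => (hu.continuousOn_green hψ x ξ).mul continuousOn_const))
    filter_upwards [ae_restrict_mem measurableSet_Ioi] with ξ hξ using hbd k hk ξ hξ
  have hdiff : DifferentiableOn ℂ f openQuadrant := by
    refine DifferentiableOn.mono (t := {k : ℂ | 0 < k.im}) ?_ fun k hk => hk.2
    refine differentiableOn_id.mul (differentiableOn_integral_of_dominated
      (isOpen_lt continuous_const Complex.continuous_im) (bound := fun ξ => G * ‖h ξ‖)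
      (fun k _ => hmeas k) ?_ (hh.int.norm.const_mul G)
      (Eventually.of_forall fun ξ => (hu.differentiableOn_green hψ x ξ).mul_const _))
    filter_upwards [ae_restrict_mem measurableSet_Ioi] with ξ hξ k hk
      using hbd k (le_of_lt hk) ξ hξ
  set g : ℝ → ℝ := fun ξ => C * |h ξ| + |h' ξ| with hg
  have hg0 : ∀ ξ, 0 ≤ g ξ := fun ξ => by positivity
  have hgint : IntegrableOn g (Ioi 0) := (hh.int.norm.const_mul C).add hh.int_deriv.norm
  -- Majorant for `k f(k) + h(x)`: the `h` part of `g` accounts for the comparison with the free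
  -- Green function, the `h'` part and the term in `h 0` for the free estimate.
  set ω : ℝ → ℝ := fun κ => |h 0| * Real.exp (-(x * κ))
    + ∫ ξ in Ioi (0 : ℝ), Real.exp (-(κ * |x - ξ|)) * g ξ with hω
  have hgmeas : ∀ κ : ℝ, AEStronglyMeasurable (fun ξ => Real.exp (-(κ * |x - ξ|)) * g ξ)
      (volume.restrict (Ioi 0)) := fun κ =>
    (by fun_prop : Continuous fun ξ => Real.exp (-(κ * |x - ξ|))).aestronglyMeasurable.mul
      hgint.aestronglyMeasurable
  have hgbd : ∀ κ : ℝ, 0 ≤ κ → ∀ ξ, ‖Real.exp (-(κ * |x - ξ|)) * g ξ‖ ≤ g ξ := by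
    intro κ hκ ξ
    rw [Real.norm_of_nonneg (mul_nonneg (Real.exp_pos _).le (hg0 ξ))]
    refine mul_le_of_le_one_left (hg0 ξ) (Real.exp_le_one_iff.2 ?_)
    have := mul_nonneg hκ (abs_nonneg (x - ξ))
    linarith
  have hωc : ContinuousOn ω (Ici 0) := by
    refine ContinuousOn.add (by fun_prop) (continuousOn_of_dominated (bound := g)
      (fun κ _ => hgmeas κ) (fun κ hκ => Eventually.of_forall (hgbd κ hκ)) hgint
      (Eventually.of_forall fun ξ => by fun_prop))
  have hωb : ∀ κ, 0 ≤ κ → |ω κ| ≤ |h 0| + ∫ ξ in Ioi (0 : ℝ), g ξ := by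
    intro κ hκ
    refine (abs_add_le _ _).trans (add_le_add ?_ ?_)
    · rw [abs_mul, abs_abs, Real.abs_exp]
      exact mul_le_of_le_one_right (abs_nonneg _)
        (Real.exp_le_one_iff.2 (by have := mul_nonneg hx.le hκ; linarith))
    · exact norm_integral_le_of_norm_le hgint (Eventually.of_forall (hgbd κ hκ))
  have hωlim : Tendsto ω atTop (𝓝 0) := by
    have h1 : Tendsto (fun κ => |h 0| * Real.exp (-(x * κ))) atTop (𝓝 0) := by
      simpa using (Real.tendsto_exp_neg_atTop_nhds_zero.comp
        (tendsto_id.const_mul_atTop hx)).const_mul |h 0|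
    have h2 : Tendsto (fun κ : ℝ => ∫ ξ in Ioi (0 : ℝ), Real.exp (-(κ * |x - ξ|)) * g ξ) atTop
        (𝓝 (∫ _ in Ioi (0 : ℝ), (0 : ℝ))) := by
      refine tendsto_integral_filter_of_dominated_convergence g
        (Eventually.of_forall hgmeas) ?_ hgint ?_
      · filter_upwards [eventually_ge_atTop 0] with κ hκ using Eventually.of_forall (hgbd κ hκ)
      -- The exponential tends to 0 except at `ξ = x`, a null set.
      · have hne : ∀ᵐ ξ ∂(volume.restrict (Ioi (0 : ℝ))), ξ ≠ x :=
          Measure.ae_ne _ x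
        filter_upwards [hne] with ξ hξ
        have hpos : 0 < |x - ξ| := abs_pos.2 (sub_ne_zero.2 hξ.symm)
        simpa using (Real.tendsto_exp_neg_atTop_nhds_zero.comp
          (tendsto_id.atTop_mul_const hpos)).mul_const (g ξ)
    simpa using h1.add h2
  have hasym : ∀ k ∈ closedQuadrant, k₀ ≤ ‖k‖ → ‖k * f k + (h x : ℝ)‖ ≤ ω k.im := by
    intro k hk hkn
    have hfree : IntegrableOn (fun ξ => freeGreen x ξ k * (h ξ : ℂ)) (Ioi 0) := by
      refine integrableOn_continuous_mul measurableSet_Ioi hh.int (continuous_freeGreen x k)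
        (C := x) fun ξ hξ => ?_
      have hm : 0 ≤ min x ξ := le_min hx.le (le_of_lt hξ)
      rw [freeGreen, norm_mul]
      calc _ ≤ 1 * x := mul_le_mul (norm_exp_I_mul_abs_le_one hk.2 _)
            ((norm_expKernel_le hm hk.2).trans (min_le_left _ _)) (norm_nonneg _) zero_le_one
        _ = x := one_mul x
    have hsplit : k * f k + (h x : ℝ)
        = (∫ ξ in Ioi (0 : ℝ), k ^ 2 * (hu.green x ξ k - freeGreen x ξ k) * h ξ)
          + (k ^ 2 * (∫ ξ in Ioi (0 : ℝ), freeGreen x ξ k * h ξ) + h x) := by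
      have : ∫ ξ in Ioi (0 : ℝ), k ^ 2 * (hu.green x ξ k - freeGreen x ξ k) * h ξ
          = k ^ 2 * ((∫ ξ in Ioi (0 : ℝ), hu.green x ξ k * h ξ)
            - ∫ ξ in Ioi (0 : ℝ), freeGreen x ξ k * h ξ) := by
        rw [← integral_sub (hint k hk.2) hfree, ← integral_const_mul]
        exact integral_congr_ae (Eventually.of_forall fun ξ => by simp only; ring)
      rw [this, hf]
      ring
    have h1 := norm_integral_freeGreen_add_le hh hx hk.2
    have hi1 := (integrableOn_exp_neg_mul_abs hh.int hk.2 x).const_mul C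
    have hi2 := integrableOn_exp_neg_mul_abs hh.int_deriv hk.2 x
    have h2 : ‖∫ ξ in Ioi (0 : ℝ), k ^ 2 * (hu.green x ξ k - freeGreen x ξ k) * h ξ‖
        ≤ ∫ ξ in Ioi (0 : ℝ), C * (Real.exp (-(k.im * |x - ξ|)) * |h ξ|) := by
      refine norm_integral_le_of_norm_le hi1 ?_
      filter_upwards [ae_restrict_mem measurableSet_Ioi] with ξ hξ
      rw [norm_mul, norm_mul, norm_pow, Complex.norm_real, Real.norm_eq_abs, ← mul_assoc C]
      exact mul_le_mul_of_nonneg_right (hC x ξ hx hξ k hk.2 hkn) (abs_nonneg _)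
    have h3 : ω k.im = (∫ ξ in Ioi (0 : ℝ), C * (Real.exp (-(k.im * |x - ξ|)) * |h ξ|))
        + (|h 0| * Real.exp (-(x * k.im))
          + ∫ ξ in Ioi (0 : ℝ), Real.exp (-(k.im * |x - ξ|)) * |h' ξ|) := by
      have : ∫ ξ in Ioi (0 : ℝ), Real.exp (-(k.im * |x - ξ|)) * g ξ
          = (∫ ξ in Ioi (0 : ℝ), C * (Real.exp (-(k.im * |x - ξ|)) * |h ξ|))
            + ∫ ξ in Ioi (0 : ℝ), Real.exp (-(k.im * |x - ξ|)) * |h' ξ| := by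
        rw [← integral_add hi1 hi2]
        exact integral_congr_ae (Eventually.of_forall fun ξ => by simp only [hg]; ring)
      rw [hω]
      simp only
      rw [this]; ring
    rw [hsplit, h3]
    exact (norm_add_le _ _).trans (add_le_add h2 h1)
  have hreal : ∀ t : ℝ, 0 ≤ t → (f (t * Complex.I)).re = 0 := by
    intro t ht
    have hconj : conj (∫ ξ in Ioi (0 : ℝ), hu.green x ξ (t * Complex.I) * (h ξ : ℂ))
        = ∫ ξ in Ioi (0 : ℝ), hu.green x ξ (t * Complex.I) * (h ξ : ℂ) := by
      rw [← integral_conj]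
      refine setIntegral_congr_fun measurableSet_Ioi fun ξ hξ => ?_
      rw [map_mul, Complex.conj_ofReal, hu.conj_green_imaginary ht hx.le (le_of_lt hξ)]
    have him := Complex.conj_eq_iff_im.1 hconj
    simp only [hf]
    rw [mul_assoc, Complex.re_ofReal_mul, Complex.I_mul_re, him]
    simp
  have key := tendsto_im_integral_of_asymptotic hcont hdiff hωc hωb hωlim hasym hreal
  refine key.congr fun R => intervalIntegral.integral_congr fun t _ => ?_
  have hk := ofReal_im_nonneg t
  simp only [hf]
  rw [← integral_const_mul, ← integral_const_mul, ← RCLike.im_eq_complex_im,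
    ← integral_im ((hint t hk).const_mul _)]
  refine setIntegral_congr_fun measurableSet_Ioi fun ξ hξ => ?_
  rw [RCLike.im_eq_complex_im, ← mul_assoc, mul_comm, Complex.im_ofReal_mul,
    hu.im_mul_green hx.le (le_of_lt hξ)]
  ring

end IsPotential

/-! ### The boundary value problem -/

/-- The closed quarter plane. -/
def quarterPlane : Set (ℝ × ℝ) := Ici 0 ×ˢ Ici 0

/-- A solution of `q_xx + q_yy + u(x) q = 0` in the quarter plane, `C¹` up to the boundary, which
together with its first derivatives `qx`, `qy` is bounded by an integrable function `w` of each
variable. -/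
structure IsDecayingSolution (u : ℝ → ℝ) (q qx qy : ℝ → ℝ → ℝ) (w : ℝ → ℝ) : Prop where
  cont : ContinuousOn (Function.uncurry q) quarterPlane
  cont_x : ContinuousOn (Function.uncurry qx) quarterPlane
  cont_y : ContinuousOn (Function.uncurry qy) quarterPlane
  deriv_x : ∀ x y, 0 ≤ x → 0 ≤ y → HasDerivWithinAt (fun s => q s y) (qx x y) (Ici 0) x
  deriv_y : ∀ x y, 0 ≤ x → 0 ≤ y → HasDerivWithinAt (fun t => q x t) (qy x y) (Ici 0) y
  interior : ∀ x y, 0 < x → 0 < y → ∃ L Lx Ly : ℝ × ℝ →L[ℝ] ℝ,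
    HasFDerivAt (Function.uncurry q) L (x, y) ∧ HasFDerivAt (Function.uncurry qx) Lx (x, y) ∧
    HasFDerivAt (Function.uncurry qy) Ly (x, y) ∧ L (1, 0) = qx x y ∧
    Lx (1, 0) + Ly (0, 1) = -(u x * q x y)
  int : IntegrableOn w (Ioi 0)
  tendsto : Tendsto w atTop (𝓝 0)
  le_left : ∀ x y, 0 ≤ x → 0 ≤ y → |q x y| ≤ w x ∧ |qx x y| ≤ w x ∧ |qy x y| ≤ w x
  le_right : ∀ x y, 0 ≤ x → 0 ≤ y → |q x y| ≤ w y ∧ |qx x y| ≤ w y ∧ |qy x y| ≤ w y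

theorem hasDerivAt_prodMk_left (x y : ℝ) : HasDerivAt (fun s : ℝ => (s, y)) (1, 0) x :=
  (hasDerivAt_id x).prodMk (hasDerivAt_const x y)

theorem hasDerivAt_prodMk_right (x y : ℝ) : HasDerivAt (fun t : ℝ => (x, t)) (0, 1) y :=
  (hasDerivAt_const y x).prodMk (hasDerivAt_id y)

/-- Near an interior point the one-sided `partialX` and `partialY` agree with the Fréchet derivative
on the coordinate vectors, so `C²` regularity makes them differentiable and the equation becomes a
statement about their derivatives. -/
theorem GenLaplace.IsPoincareSolution.interior {u f g : ℝ → ℝ} {β γ₁ γ₂ : ℝ} {q : ℝ → ℝ → ℝ}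
    (hq : IsPoincareSolution u f g β γ₁ γ₂ q) {x y : ℝ} (hx : 0 < x) (hy : 0 < y) :
    ∃ L Lx Ly : ℝ × ℝ →L[ℝ] ℝ,
      HasFDerivAt (Function.uncurry q) L (x, y) ∧
      HasFDerivAt (Function.uncurry (partialX q)) Lx (x, y) ∧
      HasFDerivAt (Function.uncurry (partialY q)) Ly (x, y) ∧ L (1, 0) = partialX q x y ∧
      Lx (1, 0) + Ly (0, 1) = -(u x * q x y) := by
  set Q : ℝ × ℝ → ℝ := Function.uncurry q with hQ
  have hopen : IsOpen ((Ioi 0 ×ˢ Ioi 0 : Set (ℝ × ℝ))) := isOpen_Ioi.prod isOpen_Ioi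
  have hC : ∀ p ∈ (Ioi 0 ×ˢ Ioi 0 : Set (ℝ × ℝ)), ContDiffAt ℝ 2 Q p := fun p hp =>
    hq.contDiff_open.contDiffAt (hopen.mem_nhds hp)
  have hD : ∀ p ∈ (Ioi 0 ×ˢ Ioi 0 : Set (ℝ × ℝ)), HasFDerivAt Q (fderiv ℝ Q p) p := fun p hp =>
    ((hC p hp).differentiableAt (by norm_num)).hasFDerivAt
  have hX : ∀ p ∈ (Ioi 0 ×ˢ Ioi 0 : Set (ℝ × ℝ)),
      HasDerivAt (fun s => q s p.2) (fderiv ℝ Q p (1, 0)) p.1 := fun p hp =>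
    HasFDerivAt.comp_hasDerivAt (l := Q) (f := fun s => (s, p.2)) p.1 (hD p hp)
      (hasDerivAt_prodMk_left p.1 p.2)
  have hY : ∀ p ∈ (Ioi 0 ×ˢ Ioi 0 : Set (ℝ × ℝ)),
      HasDerivAt (fun t => q p.1 t) (fderiv ℝ Q p (0, 1)) p.2 := fun p hp =>
    HasFDerivAt.comp_hasDerivAt (l := Q) (f := fun t => (p.1, t)) p.2 (hD p hp)
      (hasDerivAt_prodMk_right p.1 p.2)
  have hX' : ∀ p ∈ (Ioi 0 ×ˢ Ioi 0 : Set (ℝ × ℝ)),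
      partialX q p.1 p.2 = fderiv ℝ Q p (1, 0) := fun p hp =>
    (hX p hp).hasDerivWithinAt.derivWithin (uniqueDiffOn_Ici 0 p.1 (Ioi_subset_Ici_self hp.1))
  have hY' : ∀ p ∈ (Ioi 0 ×ˢ Ioi 0 : Set (ℝ × ℝ)),
      partialY q p.1 p.2 = fderiv ℝ Q p (0, 1) := fun p hp =>
    (hY p hp).hasDerivWithinAt.derivWithin (uniqueDiffOn_Ici 0 p.2 (Ioi_subset_Ici_self hp.2))
  have hmem : (x, y) ∈ (Ioi 0 ×ˢ Ioi 0 : Set (ℝ × ℝ)) := ⟨hx, hy⟩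
  have hDD : HasFDerivAt (fderiv ℝ Q) (fderiv ℝ (fderiv ℝ Q) (x, y)) (x, y) :=
    (((hC _ hmem).fderiv_right (m := 1) (by norm_num)).differentiableAt
      (by norm_num)).hasFDerivAt
  have hev : ∀ᶠ p in 𝓝 (x, y), p ∈ (Ioi 0 ×ˢ Ioi 0 : Set (ℝ × ℝ)) := hopen.mem_nhds hmem
  have hLx : HasFDerivAt (Function.uncurry (partialX q))
      ((ContinuousLinearMap.apply ℝ ℝ ((1, 0) : ℝ × ℝ)).comp (fderiv ℝ (fderiv ℝ Q) (x, y)))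
      (x, y) :=
    ((ContinuousLinearMap.apply ℝ ℝ ((1, 0) : ℝ × ℝ)).hasFDerivAt.comp (x, y)
      hDD).congr_of_eventuallyEq (hev.mono fun p hp => hX' p hp)
  have hLy : HasFDerivAt (Function.uncurry (partialY q))
      ((ContinuousLinearMap.apply ℝ ℝ ((0, 1) : ℝ × ℝ)).comp (fderiv ℝ (fderiv ℝ Q) (x, y)))
      (x, y) :=
    ((ContinuousLinearMap.apply ℝ ℝ ((0, 1) : ℝ × ℝ)).hasFDerivAt.comp (x, y)
      hDD).congr_of_eventuallyEq (hev.mono fun p hp => hY' p hp)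
  refine ⟨_, _, _, hD _ hmem, hLx, hLy, (hX' _ hmem).symm, ?_⟩
  have h1 := ((HasFDerivAt.comp_hasDerivAt (f := fun s => (s, y)) x hLx
    (hasDerivAt_prodMk_left x y)).congr_of_eventuallyEq (f₁ := deriv fun s => q s y)
      ((lt_mem_nhds hx).mono fun s hs => ((hX (s, y) ⟨hs, hy⟩).deriv.trans
        (hX' (s, y) ⟨hs, hy⟩).symm))).deriv
  have h2 := ((HasFDerivAt.comp_hasDerivAt (f := fun t => (x, t)) y hLy
    (hasDerivAt_prodMk_right x y)).congr_of_eventuallyEq (f₁ := deriv fun t => q x t)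
      ((lt_mem_nhds hy).mono fun t ht => ((hY (x, t) ⟨hx, ht⟩).deriv.trans
        (hY' (x, t) ⟨hx, ht⟩).symm))).deriv
  have h3 := hq.pde x y hx hy
  rw [h1, h2] at h3
  linarith

/-- `C (1 + z)^{-1-ε}` majorises in either variable, as `1 + x + y` exceeds both `1 + x` and `1 +
y`; the exponent below `-1` makes it integrable. -/
theorem GenLaplace.IsPoincareSolution.exists_isDecayingSolution {u f g : ℝ → ℝ} {β γ₁ γ₂ : ℝ}
    {q : ℝ → ℝ → ℝ} (hq : IsPoincareSolution u f g β γ₁ γ₂ q) (hd : HasDecay q) :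
    ∃ w, IsDecayingSolution u q (partialX q) (partialY q) w := by
  obtain ⟨C, ε, hε, hC⟩ := hd
  have hC0 : 0 ≤ C := by
    have := (abs_nonneg _).trans (hC 0 0 le_rfl le_rfl).1
    simpa using this
  set Q : ℝ × ℝ → ℝ := fun p => q p.1 p.2 with hQ
  have hS : UniqueDiffOn ℝ quarterPlane := (uniqueDiffOn_Ici 0).prod (uniqueDiffOn_Ici 0)
  have hD : ∀ p ∈ quarterPlane, HasFDerivWithinAt Q (fderivWithin ℝ Q quarterPlane p)
      quarterPlane p := fun p hp =>
    ((hq.contDiff_closed.differentiableOn (by norm_num)) p hp).hasFDerivWithinAt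
  have hX : ∀ x y, 0 ≤ x → 0 ≤ y → HasDerivWithinAt (fun s => q s y)
      (fderivWithin ℝ Q quarterPlane (x, y) (1, 0)) (Ici 0) x := fun x y hx hy =>
    HasFDerivWithinAt.comp_hasDerivWithinAt (l := Q) (f := fun s => (s, y)) x
      (hD (x, y) ⟨hx, hy⟩) (hasDerivAt_prodMk_left x y).hasDerivWithinAt fun s hs => ⟨hs, hy⟩
  have hY : ∀ x y, 0 ≤ x → 0 ≤ y → HasDerivWithinAt (fun t => q x t)
      (fderivWithin ℝ Q quarterPlane (x, y) (0, 1)) (Ici 0) y := fun x y hx hy =>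
    HasFDerivWithinAt.comp_hasDerivWithinAt (l := Q) (f := fun t => (x, t)) y
      (hD (x, y) ⟨hx, hy⟩) (hasDerivAt_prodMk_right x y).hasDerivWithinAt fun s hs => ⟨hx, hs⟩
  have hX' : ∀ x y, 0 ≤ x → 0 ≤ y →
      partialX q x y = fderivWithin ℝ Q quarterPlane (x, y) (1, 0) := fun x y hx hy =>
    (hX x y hx hy).derivWithin (uniqueDiffOn_Ici 0 x hx)
  have hY' : ∀ x y, 0 ≤ x → 0 ≤ y →
      partialY q x y = fderivWithin ℝ Q quarterPlane (x, y) (0, 1) := fun x y hx hy =>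
    (hY x y hx hy).derivWithin (uniqueDiffOn_Ici 0 y hy)
  have hcD := hq.contDiff_closed.continuousOn_fderivWithin hS le_rfl
  have hle : ∀ x y z : ℝ, 0 ≤ z → 1 + z ≤ 1 + x + y →
      C * (1 + x + y) ^ (-(1 + ε)) ≤ C * (z + 1) ^ (-(1 + ε)) := fun x y z hz h =>
    mul_le_mul_of_nonneg_left (Real.rpow_le_rpow_of_nonpos (by linarith) (by linarith)
      (by linarith)) hC0
  refine ⟨fun x => C * (x + 1) ^ (-(1 + ε)), hq.contDiff_closed.continuousOn, ?_, ?_, ?_, ?_,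
    fun x y hx hy => hq.interior hx hy, ?_, ?_, ?_, ?_⟩
  · exact (hcD.clm_apply continuousOn_const).congr fun p hp => hX' p.1 p.2 hp.1 hp.2
  · exact (hcD.clm_apply continuousOn_const).congr fun p hp => hY' p.1 p.2 hp.1 hp.2
  · intro x y hx hy
    rw [hX' x y hx hy]; exact hX x y hx hy
  · intro x y hx hy
    rw [hY' x y hx hy]; exact hY x y hx hy
  · exact (integrableOn_add_rpow_Ioi_of_lt (by linarith) (by norm_num)).const_mul C
  · simpa using ((tendsto_rpow_neg_atTop (by linarith : 0 < 1 + ε)).comp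
      (tendsto_atTop_add_const_right atTop (1 : ℝ) tendsto_id)).const_mul C
  · intro x y hx hy
    obtain ⟨h1, h2, h3⟩ := hC x y hx hy
    have := hle x y x hx (by linarith)
    exact ⟨h1.trans this, h2.trans this, h3.trans this⟩
  · intro x y hx hy
    obtain ⟨h1, h2, h3⟩ := hC x y hx hy
    have := hle x y y hy (by linarith)
    exact ⟨h1.trans this, h2.trans this, h3.trans this⟩

/-- A continuous function on the quarter plane bounded by an integrable function `w` of each
variable. -/
structure IsDominated (v : ℝ → ℝ → ℝ) (w : ℝ → ℝ) : Prop where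
  cont : ContinuousOn (Function.uncurry v) quarterPlane
  int : IntegrableOn w (Ioi 0)
  tendsto : Tendsto w atTop (𝓝 0)
  le_left : ∀ x y, 0 ≤ x → 0 ≤ y → |v x y| ≤ w x
  le_right : ∀ x y, 0 ≤ x → 0 ≤ y → |v x y| ≤ w y

/-! ### Integrals of dominated functions against bounded weights. -/

namespace IsDominated

variable {v : ℝ → ℝ → ℝ} {w : ℝ → ℝ}

theorem continuousOn_left (hv : IsDominated v w) {y : ℝ} (hy : 0 ≤ y) :
    ContinuousOn (fun x => v x y) (Ici 0) :=
  hv.cont.comp (f := fun x => (x, y)) (by fun_prop) fun _ hx => ⟨hx, hy⟩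

theorem continuousOn_right (hv : IsDominated v w) {x : ℝ} (hx : 0 ≤ x) :
    ContinuousOn (fun y => v x y) (Ici 0) :=
  hv.cont.comp (f := fun y => (x, y)) (by fun_prop) fun _ hy => ⟨hx, hy⟩

theorem integrableOn_left (hv : IsDominated v w) {y : ℝ} (hy : 0 ≤ y) :
    IntegrableOn (fun x => v x y) (Ioi 0) := by
  refine Integrable.mono' hv.int
    (((hv.continuousOn_left hy).mono Ioi_subset_Ici_self).aestronglyMeasurable
      measurableSet_Ioi) ?_
  filter_upwards [ae_restrict_mem measurableSet_Ioi] with x hx using hv.le_left x y (le_of_lt hx) hy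

theorem integrableOn_right (hv : IsDominated v w) {x : ℝ} (hx : 0 ≤ x) :
    IntegrableOn (fun y => v x y) (Ioi 0) := by
  refine Integrable.mono' hv.int
    (((hv.continuousOn_right hx).mono Ioi_subset_Ici_self).aestronglyMeasurable
      measurableSet_Ioi) ?_
  filter_upwards [ae_restrict_mem measurableSet_Ioi] with y hy
    using hv.le_right x y hx (le_of_lt hy)

theorem tendsto_left (hv : IsDominated v w) {y : ℝ} (hy : 0 ≤ y) :
    Tendsto (fun x => v x y) atTop (𝓝 0) :=
  squeeze_zero_norm' ((eventually_ge_atTop 0).mono fun x hx => hv.le_left x y hx hy) hv.tendsto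

theorem tendsto_right (hv : IsDominated v w) {x : ℝ} (hx : 0 ≤ x) :
    Tendsto (fun y => v x y) atTop (𝓝 0) :=
  squeeze_zero_norm' ((eventually_ge_atTop 0).mono fun y hy => hv.le_right x y hx hy) hv.tendsto

variable {χ : ℝ → ℝ} {A : ℝ}

theorem abs_mul_le (hv : IsDominated v w) (hA : ∀ x, 0 ≤ x → |χ x| ≤ A) {x y : ℝ} (hx : 0 ≤ x)
    (hy : 0 ≤ y) : ‖χ x * v x y‖ ≤ A * w x := by
  rw [Real.norm_eq_abs, abs_mul]
  exact mul_le_mul (hA x hx) (hv.le_left x y hx hy) (abs_nonneg _)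
    ((abs_nonneg _).trans (hA x hx))

theorem aestronglyMeasurable_mul (hv : IsDominated v w) (hχ : ContinuousOn χ (Ici 0)) {y : ℝ}
    (hy : 0 ≤ y) : AEStronglyMeasurable (fun x => χ x * v x y) (volume.restrict (Ioi 0)) :=
  ((hχ.mul (hv.continuousOn_left hy)).mono Ioi_subset_Ici_self).aestronglyMeasurable
    measurableSet_Ioi

theorem integrableOn_mul (hv : IsDominated v w) (hχ : ContinuousOn χ (Ici 0))
    (hA : ∀ x, 0 ≤ x → |χ x| ≤ A) {y : ℝ} (hy : 0 ≤ y) :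
    IntegrableOn (fun x => χ x * v x y) (Ioi 0) := by
  refine Integrable.mono' (hv.int.const_mul A) (hv.aestronglyMeasurable_mul hχ hy) ?_
  filter_upwards [ae_restrict_mem measurableSet_Ioi] with x hx
    using hv.abs_mul_le hA (le_of_lt hx) hy

theorem continuousOn_integral_mul (hv : IsDominated v w) (hχ : ContinuousOn χ (Ici 0))
    (hA : ∀ x, 0 ≤ x → |χ x| ≤ A) :
    ContinuousOn (fun y => ∫ x in Ioi 0, χ x * v x y) (Ici 0) := by
  refine continuousOn_of_dominated (bound := fun x => A * w x)
    (fun y hy => hv.aestronglyMeasurable_mul hχ hy) (fun y hy => ?_) (hv.int.const_mul A) ?_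
  · filter_upwards [ae_restrict_mem measurableSet_Ioi] with x hx
      using hv.abs_mul_le hA (le_of_lt hx) hy
  · filter_upwards [ae_restrict_mem measurableSet_Ioi] with x hx
      using continuousOn_const.mul (hv.continuousOn_right (le_of_lt hx))

theorem tendsto_integral_mul (hv : IsDominated v w) (hχ : ContinuousOn χ (Ici 0))
    (hA : ∀ x, 0 ≤ x → |χ x| ≤ A) :
    Tendsto (fun y => ∫ x in Ioi 0, χ x * v x y) atTop (𝓝 0) := by
  have : Tendsto (fun y => ∫ x in Ioi 0, χ x * v x y) atTop (𝓝 (∫ _ in Ioi (0 : ℝ), (0 : ℝ))) := by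
    refine tendsto_integral_filter_of_dominated_convergence (fun x => A * w x) ?_ ?_
      (hv.int.const_mul A) ?_
    · exact (eventually_ge_atTop 0).mono fun y hy => hv.aestronglyMeasurable_mul hχ hy
    · filter_upwards [eventually_ge_atTop 0] with y hy
      filter_upwards [ae_restrict_mem measurableSet_Ioi] with x hx
        using hv.abs_mul_le hA (le_of_lt hx) hy
    · filter_upwards [ae_restrict_mem measurableSet_Ioi] with x hx
      simpa using (hv.tendsto_right (le_of_lt hx)).const_mul (χ x)
  simpa using this

theorem integral_mul_swap (hv : IsDominated v w) (hχ : ContinuousOn χ (Ici 0))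
    (hA : ∀ x, 0 ≤ x → |χ x| ≤ A) {a b : ℝ} (ha : 0 ≤ a) (hab : a ≤ b) :
    IntegrableOn (fun x => ∫ y in a..b, χ x * v x y) (Ioi 0) ∧
    ∫ x in Ioi 0, ∫ y in a..b, χ x * v x y = ∫ y in a..b, ∫ x in Ioi 0, χ x * v x y := by
  have hI : Integrable (fun p : ℝ × ℝ => χ p.1 * v p.1 p.2)
      ((volume.restrict (Ioi 0)).prod (volume.restrict (Ioc a b))) := by
    refine Integrable.mono' ((hv.int.const_mul A).mul_prod (integrable_const (1 : ℝ))) ?_ ?_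
    · rw [Measure.prod_restrict]
      refine ContinuousOn.aestronglyMeasurable ?_ (measurableSet_Ioi.prod measurableSet_Ioc)
      refine ContinuousOn.mul (hχ.comp continuousOn_fst fun p hp => Ioi_subset_Ici_self hp.1)
        (hv.cont.mono fun p hp => ⟨Ioi_subset_Ici_self hp.1, ha.trans (le_of_lt hp.2.1)⟩)
    · rw [Measure.prod_restrict]
      filter_upwards [ae_restrict_mem (measurableSet_Ioi.prod measurableSet_Ioc)] with p hp
      rw [mul_one]
      exact hv.abs_mul_le hA (le_of_lt hp.1) (ha.trans (le_of_lt hp.2.1))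
  simp only [intervalIntegral.integral_of_le hab]
  exact ⟨hI.integral_prod_left, integral_integral_swap hI⟩

end IsDominated

/-- A bounded real solution of `χ'' + (u + lam) χ = 0` on `[0, ∞)` with bounded derivative. -/
structure IsBoundedSolution (u : ℝ → ℝ) (lam : ℝ) (χ χ' : ℝ → ℝ) : Prop where
  deriv_fst : ∀ x, 0 ≤ x → HasDerivWithinAt χ (χ' x) (Ici 0) x
  deriv_snd : ∀ x, 0 ≤ x → HasDerivWithinAt χ' (-(u x + lam) * χ x) (Ici 0) x
  bounded : ∃ A, ∀ x, 0 ≤ x → |χ x| ≤ A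
  bounded_deriv : ∃ B, ∀ x, 0 ≤ x → |χ' x| ≤ B

namespace IsBoundedSolution

variable {u χ χ' : ℝ → ℝ} {lam : ℝ}

theorem continuousOn (h : IsBoundedSolution u lam χ χ') : ContinuousOn χ (Ici 0) :=
  fun x hx => (h.deriv_fst x hx).continuousWithinAt

theorem continuousOn_deriv (h : IsBoundedSolution u lam χ χ') : ContinuousOn χ' (Ici 0) :=
  fun x hx => (h.deriv_snd x hx).continuousWithinAt

end IsBoundedSolution

/-! ### Green's identity and the transform in `x`. -/

namespace IsDecayingSolution

variable {u w χ χ' : ℝ → ℝ} {q qx qy : ℝ → ℝ → ℝ} {lam : ℝ}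

theorem dom (hq : IsDecayingSolution u q qx qy w) : IsDominated q w :=
  ⟨hq.cont, hq.int, hq.tendsto, fun x y hx hy => (hq.le_left x y hx hy).1,
    fun x y hx hy => (hq.le_right x y hx hy).1⟩

theorem dom_x (hq : IsDecayingSolution u q qx qy w) : IsDominated qx w :=
  ⟨hq.cont_x, hq.int, hq.tendsto, fun x y hx hy => (hq.le_left x y hx hy).2.1,
    fun x y hx hy => (hq.le_right x y hx hy).2.1⟩

theorem dom_y (hq : IsDecayingSolution u q qx qy w) : IsDominated qy w :=
  ⟨hq.cont_y, hq.int, hq.tendsto, fun x y hx hy => (hq.le_left x y hx hy).2.2,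
    fun x y hx hy => (hq.le_right x y hx hy).2.2⟩

theorem isAdmissible_left (hq : IsDecayingSolution u q qx qy w) {y : ℝ} (hy : 0 ≤ y) :
    IsAdmissible (fun x => q x y) (fun x => qx x y) where
  cont := hq.dom.continuousOn_left hy
  cont_deriv := hq.dom_x.continuousOn_left hy
  hasDerivAt x hx := (hq.deriv_x x y hx.le hy).hasDerivAt (Ici_mem_nhds hx)
  int := hq.dom.integrableOn_left hy
  int_deriv := hq.dom_x.integrableOn_left hy
  tendsto := hq.dom.tendsto_left hy

theorem isAdmissible_right (hq : IsDecayingSolution u q qx qy w) {x : ℝ} (hx : 0 ≤ x) :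
    IsAdmissible (fun y => q x y) (fun y => qy x y) where
  cont := hq.dom.continuousOn_right hx
  cont_deriv := hq.dom_y.continuousOn_right hx
  hasDerivAt y hy := (hq.deriv_y x y hx hy.le).hasDerivAt (Ici_mem_nhds hy)
  int := hq.dom.integrableOn_right hx
  int_deriv := hq.dom_y.integrableOn_right hx
  tendsto := hq.dom.tendsto_right hx

theorem hasDerivAt_integral_mul (hq : IsDecayingSolution u q qx qy w)
    (hχ : IsBoundedSolution u lam χ χ') {y : ℝ} (hy : 0 < y) :
    HasDerivAt (fun y => ∫ x in Ioi 0, χ x * q x y) (∫ x in Ioi 0, χ x * qy x y) y := by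
  obtain ⟨A, hA⟩ := hχ.bounded
  refine (hasDerivAt_integral_of_dominated_loc_of_deriv_le (𝕜 := ℝ) (bound := fun x => A * w x)
    (F := fun y x => χ x * q x y) (F' := fun y x => χ x * qy x y)
    (Ioi_mem_nhds hy) ?_ (hq.dom.integrableOn_mul hχ.continuousOn hA hy.le)
    (hq.dom_y.aestronglyMeasurable_mul hχ.continuousOn hy.le) ?_ (hq.int.const_mul A) ?_).2
  · exact (lt_mem_nhds hy).mono fun t ht =>
      hq.dom.aestronglyMeasurable_mul hχ.continuousOn (le_of_lt ht)
  · filter_upwards [ae_restrict_mem measurableSet_Ioi] with x hx t ht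
      using hq.dom_y.abs_mul_le hA (le_of_lt hx) (le_of_lt ht)
  · filter_upwards [ae_restrict_mem measurableSet_Ioi] with x hx t ht
    exact ((hq.deriv_y x t (le_of_lt hx) (le_of_lt ht)).hasDerivAt (Ici_mem_nhds ht)).const_mul _

/-- Divergence theorem for the field `(χ q_x - χ' q, χ q_y)`, whose divergence is `lam χ q` by the
two equations. It asks for differentiability only in the open rectangle and continuity up to its
boundary, so `C¹` regularity of `q` on the boundary suffices. -/
theorem green_identity (hq : IsDecayingSolution u q qx qy w)
    (hχ : IsBoundedSolution u lam χ χ') {X a b : ℝ} (hX : 0 ≤ X) (ha : 0 ≤ a) (hab : a ≤ b) :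
    ∫ x in (0 : ℝ)..X, ∫ y in a..b, lam * (χ x * q x y)
      = (((∫ x in (0 : ℝ)..X, χ x * qy x b) - ∫ x in (0 : ℝ)..X, χ x * qy x a)
        + ∫ y in a..b, (χ X * qx X y - χ' X * q X y))
        - ∫ y in a..b, (χ 0 * qx 0 y - χ' 0 * q 0 y) := by
  have hsub : Icc 0 X ×ˢ Icc a b ⊆ quarterPlane := fun p hp => ⟨hp.1.1, ha.trans hp.2.1⟩
  have hc1 : ContinuousOn (fun p : ℝ × ℝ => χ p.1) (Icc 0 X ×ˢ Icc a b) :=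
    hχ.continuousOn.comp continuousOn_fst fun p hp => hp.1.1
  have hc2 : ContinuousOn (fun p : ℝ × ℝ => χ' p.1) (Icc 0 X ×ˢ Icc a b) :=
    hχ.continuousOn_deriv.comp continuousOn_fst fun p hp => hp.1.1
  have hq' := hq.cont.mono hsub
  choose! L Lx Ly hL using hq.interior
  have hχf : ∀ x y, 0 < x → HasFDerivAt (fun p : ℝ × ℝ => χ p.1)
      (χ' x • ContinuousLinearMap.fst ℝ ℝ ℝ) (x, y) := fun x y hx =>
    ((hχ.deriv_fst x hx.le).hasDerivAt (Ici_mem_nhds hx)).comp_hasFDerivAt (x, y)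
      (f := Prod.fst) hasFDerivAt_fst
  have hχf' : ∀ x y, 0 < x → HasFDerivAt (fun p : ℝ × ℝ => χ' p.1)
      ((-(u x + lam) * χ x) • ContinuousLinearMap.fst ℝ ℝ ℝ) (x, y) := fun x y hx =>
    ((hχ.deriv_snd x hx.le).hasDerivAt (Ici_mem_nhds hx)).comp_hasFDerivAt (x, y)
      (f := Prod.fst) hasFDerivAt_fst
  have hkey : ∀ x y, 0 < x → 0 < y →
      (χ x • Lx x y + qx x y • (χ' x • ContinuousLinearMap.fst ℝ ℝ ℝ)
        - (χ' x • L x y + q x y • ((-(u x + lam) * χ x) • ContinuousLinearMap.fst ℝ ℝ ℝ)))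
          ((1, 0) : ℝ × ℝ)
        + (χ x • Ly x y + qy x y • (χ' x • ContinuousLinearMap.fst ℝ ℝ ℝ)) ((0, 1) : ℝ × ℝ)
      = lam * (χ x * q x y) := by
    intro x y hx hy
    obtain ⟨-, -, -, h4, h5⟩ := hL x y hx hy
    simp only [add_apply, sub_apply, smul_apply, ContinuousLinearMap.coe_fst', smul_eq_mul, h4]
    linear_combination χ x * h5
  have key := integral2_divergence_prod_of_hasFDerivAt
    (fun p : ℝ × ℝ => χ p.1 * Function.uncurry qx p - χ' p.1 * Function.uncurry q p)
    (fun p : ℝ × ℝ => χ p.1 * Function.uncurry qy p)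
    (fun p => (χ p.1 • Lx p.1 p.2
        + Function.uncurry qx p • (χ' p.1 • ContinuousLinearMap.fst ℝ ℝ ℝ))
      - (χ' p.1 • L p.1 p.2
        + Function.uncurry q p • ((-(u p.1 + lam) * χ p.1) • ContinuousLinearMap.fst ℝ ℝ ℝ)))
    (fun p => χ p.1 • Ly p.1 p.2
        + Function.uncurry qy p • (χ' p.1 • ContinuousLinearMap.fst ℝ ℝ ℝ))
    0 a X b ?_ ?_ ?_ ?_ ?_
  · refine Eq.trans ?_ key
    refine intervalIntegral.integral_congr_ae (Eventually.of_forall fun x hx => ?_)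
    refine intervalIntegral.integral_congr_ae (Eventually.of_forall fun y hy => ?_)
    rw [uIoc_of_le hX] at hx
    rw [uIoc_of_le hab] at hy
    exact (hkey x y hx.1 (ha.trans_lt hy.1)).symm
  · rw [uIcc_of_le hX, uIcc_of_le hab]
    exact (hc1.mul (hq.cont_x.mono hsub)).sub (hc2.mul hq')
  · rw [uIcc_of_le hX, uIcc_of_le hab]
    exact hc1.mul (hq.cont_y.mono hsub)
  · rw [min_eq_left hX, max_eq_right hX, min_eq_left hab, max_eq_right hab]
    rintro ⟨x, y⟩ ⟨hx, hy⟩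
    obtain ⟨h1, h2, -⟩ := hL x y hx.1 (ha.trans_lt hy.1)
    exact ((hχf x y hx.1).mul h2).sub ((hχf' x y hx.1).mul h1)
  · rw [min_eq_left hX, max_eq_right hX, min_eq_left hab, max_eq_right hab]
    rintro ⟨x, y⟩ ⟨hx, hy⟩
    obtain ⟨-, -, h3, -⟩ := hL x y hx.1 (ha.trans_lt hy.1)
    exact (hχf x y hx.1).mul h3
  · rw [uIcc_of_le hX, uIcc_of_le hab]
    -- On the boundary of the quarter plane the chosen derivatives are arbitrary. Up to a null set
    -- the rectangle may be taken open, and there the divergence is the continuous function `lam χ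
    -- q`.
    have hae : (Ioo 0 X ×ˢ Ioo a b : Set (ℝ × ℝ)) =ᵐ[volume] Icc 0 X ×ˢ Icc a b :=
      Measure.set_prod_ae_eq Ioo_ae_eq_Icc Ioo_ae_eq_Icc
    have hi : IntegrableOn (fun p : ℝ × ℝ => lam * (χ p.1 * Function.uncurry q p))
        (Icc 0 X ×ˢ Icc a b) :=
      (continuousOn_const.mul (hc1.mul hq')).integrableOn_compact (isCompact_Icc.prod isCompact_Icc)
    rw [← integrableOn_congr_set_ae hae] at hi ⊢
    exact hi.congr_fun (fun p hp => (hkey p.1 p.2 hp.1.1 (ha.trans_lt hp.2.1)).symm)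
      (measurableSet_Ioo.prod measurableSet_Ioo)

/-- Green's identity with `X → ∞`; the far side is killed by `w`. This is the integrated form of
`P'' = lam P + source` for `P(y) = ∫ χ q(x,y) dx`, obtained without integrating second derivatives
of `q`, which are not controlled. -/
theorem integral_mul_deriv_sub (hq : IsDecayingSolution u q qx qy w)
    (hχ : IsBoundedSolution u lam χ χ') {a b : ℝ} (ha : 0 ≤ a) (hab : a ≤ b) :
    (∫ x in Ioi 0, χ x * qy x b) - ∫ x in Ioi 0, χ x * qy x a
      = ∫ y in a..b, (lam * (∫ x in Ioi 0, χ x * q x y) + (χ 0 * qx 0 y - χ' 0 * q 0 y)) := by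
  obtain ⟨A, hA⟩ := hχ.bounded
  obtain ⟨B, hB⟩ := hχ.bounded_deriv
  have hb := ha.trans hab
  obtain ⟨hi, hswap⟩ := hq.dom.integral_mul_swap hχ.continuousOn hA ha hab
  have hlhs : Tendsto (fun X => ∫ x in (0 : ℝ)..X, ∫ y in a..b, lam * (χ x * q x y)) atTop
      (𝓝 (lam * ∫ y in a..b, ∫ x in Ioi 0, χ x * q x y)) := by
    rw [← hswap]
    simp only [intervalIntegral.integral_const_mul] at hi ⊢
    exact (intervalIntegral_tendsto_integral_Ioi 0 hi tendsto_id).const_mul lam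
  have hside : Tendsto (fun X => ∫ y in a..b, (χ X * qx X y - χ' X * q X y)) atTop (𝓝 0) := by
    have hbd : Tendsto (fun X => ((A + B) * w X) * |b - a|) atTop (𝓝 0) := by
      simpa using (hq.tendsto.const_mul (A + B)).mul_const |b - a|
    refine squeeze_zero_norm' ((eventually_ge_atTop 0).mono fun X hX => ?_) hbd
    refine intervalIntegral.norm_integral_le_of_norm_le_const fun y hy => ?_
    rw [uIoc_of_le hab] at hy
    have hy0 : 0 ≤ y := ha.trans hy.1.le
    have h1 := hq.dom_x.abs_mul_le hA hX hy0
    have h2 := hq.dom.abs_mul_le hB hX hy0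
    exact (norm_sub_le _ _).trans (by linarith)
  have hrhs := (((intervalIntegral_tendsto_integral_Ioi 0
    (hq.dom_y.integrableOn_mul hχ.continuousOn hA hb) tendsto_id).sub
    (intervalIntegral_tendsto_integral_Ioi 0
    (hq.dom_y.integrableOn_mul hχ.continuousOn hA ha) tendsto_id)).add hside).sub_const
      (∫ y in a..b, (χ 0 * qx 0 y - χ' 0 * q 0 y))
  have heq := tendsto_nhds_unique (hlhs.congr' ((eventually_ge_atTop 0).mono fun X hX =>
    hq.green_identity hχ hX ha hab)) hrhs
  have hsub : uIcc a b ⊆ Ici 0 := by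
    rw [uIcc_of_le hab]; exact fun y hy => ha.trans hy.1
  rw [intervalIntegral.integral_add, intervalIntegral.integral_const_mul, heq]
  · ring
  · exact (((hq.dom.continuousOn_integral_mul hχ.continuousOn hA).mono
      hsub).intervalIntegrable).const_mul lam
  · exact (((continuousOn_const.mul (hq.dom_x.continuousOn_right le_rfl)).sub
      (continuousOn_const.mul (hq.dom.continuousOn_right le_rfl))).mono hsub).intervalIntegrable

theorem hasDerivAt_integral_mul_deriv (hq : IsDecayingSolution u q qx qy w)
    (hχ : IsBoundedSolution u lam χ χ') {y : ℝ} (hy : 0 < y) :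
    HasDerivAt (fun y => ∫ x in Ioi 0, χ x * qy x y)
      (lam * (∫ x in Ioi 0, χ x * q x y) + (χ 0 * qx 0 y - χ' 0 * q 0 y)) y := by
  obtain ⟨A, hA⟩ := hχ.bounded
  set r : ℝ → ℝ := fun y => lam * (∫ x in Ioi 0, χ x * q x y) + (χ 0 * qx 0 y - χ' 0 * q 0 y)
    with hr
  have hrc : ContinuousOn r (Ici 0) :=
    (continuousOn_const.mul (hq.dom.continuousOn_integral_mul hχ.continuousOn hA)).add
      ((continuousOn_const.mul (hq.dom_x.continuousOn_right le_rfl)).sub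
        (continuousOn_const.mul (hq.dom.continuousOn_right le_rfl)))
  have hd : HasDerivAt (fun y => ∫ t in (0 : ℝ)..y, r t) (r y) y := by
    refine intervalIntegral.integral_hasDerivAt_right ?_ ?_ (hrc.continuousAt (Ici_mem_nhds hy))
    · refine (hrc.mono ?_).intervalIntegrable
      rw [uIcc_of_le hy.le]; exact fun t ht => ht.1
    · exact (hrc.mono Ioi_subset_Ici_self).stronglyMeasurableAtFilter isOpen_Ioi y hy
  refine (hd.const_add (∫ x in Ioi 0, χ x * qy x 0)).congr_of_eventuallyEq ?_
  filter_upwards [lt_mem_nhds hy] with t ht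
  have := hq.integral_mul_deriv_sub hχ le_rfl (le_of_lt ht)
  simp only [hr]
  linarith

end IsDecayingSolution

/-! ### The equation `P'' = c² P + r` on a half line -/

section SecondOrder

variable {P P₁ r : ℝ → ℂ} {c : ℂ}

/-- The factorisation `d²/dy² - c² = (d/dy + c)(d/dy - c)`: the function `P' - cP` satisfies a first
order equation with this integrating factor. -/
theorem hasDerivAt_exp_mul_factor (hP : ∀ y, 0 < y → HasDerivAt P (P₁ y) y)
    (hP₁ : ∀ y, 0 < y → HasDerivAt P₁ (c ^ 2 * P y + r y) y) {a y : ℝ} (hy : 0 < y) :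
    HasDerivAt (fun η : ℝ => Complex.exp (c * (η - a : ℝ)) * (P₁ η - c * P η))
      (Complex.exp (c * (y - a : ℝ)) * r y) y := by
  have h1 : HasDerivAt (fun η : ℝ => Complex.exp (c * (η - a : ℝ)))
      (c * Complex.exp (c * (y - a : ℝ))) y := by
    simpa using (hasDerivAt_cexp_mul c (y - a)).comp_sub_const y a
  exact (h1.mul ((hP₁ y hy).sub ((hP y hy).const_mul c))).congr_deriv
    (by simp only [Pi.sub_apply]; ring)

theorem norm_exp_mul_sub_le_one (hc : c.re ≤ 0) {a η : ℝ} (h : a ≤ η) :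
    ‖Complex.exp (c * (η - a : ℝ))‖ ≤ 1 := by
  rw [Complex.norm_exp, Complex.re_mul_ofReal]
  exact Real.exp_le_one_iff.2 (mul_nonpos_of_nonpos_of_nonneg hc (by linarith))

theorem integrableOn_exp_mul_sub (hr : IntegrableOn r (Ioi 0)) (hc : c.re ≤ 0) {a : ℝ}
    (ha : 0 ≤ a) : IntegrableOn (fun η => Complex.exp (c * (η - a : ℝ)) * r η) (Ioi a) := by
  refine Integrable.mono (hr.mono_set (Ioi_subset_Ioi ha))
    ((by fun_prop : Continuous fun η : ℝ => Complex.exp (c * (η - a : ℝ))).aestronglyMeasurable.mul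
      (hr.mono_set (Ioi_subset_Ioi ha)).aestronglyMeasurable) ?_
  filter_upwards [ae_restrict_mem measurableSet_Ioi] with η hη
  rw [norm_mul]
  exact mul_le_of_le_one_left (norm_nonneg _) (norm_exp_mul_sub_le_one hc (le_of_lt hη))

/-- `Re c ≤ 0` keeps the integrating factor bounded on `[y, ∞)`, and the decay of `P` and `P₁`
removes the contribution of infinity. -/
theorem mul_sub_eq_integral_tail (hPc : ContinuousOn P (Ici 0)) (hP₁c : ContinuousOn P₁ (Ici 0))
    (hP : ∀ y, 0 < y → HasDerivAt P (P₁ y) y)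
    (hP₁ : ∀ y, 0 < y → HasDerivAt P₁ (c ^ 2 * P y + r y) y)
    (hPt : Tendsto P atTop (𝓝 0)) (hP₁t : Tendsto P₁ atTop (𝓝 0))
    (hr : IntegrableOn r (Ioi 0)) (hc : c.re ≤ 0) {y : ℝ} (hy : 0 ≤ y) :
    c * P y - P₁ y = ∫ η in Ioi y, Complex.exp (c * (η - y : ℝ)) * r η := by
  have ht : Tendsto (fun η : ℝ => Complex.exp (c * (η - y : ℝ)) * (P₁ η - c * P η)) atTop
      (𝓝 0) := by
    have h1 : Tendsto (fun η => ‖P₁ η - c * P η‖) atTop (𝓝 0) := by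
      simpa using (hP₁t.sub (hPt.const_mul c)).norm
    refine squeeze_zero_norm' ((eventually_ge_atTop y).mono fun η hη => ?_) h1
    rw [norm_mul]
    exact mul_le_of_le_one_left (norm_nonneg _) (norm_exp_mul_sub_le_one hc hη)
  have hcont : ContinuousWithinAt
      (fun η : ℝ => Complex.exp (c * (η - y : ℝ)) * (P₁ η - c * P η)) (Ici y) y :=
    (ContinuousOn.mul (by fun_prop)
      ((hP₁c.sub (continuousOn_const.mul hPc)).mono (Ici_subset_Ici.2 hy))) y self_mem_Ici
  rw [integral_Ioi_of_hasDerivAt_of_tendsto hcont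
    (fun η hη => hasDerivAt_exp_mul_factor hP hP₁ (hy.trans_lt hη))
    (integrableOn_exp_mul_sub hr hc hy) ht]
  simp

theorem sub_mul_eq_integral_head (hPc : ContinuousOn P (Ici 0)) (hP₁c : ContinuousOn P₁ (Ici 0))
    (hP : ∀ y, 0 < y → HasDerivAt P (P₁ y) y)
    (hP₁ : ∀ y, 0 < y → HasDerivAt P₁ (c ^ 2 * P y + r y) y)
    (hr : ContinuousOn r (Ici 0)) {y : ℝ} (hy : 0 ≤ y) :
    P₁ y - c * P y = Complex.exp (-(c * y)) * (P₁ 0 - c * P 0)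
      + ∫ η in (0 : ℝ)..y, Complex.exp (c * (η - y : ℝ)) * r η := by
  have hsub : Icc 0 y ⊆ Ici 0 := fun t ht => ht.1
  rw [intervalIntegral.integral_eq_sub_of_hasDerivAt_of_le
    (f := fun η : ℝ => Complex.exp (c * (η - y : ℝ)) * (P₁ η - c * P η)) hy
    (ContinuousOn.mul (by fun_prop) ((hP₁c.sub (continuousOn_const.mul hPc)).mono hsub))
    (fun η hη => hasDerivAt_exp_mul_factor hP hP₁ hη.1)]
  · simp
  · refine ContinuousOn.intervalIntegrable ?_
    rw [uIcc_of_le hy]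
    exact ContinuousOn.mul (by fun_prop) (hr.mono hsub)

end SecondOrder

theorem IsEigenfunction.isBoundedSolution {u : ℝ → ℝ} {k : ℂ} {χ χ' : ℝ → ℂ}
    (h : IsEigenfunction u k χ χ') {lam A B : ℝ} (hlam : (lam : ℂ) = k ^ 2)
    (hre : ∀ x, 0 ≤ x → ((χ x).re : ℂ) = χ x) (hA : ∀ x, 0 ≤ x → ‖χ x‖ ≤ A)
    (hB : ∀ x, 0 ≤ x → ‖χ' x‖ ≤ B) :
    IsBoundedSolution u lam (fun x => (χ x).re) (fun x => (χ' x).re) where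
  deriv_fst x hx := Complex.reCLM.hasFDerivAt.comp_hasDerivWithinAt x (h.deriv_fst x hx)
  deriv_snd x hx := by
    refine (Complex.reCLM.hasFDerivAt.comp_hasDerivWithinAt x (h.deriv_snd x hx)).congr_deriv ?_
    rw [← hlam, ← hre x hx]
    simp [← Complex.ofReal_add, ← Complex.ofReal_mul, ← Complex.ofReal_neg]
  bounded := ⟨A, fun x hx => (Complex.abs_re_le_norm _).trans (hA x hx)⟩
  bounded_deriv := ⟨B, fun x hx => (Complex.abs_re_le_norm _).trans (hB x hx)⟩

/-! ### The transformed equation and the relations between boundary values. -/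

namespace IsDecayingSolution

variable {u w f g χ χ' : ℝ → ℝ} {q qx qy : ℝ → ℝ → ℝ} {lam γ₁ γ₂ : ℝ}

theorem integrableOn_source (hq : IsDecayingSolution u q qx qy w) (a b : ℝ) :
    IntegrableOn (fun y => ((a * qx 0 y - b * q 0 y : ℝ) : ℂ)) (Ioi 0) :=
  (((hq.dom_x.integrableOn_right le_rfl).const_mul a).sub
    ((hq.dom.integrableOn_right le_rfl).const_mul b)).ofReal

/-- At `y = 0` this is the global relation between the transforms of `q` and `q_y` on the bottom
edge and the Laplace transforms of `q` and `q_x` on the left edge. -/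
theorem mul_transform_sub (hq : IsDecayingSolution u q qx qy w)
    (hχ : IsBoundedSolution u lam χ χ') {c : ℂ} (hc : c ^ 2 = lam) (hre : c.re ≤ 0) {y : ℝ}
    (hy : 0 ≤ y) :
    c * (∫ x in Ioi 0, χ x * q x y : ℝ) - (∫ x in Ioi 0, χ x * qy x y : ℝ)
      = ∫ η in Ioi y, Complex.exp (c * (η - y : ℝ)) * ((χ 0 * qx 0 η - χ' 0 * q 0 η : ℝ) : ℂ) := by
  obtain ⟨A, hA⟩ := hχ.bounded
  refine mul_sub_eq_integral_tail (P := fun y => ((∫ x in Ioi 0, χ x * q x y : ℝ) : ℂ))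
    (P₁ := fun y => ((∫ x in Ioi 0, χ x * qy x y : ℝ) : ℂ))
    (r := fun η => ((χ 0 * qx 0 η - χ' 0 * q 0 η : ℝ) : ℂ)) ?_ ?_ ?_ ?_ ?_ ?_
    (hq.integrableOn_source _ _) hre hy
  · exact Complex.continuous_ofReal.comp_continuousOn
      (hq.dom.continuousOn_integral_mul hχ.continuousOn hA)
  · exact Complex.continuous_ofReal.comp_continuousOn
      (hq.dom_y.continuousOn_integral_mul hχ.continuousOn hA)
  · exact fun y hy => (hq.hasDerivAt_integral_mul hχ hy).ofReal_comp
  · exact fun y hy => (hq.hasDerivAt_integral_mul_deriv hχ hy).ofReal_comp.congr_deriv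
      (by rw [hc]; push_cast; ring)
  · exact_mod_cast (Complex.continuous_ofReal.tendsto 0).comp
      (hq.dom.tendsto_integral_mul hχ.continuousOn hA)
  · exact_mod_cast (Complex.continuous_ofReal.tendsto 0).comp
      (hq.dom_y.tendsto_integral_mul hχ.continuousOn hA)

theorem transform_sub_mul (hq : IsDecayingSolution u q qx qy w)
    (hχ : IsBoundedSolution u lam χ χ') {c : ℂ} (hc : c ^ 2 = lam) {y : ℝ} (hy : 0 ≤ y) :
    (∫ x in Ioi 0, χ x * qy x y : ℝ) - c * (∫ x in Ioi 0, χ x * q x y : ℝ)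
      = Complex.exp (-(c * y))
          * ((∫ x in Ioi 0, χ x * qy x 0 : ℝ) - c * (∫ x in Ioi 0, χ x * q x 0 : ℝ))
        + ∫ η in (0 : ℝ)..y,
          Complex.exp (c * (η - y : ℝ)) * ((χ 0 * qx 0 η - χ' 0 * q 0 η : ℝ) : ℂ) := by
  obtain ⟨A, hA⟩ := hχ.bounded
  refine sub_mul_eq_integral_head (P := fun y => ((∫ x in Ioi 0, χ x * q x y : ℝ) : ℂ))
    (P₁ := fun y => ((∫ x in Ioi 0, χ x * qy x y : ℝ) : ℂ))
    (r := fun η => ((χ 0 * qx 0 η - χ' 0 * q 0 η : ℝ) : ℂ)) ?_ ?_ ?_ ?_ ?_ hy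
  · exact Complex.continuous_ofReal.comp_continuousOn
      (hq.dom.continuousOn_integral_mul hχ.continuousOn hA)
  · exact Complex.continuous_ofReal.comp_continuousOn
      (hq.dom_y.continuousOn_integral_mul hχ.continuousOn hA)
  · exact fun y hy => (hq.hasDerivAt_integral_mul hχ hy).ofReal_comp
  · exact fun y hy => (hq.hasDerivAt_integral_mul_deriv hχ hy).ofReal_comp.congr_deriv
      (by rw [hc]; push_cast; ring)
  · exact Complex.continuous_ofReal.comp_continuousOn
      ((continuousOn_const.mul (hq.dom_x.continuousOn_right le_rfl)).sub
        (continuousOn_const.mul (hq.dom.continuousOn_right le_rfl)))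

theorem integral_mul_bottom (hq : IsDecayingSolution u q qx qy w)
    (hf : ∀ x, 0 < x → qy x 0 + γ₁ * q x 0 = f x) (hχ : IsBoundedSolution u lam χ χ') :
    ∫ x in Ioi 0, χ x * qy x 0 = (∫ x in Ioi 0, f x * χ x) - γ₁ * ∫ x in Ioi 0, χ x * q x 0 := by
  obtain ⟨A, hA⟩ := hχ.bounded
  have h1 := hq.dom_y.integrableOn_mul hχ.continuousOn hA le_rfl
  have h2 := (hq.dom.integrableOn_mul hχ.continuousOn hA le_rfl).const_mul γ₁
  have : ∫ x in Ioi 0, f x * χ x = ∫ x in Ioi 0, (χ x * qy x 0 + γ₁ * (χ x * q x 0)) :=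
    setIntegral_congr_fun measurableSet_Ioi fun x hx => by
      simp only [← hf x hx]; ring
  rw [this, integral_add h1 h2, integral_const_mul]
  ring

end IsDecayingSolution

/-- `∫_0^∞ e^{-k|η-y|} h(η) dη`. -/
noncomputable def expConv (h : ℝ → ℝ) (y : ℝ) (k : ℂ) : ℂ :=
  ∫ η in Ioi (0 : ℝ), Complex.exp (-(k * |η - y|)) * h η

theorem norm_exp_neg_mul_abs_le_one {k : ℂ} (hk : 0 ≤ k.re) (t : ℝ) :
    ‖Complex.exp (-(k * |t|))‖ ≤ 1 := by
  rw [Complex.norm_exp, Complex.neg_re, Complex.re_mul_ofReal]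
  exact Real.exp_le_one_iff.2 (by have := mul_nonneg hk (abs_nonneg t); linarith)

theorem expConv_eq_add {h : ℝ → ℝ} (hh : IntegrableOn h (Ioi 0)) {y : ℝ} (hy : 0 ≤ y) {k : ℂ}
    (hk : 0 ≤ k.re) :
    expConv h y k = (∫ η in (0 : ℝ)..y, Complex.exp (k * (η - y : ℝ)) * h η)
      + ∫ η in Ioi y, Complex.exp (-k * (η - y : ℝ)) * h η := by
  have hint : IntegrableOn (fun η => Complex.exp (-(k * |η - y|)) * h η) (Ioi 0) :=
    integrableOn_continuous_mul measurableSet_Ioi hh (by fun_prop) (C := 1)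
      fun η _ => norm_exp_neg_mul_abs_le_one hk _
  rw [expConv, ← Ioc_union_Ioi_eq_Ioi hy, setIntegral_union (Ioc_disjoint_Ioi le_rfl)
    measurableSet_Ioi (hint.mono_set Ioc_subset_Ioi_self) (hint.mono_set (Ioi_subset_Ioi hy)),
    intervalIntegral.integral_of_le hy]
  congr 1
  · refine setIntegral_congr_fun measurableSet_Ioc fun η hη => ?_
    rw [abs_of_nonpos (by linarith [hη.2])]
    push_cast
    ring_nf
  · refine setIntegral_congr_fun measurableSet_Ioi fun η hη => ?_
    rw [abs_of_nonneg (by linarith [mem_Ioi.1 hη])]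
    push_cast
    ring_nf

namespace IsDecayingSolution

variable {u w f g : ℝ → ℝ} {q qx qy : ℝ → ℝ → ℝ} {γ₁ γ₂ : ℝ}

theorem _root_.IsPotential.isBoundedSolution_sineFn (hu : IsPotential u) (t : ℝ) :
    IsBoundedSolution u (t ^ 2) (fun x => sineFn u x t) (fun x => (hu.sineDeriv x t).re) := by
  obtain ⟨B, hB⟩ := hu.exists_norm_sineDeriv_le t
  exact (hu.isEigenfunction_sineFn t).isBoundedSolution (by push_cast; rfl) (fun x _ => by simp)
    (fun x hx => by simpa using hu.abs_sineFn_le t hx) hB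

/-- Subtracting the two first order solutions, with `-t` integrated from infinity and `t` from the
origin, isolates `2tP`. The initial quantity `P'(0) - tP(0)` is then found from the bottom condition
and the global relation. -/
theorem two_mul_sine_transform (hq : IsDecayingSolution u q qx qy w) (hu : IsPotential u)
    (hf : ∀ x, 0 < x → qy x 0 + γ₁ * q x 0 = f x) (hγ₁ : γ₁ < 0) {t : ℝ} (ht : 0 < t) {y : ℝ}
    (hy : 0 ≤ y) :
    2 * (∫ x in Ioi 0, sineFn u x t * q x y : ℝ)
      = expConv (q 0) y t - Complex.exp (-(t * y)) * (2 * (∫ x in Ioi 0, f x * sineFn u x t : ℝ)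
        / (t - γ₁) - g0 q (-t) * ((t + γ₁) / (t - γ₁))) := by
  have hχ := hu.isBoundedSolution_sineFn t
  have hne : (t : ℂ) - γ₁ ≠ 0 := by exact_mod_cast (by linarith : t - γ₁ ≠ 0)
  have ht0 : (t : ℂ) ≠ 0 := by exact_mod_cast ht.ne'
  have hre : (-(t : ℂ)).re ≤ 0 := by simpa using ht.le
  -- `sineFn` vanishes at the origin with derivative `t`, so the unknown `q_x(0, ·)` drops out of
  -- the source.
  have hsrc : ∀ η, ((sineFn u 0 t * qx 0 η - (hu.sineDeriv 0 t).re * q 0 η : ℝ) : ℂ)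
      = -t * q 0 η := fun η => by simp [IsPotential.sineFn_zero, hu.sineDeriv_zero]
  have h1 := hq.mul_transform_sub hχ (c := -t) (by push_cast; ring) hre hy
  have h2 := hq.transform_sub_mul hχ (c := t) (by push_cast; ring) hy
  have h3 := hq.mul_transform_sub hχ (c := -t) (by push_cast; ring) hre le_rfl
  have h4 := congrArg (fun r : ℝ => (r : ℂ)) (hq.integral_mul_bottom hf hχ)
  simp only [hsrc, mul_left_comm _ (-(t : ℂ))] at h1 h2 h3
  rw [integral_const_mul] at h1 h3
  rw [intervalIntegral.integral_const_mul] at h2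
  simp only [sub_zero] at h3
  push_cast at h4
  have h5 := expConv_eq_add (hq.dom.integrableOn_right (x := 0) le_rfl) hy (k := t)
    (by simpa using ht.le)
  have h6 : g0 q (-t) = ∫ η in Ioi (0 : ℝ), Complex.exp (-t * η) * q 0 η := rfl
  rw [← h6] at h3
  rw [h5]
  set P := (∫ x in Ioi 0, sineFn u x t * q x y : ℝ)
  set P₁ := (∫ x in Ioi 0, sineFn u x t * qy x y : ℝ)
  set P0 := (∫ x in Ioi 0, sineFn u x t * q x 0 : ℝ)
  set P₁0 := (∫ x in Ioi 0, sineFn u x t * qy x 0 : ℝ)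
  set fs := (∫ x in Ioi 0, f x * sineFn u x t : ℝ)
  set T := ∫ η in Ioi y, Complex.exp (-t * (η - y : ℝ)) * q 0 η
  set S := ∫ η in (0 : ℝ)..y, Complex.exp (t * (η - y : ℝ)) * q 0 η
  set e := Complex.exp (-(t * y))
  set G := g0 q (-t)
  -- Two linear equations, `P₁0 + γ₁ P0 = fs` and `P₁0 + t P0 = t G`, determine both initial values
  -- because `t ≠ γ₁`.
  have h7 : (P₁0 : ℂ) - t * P0 = t * (2 * fs / (t - γ₁) - G * ((t + γ₁) / (t - γ₁))) := by
    field_simp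
    linear_combination (2 * t : ℂ) * h4 + (t + γ₁ : ℂ) * h3
  have h8 : (t : ℂ) * (2 * P)
      = t * (S + T - e * (2 * fs / (t - γ₁) - G * ((t + γ₁) / (t - γ₁)))) := by
    linear_combination -h1 - h2 - e * h7
  exact mul_left_cancel₀ ht0 h8

/-- The global relation for the real solution `ψ(·, it)`. The left condition replaces `q_x(0,y)` by
`g - γ₂ q` and produces `D`; the bottom condition replaces `q_y(x,0)`. The hypotheses leave `c = it`
and `c = -it`, both allowed since `Re c = 0`, and the unknown integral of `ψ q(x,0)` appears with
the factor `c + γ₁`. -/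
theorem specD_mul_g0 (hq : IsDecayingSolution u q qx qy w) (hu : IsPotential u)
    (hf : ∀ x, 0 < x → qy x 0 + γ₁ * q x 0 = f x)
    (hg : ∀ y, 0 < y → qx 0 y + γ₂ * q 0 y = g y) {t : ℝ} (ht : 0 < t) {c : ℂ}
    (hc : c ^ 2 = -(t ^ 2)) (hre : c.re ≤ 0) :
    specD u 0 γ₂ (t * Complex.I) * g0 q c
      = (∫ x in Ioi (0 : ℝ), (f x : ℂ) * psi u x (t * Complex.I))
        + psi u 0 (t * Complex.I) * (∫ y in Ioi (0 : ℝ), Complex.exp (c * y) * (g y : ℂ))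
        - (c + γ₁) * (∫ x in Ioi 0, (psi u x (t * Complex.I)).re * q x 0 : ℝ) := by
  set k : ℂ := t * Complex.I with hk
  have hkim : 0 ≤ k.im := by simpa [hk] using ht.le
  obtain ⟨C, hC0, hC⟩ := hu.exists_norm_jostDeriv_le
  have hexp : ∀ x, 0 ≤ x → Real.exp (-(k.im * x)) ≤ 1 := fun x hx =>
    Real.exp_le_one_iff.2 (by have := mul_nonneg hkim hx; linarith)
  have hχ : IsBoundedSolution u (-(t ^ 2)) (fun x => (psi u x k).re)
      (fun x => (hu.psiDeriv x k).re) := by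
    refine (hu.isEigenfunction_psi hkim).isBoundedSolution (A := ‖hu.jost‖)
      (B := ‖k‖ * ‖hu.jost‖ + C) ?_ (fun x hx => hu.ofReal_re_psi ht.le hx)
      (fun x hx => ?_) (fun x hx => ?_)
    · rw [hk, mul_pow, Complex.I_sq]; push_cast; ring
    · exact (hu.norm_psi_le hkim hx).trans (mul_le_of_le_one_right (norm_nonneg _) (hexp x hx))
    · exact (hu.norm_psiDeriv_le hC hkim hx).trans
        (mul_le_of_le_one_right (by positivity) (hexp x hx))
  have hψ := hu.ofReal_re_psi (κ := t) ht.le (x := 0) le_rfl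
  have hψ' := hu.ofReal_re_psiDeriv (κ := t) ht.le (x := 0) le_rfl
  rw [← hk] at hψ hψ'
  have h3 := hq.mul_transform_sub hχ (c := c) (by push_cast; exact hc) hre le_rfl
  have h4 := congrArg (fun r : ℝ => (r : ℂ)) (hq.integral_mul_bottom hf hχ)
  have hgi : IntegrableOn (fun y => (g y : ℂ)) (Ioi 0) := by
    refine IntegrableOn.congr_fun (hq.integrableOn_source 1 (-γ₂)) (fun y hy => ?_)
      measurableSet_Ioi
    rw [← hg y hy]; push_cast; ring
  have hqi : IntegrableOn (fun y => (q 0 y : ℂ)) (Ioi 0) :=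
    (hq.dom.integrableOn_right (x := 0) le_rfl).ofReal
  have hs : ∫ η in Ioi (0 : ℝ), Complex.exp (c * (η - 0 : ℝ))
        * (((psi u 0 k).re * qx 0 η - (hu.psiDeriv 0 k).re * q 0 η : ℝ) : ℂ)
      = psi u 0 k * (∫ y in Ioi (0 : ℝ), Complex.exp (c * y) * (g y : ℂ))
        - specD u 0 γ₂ k * g0 q c := by
    have i1 := (integrableOn_exp_mul_sub hgi hre le_rfl).const_mul (psi u 0 k)
    have i2 := (integrableOn_exp_mul_sub hqi hre le_rfl).const_mul (specD u 0 γ₂ k)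
    simp only [sub_zero] at i1 i2
    rw [g0, ← integral_const_mul, ← integral_const_mul, ← integral_sub i1 i2]
    refine setIntegral_congr_fun measurableSet_Ioi fun η hη => ?_
    simp only [← hg η hη, specD, hu.psiX0_eq_psiDeriv hkim]
    push_cast
    rw [hψ, hψ']
    simp only [sub_zero]
    ring
  have hfψ : ((∫ x in Ioi 0, f x * (psi u x k).re : ℝ) : ℂ)
      = ∫ x in Ioi (0 : ℝ), (f x : ℂ) * psi u x k := by
    rw [← integral_complex_ofReal]
    refine setIntegral_congr_fun measurableSet_Ioi fun x hx => ?_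
    have := hu.ofReal_re_psi (κ := t) ht.le (le_of_lt hx)
    rw [Complex.ofReal_mul, ← hk] at *
    rw [this]
  rw [hs] at h3
  push_cast at h4
  rw [hfψ] at h4
  linear_combination h3 + h4

/-- With `k = it`, multiply the relation for `c = k` by `k - γ₁` and the one for `c = -k` by `k +
γ₁`: the unknown terms cancel in the sum. Since `-conj k = k` and `ψ` is real here, `conj H(-conj
k)` is `H(k)` with `e^{ky}` replaced by `e^{-ky}`. -/
theorem specF_eq (hq : IsDecayingSolution u q qx qy w) (hu : IsPotential u)
    (hf : ∀ x, 0 < x → qy x 0 + γ₁ * q x 0 = f x)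
    (hg : ∀ y, 0 < y → qx 0 y + γ₂ * q 0 y = g y) (hγ₁ : γ₁ < 0) {t : ℝ} (ht : 0 < t)
    (hD : specD u 0 γ₂ (t * Complex.I) ≠ 0) :
    specF u f g 0 γ₁ γ₂ (t * Complex.I) = g0 q (t * Complex.I)
      + g0 q (-(t * Complex.I)) * ((t * Complex.I + γ₁) / (t * Complex.I - γ₁)) := by
  have hkim : 0 ≤ (t * Complex.I : ℂ).im := by simpa using ht.le
  have h1 := hq.specD_mul_g0 hu hf hg ht (c := t * Complex.I)
    (by rw [mul_pow, Complex.I_sq]; ring) (by simp)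
  have h2 := hq.specD_mul_g0 hu hf hg ht (c := -(t * Complex.I))
    (by rw [neg_sq, mul_pow, Complex.I_sq]; ring) (by simp)
  have hne : (t * Complex.I : ℂ) - γ₁ ≠ 0 := fun h => by
    have := congrArg Complex.re h
    simp at this
    linarith
  have hconj : conj (specH u f g (-conj (t * Complex.I)))
      = (∫ x in Ioi (0 : ℝ), (f x : ℂ) * psi u x (t * Complex.I))
        + psi u 0 (t * Complex.I)
          * ∫ y in Ioi (0 : ℝ), Complex.exp (-(t * Complex.I) * y) * (g y : ℂ) := by
    have h0 : -conj (t * Complex.I : ℂ) = t * Complex.I := by simp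
    rw [h0, specH, map_add, map_mul, ← integral_conj, ← integral_conj,
      hu.conj_psi_imaginary ht.le le_rfl]
    congr 1
    · refine setIntegral_congr_fun measurableSet_Ioi fun x hx => ?_
      rw [map_mul, Complex.conj_ofReal, hu.conj_psi_imaginary ht.le (le_of_lt hx)]
    · congr 2
      funext y
      rw [map_mul, Complex.conj_ofReal, ← Complex.exp_conj]
      simp
  rw [specF, hconj, div_eq_iff (mul_ne_zero hne hD), specH]
  generalize (∫ y in Ioi (0 : ℝ), Complex.exp (-(t * Complex.I) * y) * (g y : ℂ)) = G at h2 ⊢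
  field_simp
  linear_combination -(t * Complex.I - γ₁ : ℂ) * h1 - (t * Complex.I + γ₁ : ℂ) * h2

end IsDecayingSolution

/-! ### Laplace transforms of boundary values -/

namespace IsAdmissible

variable {h h' : ℝ → ℝ}

theorem hasDerivAt_exp_mul (hh : IsAdmissible h h') (c : ℂ) (y : ℝ) {η : ℝ} (hη : 0 < η) :
    HasDerivAt (fun η : ℝ => Complex.exp (c * (η - y : ℝ)) * h η)
      (c * (Complex.exp (c * (η - y : ℝ)) * h η) + Complex.exp (c * (η - y : ℝ)) * h' η) η := by
  have h1 : HasDerivAt (fun η : ℝ => Complex.exp (c * (η - y : ℝ)))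
      (c * Complex.exp (c * (η - y : ℝ))) η := by
    simpa using (hasDerivAt_cexp_mul c (η - y)).comp_sub_const η y
  exact (h1.mul (hh.hasDerivAt η hη).ofReal_comp).congr_deriv (by ring)

theorem continuousOn_exp_mul (hh : IsAdmissible h h') (c : ℂ) (y : ℝ) :
    ContinuousOn (fun η : ℝ => Complex.exp (c * (η - y : ℝ)) * h η) (Ici 0) :=
  ContinuousOn.mul (by fun_prop) (Complex.continuous_ofReal.comp_continuousOn hh.cont)

theorem continuousOn_exp_mul_deriv (hh : IsAdmissible h h') (c : ℂ) (y : ℝ) :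
    ContinuousOn (fun η : ℝ => Complex.exp (c * (η - y : ℝ)) * h' η) (Ici 0) :=
  ContinuousOn.mul (by fun_prop) (Complex.continuous_ofReal.comp_continuousOn hh.cont_deriv)

theorem mul_integral_tail (hh : IsAdmissible h h') {c : ℂ} (hc : c.re ≤ 0) {y : ℝ} (hy : 0 ≤ y) :
    c * (∫ η in Ioi y, Complex.exp (c * (η - y : ℝ)) * h η)
      = -h y - ∫ η in Ioi y, Complex.exp (c * (η - y : ℝ)) * h' η := by
  have i1 : Integrable (fun η : ℝ => c * (Complex.exp (c * (η - y : ℝ)) * (h η : ℂ)))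
      (volume.restrict (Ioi y)) := (integrableOn_exp_mul_sub hh.int.ofReal hc hy).const_mul c
  have i2 : Integrable (fun η : ℝ => Complex.exp (c * (η - y : ℝ)) * (h' η : ℂ))
      (volume.restrict (Ioi y)) := integrableOn_exp_mul_sub hh.int_deriv.ofReal hc hy
  have ht : Tendsto (fun η : ℝ => Complex.exp (c * (η - y : ℝ)) * h η) atTop (𝓝 0) := by
    have h1 : Tendsto (fun η => ‖h η‖) atTop (𝓝 0) := by simpa using hh.tendsto.norm
    refine squeeze_zero_norm' ((eventually_ge_atTop y).mono fun η hη => ?_) h1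
    rw [norm_mul, Complex.norm_real]
    exact mul_le_of_le_one_left (norm_nonneg _) (norm_exp_mul_sub_le_one hc hη)
  have := integral_Ioi_of_hasDerivAt_of_tendsto
    (((hh.continuousOn_exp_mul c y).mono (Ici_subset_Ici.2 hy)) y self_mem_Ici)
    (fun η hη => hh.hasDerivAt_exp_mul c y (hy.trans_lt hη)) (i1.add i2) ht
  rw [integral_add i1 i2, integral_const_mul] at this
  simp only [sub_self, Complex.ofReal_zero, mul_zero, Complex.exp_zero, one_mul] at this
  linear_combination this

theorem mul_integral_head (hh : IsAdmissible h h') (c : ℂ) {y : ℝ} (hy : 0 ≤ y) :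
    c * (∫ η in (0 : ℝ)..y, Complex.exp (c * (η - y : ℝ)) * h η)
      = h y - Complex.exp (-(c * y)) * h 0
        - ∫ η in (0 : ℝ)..y, Complex.exp (c * (η - y : ℝ)) * h' η := by
  have hsub : Icc 0 y ⊆ Ici 0 := fun t ht => ht.1
  have i1 : IntervalIntegrable (fun η : ℝ => Complex.exp (c * (η - y : ℝ)) * h η) volume 0 y :=
    ((hh.continuousOn_exp_mul c y).mono (by rwa [uIcc_of_le hy])).intervalIntegrable
  have i2 : IntervalIntegrable (fun η : ℝ => Complex.exp (c * (η - y : ℝ)) * h' η) volume 0 y :=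
    ((hh.continuousOn_exp_mul_deriv c y).mono (by rwa [uIcc_of_le hy])).intervalIntegrable
  have := intervalIntegral.integral_eq_sub_of_hasDerivAt_of_le hy
    ((hh.continuousOn_exp_mul c y).mono hsub) (fun η hη => hh.hasDerivAt_exp_mul c y hη.1)
    ((i1.const_mul c).add i2)
  rw [intervalIntegral.integral_add (i1.const_mul c) i2,
    intervalIntegral.integral_const_mul] at this
  simp only [sub_self, Complex.ofReal_zero, mul_zero, Complex.exp_zero, one_mul, zero_sub,
    Complex.ofReal_neg, mul_neg] at this
  linear_combination this

/-- Integration by parts on each side of the kink `η = y`. The resulting bound for `k expConv`,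
uniform in the closed right half plane, is what the Jordan lemma on squares requires. -/
theorem exists_norm_mul_expConv_le (hh : IsAdmissible h h') {y : ℝ} (hy : 0 ≤ y) :
    ∃ C, ∀ k : ℂ, 0 ≤ k.re → ‖k‖ * ‖expConv h y k‖ ≤ C := by
  refine ⟨2 * |h y| + |h 0| + (∫ η in Ioc 0 y, |h' η|) + ∫ η in Ioi y, |h' η|, fun k hk => ?_⟩
  have hk' : (-k).re ≤ 0 := by simpa using hk
  have h1 := hh.mul_integral_tail hk' hy
  have h2 := hh.mul_integral_head k hy
  have heq : k * expConv h y k = (h y - Complex.exp (-(k * y)) * h 0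
        - ∫ η in (0 : ℝ)..y, Complex.exp (k * (η - y : ℝ)) * h' η)
      + (h y + ∫ η in Ioi y, Complex.exp (-k * (η - y : ℝ)) * h' η) := by
    rw [expConv_eq_add hh.int hy hk]
    linear_combination h2 - h1
  have b1 : ‖Complex.exp (-(k * y)) * h 0‖ ≤ |h 0| := by
    rw [norm_mul, Complex.norm_real, Real.norm_eq_abs]
    refine mul_le_of_le_one_left (abs_nonneg _) ?_
    have := norm_exp_neg_mul_abs_le_one hk y
    rwa [abs_of_nonneg hy] at this
  have b2 : ‖∫ η in (0 : ℝ)..y, Complex.exp (k * (η - y : ℝ)) * h' η‖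
      ≤ ∫ η in Ioc 0 y, |h' η| := by
    rw [intervalIntegral.integral_of_le hy]
    refine norm_integral_le_of_norm_le (hh.int_deriv.mono_set Ioc_subset_Ioi_self).norm ?_
    filter_upwards [ae_restrict_mem measurableSet_Ioc] with η hη
    rw [norm_mul, Complex.norm_real, Complex.norm_exp, Complex.re_mul_ofReal]
    exact mul_le_of_le_one_left (norm_nonneg _) (Real.exp_le_one_iff.2
      (mul_nonpos_of_nonneg_of_nonpos hk (by linarith [hη.2])))
  have b3 : ‖∫ η in Ioi y, Complex.exp (-k * (η - y : ℝ)) * h' η‖ ≤ ∫ η in Ioi y, |h' η| := by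
    refine norm_integral_le_of_norm_le (hh.int_deriv.mono_set (Ioi_subset_Ioi hy)).norm ?_
    filter_upwards [ae_restrict_mem measurableSet_Ioi] with η hη
    rw [norm_mul, Complex.norm_real]
    exact mul_le_of_le_one_left (norm_nonneg _) (norm_exp_mul_sub_le_one hk' (le_of_lt hη))
  have b4 : ‖(h y : ℂ)‖ = |h y| := Complex.norm_real _
  rw [← norm_mul, heq]
  have t1 := norm_add_le (h y - Complex.exp (-(k * y)) * h 0
        - ∫ η in (0 : ℝ)..y, Complex.exp (k * (η - y : ℝ)) * h' η)
      (h y + ∫ η in Ioi y, Complex.exp (-k * (η - y : ℝ)) * h' η)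
  have t2 := norm_sub_le (h y - Complex.exp (-(k * y)) * h 0)
    (∫ η in (0 : ℝ)..y, Complex.exp (k * (η - y : ℝ)) * h' η)
  have t3 := norm_sub_le (h y : ℂ) (Complex.exp (-(k * y)) * h 0)
  have t4 := norm_add_le (h y : ℂ) (∫ η in Ioi y, Complex.exp (-k * (η - y : ℝ)) * h' η)
  linarith

end IsAdmissible

section expConv

variable {h : ℝ → ℝ}

theorem norm_exp_mul_le_abs (h : ℝ → ℝ) (y : ℝ) {k : ℂ} (hk : 0 ≤ k.re) (η : ℝ) :
    ‖Complex.exp (-(k * |η - y|)) * h η‖ ≤ ‖h η‖ := by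
  rw [norm_mul, Complex.norm_real]
  exact mul_le_of_le_one_left (norm_nonneg _) (norm_exp_neg_mul_abs_le_one hk _)

theorem aestronglyMeasurable_exp_mul_abs (hh : IntegrableOn h (Ioi 0)) (y : ℝ) (k : ℂ) :
    AEStronglyMeasurable (fun η => Complex.exp (-(k * |η - y|)) * h η)
      (volume.restrict (Ioi 0)) :=
  (by fun_prop : Continuous fun η : ℝ => Complex.exp (-(k * |η - y|))).aestronglyMeasurable.mul
    hh.ofReal.aestronglyMeasurable

theorem norm_expConv_le (hh : IntegrableOn h (Ioi 0)) (y : ℝ) {k : ℂ} (hk : 0 ≤ k.re) :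
    ‖expConv h y k‖ ≤ ∫ η in Ioi (0 : ℝ), ‖h η‖ :=
  norm_integral_le_of_norm_le hh.norm (Eventually.of_forall (norm_exp_mul_le_abs h y hk))

theorem continuousOn_expConv (hh : IntegrableOn h (Ioi 0)) (y : ℝ) :
    ContinuousOn (expConv h y) {k | 0 ≤ k.re} :=
  continuousOn_of_dominated (fun k _ => aestronglyMeasurable_exp_mul_abs hh y k)
    (fun _ hk => Eventually.of_forall (norm_exp_mul_le_abs h y hk)) hh.norm
    (Eventually.of_forall fun _ => by fun_prop)

theorem differentiableOn_expConv (hh : IntegrableOn h (Ioi 0)) (y : ℝ) :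
    DifferentiableOn ℂ (expConv h y) {k | 0 < k.re} :=
  differentiableOn_integral_of_dominated (isOpen_lt continuous_const Complex.continuous_re)
    (fun k _ => aestronglyMeasurable_exp_mul_abs hh y k)
    (Eventually.of_forall fun η _ hk => norm_exp_mul_le_abs h y (le_of_lt hk) η) hh.norm
    (Eventually.of_forall fun _ => by fun_prop)

theorem g0_neg_eq_expConv (q : ℝ → ℝ → ℝ) (k : ℂ) : g0 q (-k) = expConv (q 0) 0 k :=
  setIntegral_congr_fun measurableSet_Ioi fun η hη => by
    simp only [sub_zero]
    rw [abs_of_pos (mem_Ioi.1 hη), neg_mul]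

/-- On the imaginary axis the kernel `e^{-k|η-y|}` and `e^{k(η-y)}` have the same real part. -/
theorem re_expConv_imaginary (hh : IntegrableOn h (Ioi 0)) (y t : ℝ) :
    (expConv h y (t * Complex.I)).re
      = (Complex.exp (-(t * Complex.I * y))
        * ∫ η in Ioi (0 : ℝ), Complex.exp (t * Complex.I * η) * h η).re := by
  have i1 : IntegrableOn (fun η : ℝ => Complex.exp (-(t * Complex.I * |η - y|)) * h η) (Ioi 0) :=
    Integrable.mono' hh.norm (aestronglyMeasurable_exp_mul_abs hh y _)
      (Eventually.of_forall (norm_exp_mul_le_abs h y (by simp)))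
  have i2 : IntegrableOn (fun η : ℝ => Complex.exp (-(t * Complex.I * y))
      * (Complex.exp (t * Complex.I * η) * h η)) (Ioi 0) := by
    refine Integrable.const_mul (integrableOn_continuous_mul measurableSet_Ioi hh
      (by fun_prop) (C := 1) fun η _ => ?_) _
    rw [Complex.norm_exp]; simp
  rw [← integral_const_mul, expConv]
  rw [← RCLike.re_eq_complex_re, ← integral_re i1, ← integral_re i2]
  congr 1
  funext η
  rw [← mul_assoc, ← Complex.exp_add]
  rw [RCLike.re_eq_complex_re, Complex.re_mul_ofReal, Complex.re_mul_ofReal,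
    Complex.exp_re, Complex.exp_re]
  congr 1
  simp only [Complex.neg_re, Complex.neg_im, Complex.add_re, Complex.add_im, Complex.mul_re,
    Complex.mul_im, Complex.ofReal_re, Complex.ofReal_im, Complex.I_re, Complex.I_im]
  simp only [mul_zero, zero_mul, mul_one, sub_zero, add_zero, neg_zero, zero_add]
  congr 1
  -- Both sides are cosines, of `t |η - y|` and `t (η - y)`, equal by evenness.
  rw [Real.cos_neg]
  rcases abs_cases (η - y) with ⟨ha, _⟩ | ⟨ha, _⟩ <;> rw [ha]
  · ring_nf
  · rw [← Real.cos_neg]; ring_nf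

end expConv

/-! ### The spectral functions on the real and imaginary axes. -/

namespace IsPotential

variable {u : ℝ → ℝ}

theorem differentiableOn_psi (hu : IsPotential u) {x : ℝ} (hx : 0 ≤ x) :
    DifferentiableOn ℂ (fun k => psi u x k) {k | 0 < k.im} :=
  (DifferentiableOn.mul (by fun_prop) (hu.differentiableOn_jost x)).congr fun _ hk =>
    hu.psi_eq (le_of_lt hk) hx

theorem differentiableOn_specD (hu : IsPotential u) (γ : ℝ) :
    DifferentiableOn ℂ (specD u 0 γ) {k | 0 < k.im} := by
  have h1 : DifferentiableOn ℂ (fun k => Complex.I * k * hu.jost (0, k) + hu.jostDeriv 0 k)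
      {k | 0 < k.im} :=
    (DifferentiableOn.mul (by fun_prop) (hu.differentiableOn_jost 0)).add
      hu.differentiableOn_jostDeriv_zero
  refine ((h1.congr fun k hk => hu.psiX0_eq (le_of_lt hk)).add
    ((hu.differentiableOn_psi le_rfl).const_mul (γ : ℂ))).congr fun k _ => ?_
  simp [specD]

/-- `D(k) - ik` is bounded in the closed upper half-plane. -/
theorem exists_norm_specD_sub_le (hu : IsPotential u) (γ : ℝ) :
    ∃ M, ∀ k : ℂ, 0 ≤ k.im → ‖specD u 0 γ k - Complex.I * k‖ ≤ M := by
  obtain ⟨C, hC0, hC⟩ := hu.exists_norm_jostDeriv_le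
  refine ⟨(∫ ξ in Ioi (0 : ℝ), weight u ξ) * ‖hu.jost‖ + C + |γ| * ‖hu.jost‖, fun k hk => ?_⟩
  have h : specD u 0 γ k - Complex.I * k = Complex.I * k * (hu.jost (0, k) - 1)
      + hu.jostDeriv 0 k + γ * hu.jost (0, k) := by
    rw [specD, hu.psiX0_eq hk, hu.psi_zero_eq hk]
    push_cast; ring
  rw [h]
  refine (norm_add₃_le).trans (add_le_add (add_le_add ?_ (hC 0 k le_rfl hk)) ?_)
  · rw [norm_mul, norm_mul, Complex.norm_I, one_mul]
    exact hu.norm_mul_norm_jost_sub_one_le hk le_rfl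
  · rw [norm_mul, Complex.norm_real, Real.norm_eq_abs]
    exact mul_le_mul_of_nonneg_left (hu.jost.norm_coe_le_norm _) (abs_nonneg _)

/-- `D` is holomorphic in the upper half plane and not identically zero, because `D(k) = ik + O(1)`.
Its zeros are isolated, so they meet the imaginary axis in a null set. -/
theorem ae_specD_ne_zero (hu : IsPotential u) (γ : ℝ) :
    ∀ᵐ t : ℝ ∂volume.restrict (Ioi 0), specD u 0 γ (t * Complex.I) ≠ 0 := by
  have hopen : IsOpen {k : ℂ | 0 < k.im} := isOpen_lt continuous_const Complex.continuous_im
  have han : AnalyticOnNhd ℂ (specD u 0 γ) {k | 0 < k.im} :=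
    (hu.differentiableOn_specD γ).analyticOnNhd hopen
  have hpre : IsPreconnected {k : ℂ | 0 < k.im} :=
    (convex_halfSpace_im_gt 0).isPreconnected
  obtain ⟨M, hM⟩ := hu.exists_norm_specD_sub_le γ
  have hM0 : 0 ≤ M := (norm_nonneg _).trans (hM 0 le_rfl)
  rw [ae_restrict_iff' measurableSet_Ioi]
  refine measure_null_of_locally_null _ fun t ht => ?_
  simp only [mem_compl_iff, mem_ofPred_eq, Classical.not_imp, not_not, mem_Ioi] at ht
  -- Near a zero `t` the exceptional set reduces to `{t}`, and a locally null set is null.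
  refine ⟨{t}, ?_, measure_singleton t⟩
  have hmem : (t * Complex.I : ℂ) ∈ {k : ℂ | 0 < k.im} := by simpa using ht.1
  rcases (han _ hmem).eventually_eq_zero_or_eventually_ne_zero with h0 | h0
  · exfalso
    have hz := han.eqOn_zero_of_preconnected_of_eventuallyEq_zero hpre hmem h0
    -- At this point `ik` has modulus `M + 1`, more than the bound `M` for `D(k) - ik`, so `D`
    -- cannot vanish.
    have hk : ((M + 1 : ℝ) * Complex.I : ℂ) ∈ {k : ℂ | 0 < k.im} := by
      simp only [mem_ofPred_eq, Complex.im_ofReal_mul, Complex.I_im]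
      linarith
    have h1 := hM _ (le_of_lt hk)
    rw [hz hk] at h1
    simp only [Pi.zero_apply, zero_sub, norm_neg, norm_mul, Complex.norm_I, one_mul, mul_one,
      Complex.norm_real, Real.norm_eq_abs] at h1
    linarith [le_abs_self (M + 1)]
  · have hc : Tendsto (fun s : ℝ => (s * Complex.I : ℂ)) (𝓝[≠] t) (𝓝[≠] (t * Complex.I)) := by
      refine tendsto_nhdsWithin_of_tendsto_nhds_of_eventually_within _ ?_ ?_
      · exact ((by fun_prop : Continuous fun s : ℝ => (s * Complex.I : ℂ)).tendsto t).mono_left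
          nhdsWithin_le_nhds
      · filter_upwards [self_mem_nhdsWithin] with s hs h
        exact hs (by simpa using h)
    have h2 := eventually_nhdsWithin_iff.1 (hc.eventually h0)
    rw [mem_nhdsWithin_iff_eventually]
    filter_upwards [h2] with s hs hmem'
    simp only [mem_compl_iff, mem_ofPred_eq, Classical.not_imp, not_not, mem_Ioi] at hmem'
    by_contra hne
    exact hs hne hmem'.2

/-- `ψ(0,t) φ(x,t) - φ(0,t) ψ(x,t)` is a multiple of the solution vanishing at the origin. -/
theorem psi_zero_mul_phi (hu : IsPotential u) {t : ℝ} (ht : t ≠ 0) {x : ℝ} (hx : 0 ≤ x) :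
    psi u 0 t * phi u x t = psi u x t - 2 * Complex.I * specA u t * sineFn u x t := by
  have hk := ofReal_im_nonneg t
  have h1 := hu.isEigenfunction_reg 1 0 hk
  have h2 := hu.isEigenfunction_psi hk
  have h3 := (h1.linear h2 (psi u 0 t) (-1)).eq_of_init
    (((hu.isEigenfunction_sineFn t).linear h2 (-(2 * Complex.I * specA u t)) 0)) hu.cont ?_ ?_ x hx
  · rw [hu.phi_eq hk hx]
    linear_combination h3
  · rw [hu.reg_zero 1 0 hk, IsPotential.sineFn_zero]
    push_cast; ring
  · rw [hu.regDeriv_zero 1 0 hk, hu.sineDeriv_zero, hu.specA_eq hk, hu.psiX0_eq_psiDeriv hk]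
    have : (t : ℂ) ≠ 0 := by exact_mod_cast ht
    field_simp [Complex.I_ne_zero]
    ring

/-- By `psi_zero_mul_phi` the bracket in `N` is `-2i a(t)` times the transform of `f` against
`sineFn`, so `a` cancels on the real axis. -/
theorem specN_eq (hu : IsPotential u) (ha : ∀ k : ℂ, 0 ≤ k.im → k ≠ 0 → specA u k ≠ 0)
    {f : ℝ → ℝ} (hf : IntegrableOn f (Ioi 0)) (γ₁ : ℝ) {t : ℝ} (ht : t ≠ 0) :
    specN u f γ₁ t = 2 * (∫ x in Ioi 0, f x * sineFn u x t : ℝ) / (t - γ₁) / psi u 0 t := by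
  have hk := ofReal_im_nonneg t
  have ht0 : (t : ℂ) ≠ 0 := by exact_mod_cast ht
  have hA := ha t hk ht0
  have hψ := hu.psi_zero_ne_zero ha hk
  have hint : ∀ F : ℝ → ℂ, ContinuousOn F (Ici 0) → (∃ C, ∀ x, 0 ≤ x → ‖F x‖ ≤ C) →
      IntegrableOn (fun x => (f x : ℂ) * F x) (Ioi 0) := fun F hF ⟨C, hC⟩ => by
    refine Integrable.mono' (hf.norm.const_mul C) (hf.ofReal.aestronglyMeasurable.mul
      ((hF.mono Ioi_subset_Ici_self).aestronglyMeasurable measurableSet_Ioi)) ?_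
    filter_upwards [ae_restrict_mem measurableSet_Ioi] with x hx
    rw [norm_mul, Complex.norm_real, mul_comm]
    exact mul_le_mul_of_nonneg_right (hC x (le_of_lt hx)) (norm_nonneg _)
  have i1 := hint (fun x => psi u x t) (hu.isEigenfunction_psi hk).continuousOn
    ⟨_, fun x hx => hu.norm_psi_real_le t hx⟩
  have i2 := hint (fun x => (sineFn u x t : ℂ)) (hu.isEigenfunction_sineFn t).continuousOn
    ⟨_, fun x hx => by simpa using hu.abs_sineFn_le t hx⟩
  have h1 : psi u 0 t * (∫ x in Ioi (0 : ℝ), (f x : ℂ) * phi u x t)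
      = (∫ x in Ioi (0 : ℝ), (f x : ℂ) * psi u x t)
        - 2 * Complex.I * specA u t * ∫ x in Ioi (0 : ℝ), (f x : ℂ) * sineFn u x t := by
    rw [← integral_const_mul, ← integral_const_mul, ← integral_sub i1 (i2.const_mul _)]
    refine setIntegral_congr_fun measurableSet_Ioi fun x hx => ?_
    linear_combination (f x : ℂ) * hu.psi_zero_mul_phi ht (le_of_lt hx)
  have h2 : ((∫ x in Ioi 0, f x * sineFn u x t : ℝ) : ℂ)
      = ∫ x in Ioi (0 : ℝ), (f x : ℂ) * sineFn u x t := by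
    rw [← integral_complex_ofReal]
    push_cast; rfl
  rw [specN, h1, hu.phi_zero hk, h2, div_div]
  have : Complex.I * specA u t * (t - γ₁) * psi u 0 t
      = Complex.I * specA u t * ((t - γ₁) * psi u 0 t) := by ring
  rw [this, ← mul_div_mul_left _ ((t - γ₁) * psi u 0 t) (mul_ne_zero Complex.I_ne_zero hA)]
  congr 1
  ring

/-- `ψ(x,k) / ψ(0,k)` decays like `e^{-x Im k}`. -/
theorem exists_norm_psi_div_le (hu : IsPotential u) (hψ : ∀ k : ℂ, 0 ≤ k.im → psi u 0 k ≠ 0) :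
    ∃ C, 0 ≤ C ∧ ∀ x : ℝ, 0 ≤ x → ∀ k : ℂ, 0 ≤ k.im →
      ‖psi u x k / psi u 0 k‖ ≤ C * Real.exp (-(x * k.im)) := by
  obtain ⟨c, hc, hcm⟩ := hu.exists_le_norm_jost_zero hψ
  refine ⟨‖hu.jost‖ / c, by positivity, fun x hx k hk => ?_⟩
  rw [norm_div, hu.psi_zero_eq hk, mul_comm x, div_mul_eq_mul_div]
  exact div_le_div₀ (by positivity) (hu.norm_psi_le hk hx) hc (hcm k hk)

theorem continuousOn_psi_div (hu : IsPotential u) (hψ : ∀ k : ℂ, 0 ≤ k.im → psi u 0 k ≠ 0)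
    {x : ℝ} (hx : 0 ≤ x) :
    ContinuousOn (fun k => psi u x k / psi u 0 k) {k | 0 ≤ k.im} :=
  (hu.continuousOn_psi hx).div (hu.continuousOn_psi le_rfl) hψ

theorem differentiableOn_psi_div (hu : IsPotential u) (hψ : ∀ k : ℂ, 0 ≤ k.im → psi u 0 k ≠ 0)
    {x : ℝ} (hx : 0 ≤ x) :
    DifferentiableOn ℂ (fun k => psi u x k / psi u 0 k) {k | 0 < k.im} :=
  (hu.differentiableOn_psi hx).div (hu.differentiableOn_psi le_rfl) fun k hk => hψ k (le_of_lt hk)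

end IsPotential

/-! ### The integrands of the representation -/

theorem integrableOn_of_norm_le_exp {F : ℝ → ℂ} (hF : ContinuousOn F (Ioi 0)) {C b : ℝ}
    (hb : 0 < b) (hle : ∀ t, 0 < t → ‖F t‖ ≤ C * Real.exp (-(b * t))) :
    IntegrableOn F (Ioi 0) := by
  have he : IntegrableOn (fun t => C * Real.exp (-(b * t))) (Ioi 0) := by
    simpa only [neg_mul, IntegrableOn] using (exp_neg_integrableOn_Ioi 0 hb).const_mul C
  refine Integrable.mono' he (hF.aestronglyMeasurable measurableSet_Ioi) ?_
  filter_upwards [ae_restrict_mem measurableSet_Ioi] with t ht using hle t ht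

theorem conj_g0 (q : ℝ → ℝ → ℝ) (k : ℂ) : conj (g0 q k) = g0 q (conj k) := by
  rw [g0, g0, ← integral_conj]
  congr 1
  funext η
  rw [map_mul, ← Complex.exp_conj]
  simp

theorem norm_exp_neg_mul_real (k : ℂ) (y : ℝ) :
    ‖Complex.exp (-(k * y))‖ = Real.exp (-(y * k.re)) := by
  rw [Complex.norm_exp, Complex.neg_re, Complex.re_mul_ofReal, mul_comm]

theorem sub_ofReal_ne_zero {k : ℂ} (hk : 0 ≤ k.re) {γ : ℝ} (hγ : γ < 0) : k - γ ≠ 0 := fun h => by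
  have := congrArg Complex.re h
  simp at this
  linarith

theorem norm_add_div_sub_le_one {k : ℂ} (hk : 0 ≤ k.re) {γ : ℝ} (hγ : γ < 0) :
    ‖(k + γ) / (k - γ)‖ ≤ 1 := by
  rw [norm_div]
  refine div_le_one_of_le₀ ?_ (norm_nonneg _)
  rw [← sq_le_sq₀ (norm_nonneg _) (norm_nonneg _), ← Complex.normSq_eq_norm_sq,
    ← Complex.normSq_eq_norm_sq, Complex.normSq_apply, Complex.normSq_apply]
  simp only [Complex.add_re, Complex.add_im, Complex.sub_re, Complex.sub_im, Complex.ofReal_re,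
    Complex.ofReal_im]
  nlinarith [mul_nonneg hk (neg_nonneg.2 hγ.le)]

theorem mapsTo_ofReal_closedQuadrant :
    MapsTo (fun t : ℝ => (t : ℂ)) (Ici 0) closedQuadrant := fun t ht => ⟨by simpa using ht, by simp⟩

theorem mapsTo_mul_I_closedQuadrant :
    MapsTo (fun t : ℝ => (t * Complex.I : ℂ)) (Ici 0) closedQuadrant :=
  fun t ht => ⟨by simp, by simpa using ht⟩

section

variable {u f g h h' : ℝ → ℝ} {q : ℝ → ℝ → ℝ} {γ₁ γ₂ x y : ℝ}

theorem leftover1_eq (u : ℝ → ℝ) (γ₁ : ℝ) (q : ℝ → ℝ → ℝ) (x y : ℝ) (k : ℂ) :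
    leftover1 u γ₁ q x y k = psi u x k / psi u 0 k * Complex.exp (-(k * y)) * expConv (q 0) 0 k
      * ((k + γ₁) / (k - γ₁)) := by
  rw [leftover1, g0_neg_eq_expConv]
  ring

theorem continuousOn_leftover1 (hu : IsPotential u)
    (hψ : ∀ k : ℂ, 0 ≤ k.im → psi u 0 k ≠ 0) (hi : IntegrableOn (q 0) (Ioi 0)) (hγ₁ : γ₁ < 0) (hx : 0 ≤ x)
    (y : ℝ) : ContinuousOn (leftover1 u γ₁ q x y) closedQuadrant := by
  refine ContinuousOn.congr ?_ fun k _ => leftover1_eq u γ₁ q x y k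
  refine ((((hu.continuousOn_psi_div hψ hx).mono fun k hk => hk.2).mul (by fun_prop)).mul
    ((continuousOn_expConv hi 0).mono fun k hk => hk.1)).mul ?_
  exact ContinuousOn.div (by fun_prop) (by fun_prop) fun k hk => sub_ofReal_ne_zero hk.1 hγ₁

theorem differentiableOn_leftover1 (hu : IsPotential u)
    (hψ : ∀ k : ℂ, 0 ≤ k.im → psi u 0 k ≠ 0) (hi : IntegrableOn (q 0) (Ioi 0)) (hγ₁ : γ₁ < 0) (hx : 0 ≤ x)
    (y : ℝ) : DifferentiableOn ℂ (leftover1 u γ₁ q x y) openQuadrant := by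
  refine DifferentiableOn.congr ?_ fun k _ => leftover1_eq u γ₁ q x y k
  refine ((((hu.differentiableOn_psi_div hψ hx).mono fun k hk => hk.2).mul (by fun_prop)).mul
    ((differentiableOn_expConv hi 0).mono fun k hk => hk.1)).mul ?_
  exact DifferentiableOn.div (by fun_prop) (by fun_prop) fun k hk =>
    sub_ofReal_ne_zero (le_of_lt hk.1) hγ₁

theorem exists_norm_leftover1_le (hu : IsPotential u)
    (hψ : ∀ k : ℂ, 0 ≤ k.im → psi u 0 k ≠ 0) (hγ₁ : γ₁ < 0) (q : ℝ → ℝ → ℝ) (hx : 0 ≤ x) (y : ℝ) :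
    ∃ C, 0 ≤ C ∧ ∀ k ∈ closedQuadrant, ‖leftover1 u γ₁ q x y k‖
      ≤ C * Real.exp (-(x * k.im)) * Real.exp (-(y * k.re)) * ‖expConv (q 0) 0 k‖ := by
  obtain ⟨C, hC0, hC⟩ := hu.exists_norm_psi_div_le hψ
  refine ⟨C, hC0, fun k hk => ?_⟩
  rw [leftover1_eq, norm_mul, norm_mul, norm_mul, norm_exp_neg_mul_real]
  refine (mul_le_of_le_one_right (by positivity) (norm_add_div_sub_le_one hk.1 hγ₁)).trans ?_
  gcongr
  exact hC x hx k hk.2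

theorem integrableOn_leftover1_ofReal (hu : IsPotential u)
    (hψ : ∀ k : ℂ, 0 ≤ k.im → psi u 0 k ≠ 0) (hi : IntegrableOn (q 0) (Ioi 0)) (hγ₁ : γ₁ < 0)
    (hx : 0 ≤ x) (hy : 0 < y) : IntegrableOn (fun t : ℝ => leftover1 u γ₁ q x y t) (Ioi 0) := by
  obtain ⟨C, hC0, hC⟩ := exists_norm_leftover1_le hu hψ hγ₁ q hx y
  refine integrableOn_of_norm_le_exp (C := C * ∫ η in Ioi (0 : ℝ), ‖q 0 η‖)
    (((continuousOn_leftover1 hu hψ hi hγ₁ hx y).comp (by fun_prop)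
      mapsTo_ofReal_closedQuadrant).mono Ioi_subset_Ici_self) hy fun t ht => ?_
  have hk := mapsTo_ofReal_closedQuadrant ht.le
  refine (hC t hk).trans ?_
  simp only [Complex.ofReal_im, Complex.ofReal_re, mul_zero, neg_zero, Real.exp_zero, mul_one]
  rw [mul_right_comm]
  have := norm_expConv_le hi 0 hk.1
  gcongr

theorem integrableOn_leftover1_mul_I (hu : IsPotential u)
    (hψ : ∀ k : ℂ, 0 ≤ k.im → psi u 0 k ≠ 0) (hi : IntegrableOn (q 0) (Ioi 0)) (hγ₁ : γ₁ < 0)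
    (hx : 0 < x) (y : ℝ) :
    IntegrableOn (fun t : ℝ => leftover1 u γ₁ q x y (t * Complex.I)) (Ioi 0) := by
  obtain ⟨C, hC0, hC⟩ := exists_norm_leftover1_le hu hψ hγ₁ q hx.le y
  refine integrableOn_of_norm_le_exp (C := C * ∫ η in Ioi (0 : ℝ), ‖q 0 η‖)
    (((continuousOn_leftover1 hu hψ hi hγ₁ hx.le y).comp (by fun_prop)
      mapsTo_mul_I_closedQuadrant).mono Ioi_subset_Ici_self) hx fun t ht => ?_
  have hk := mapsTo_mul_I_closedQuadrant ht.le
  refine (hC _ hk).trans ?_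
  have := norm_expConv_le hi 0 hk.1
  have hre : ((t : ℂ) * Complex.I).re = 0 := by simp
  have him : ((t : ℂ) * Complex.I).im = t := by simp
  rw [hre, him, mul_zero, neg_zero, Real.exp_zero, mul_one, mul_right_comm]
  gcongr

/-- The integrand is holomorphic in the open first quadrant: `ψ(0,k)` has no zeros, and `γ₁ < 0`
keeps the pole of `1/(k - γ₁)` outside. The Laplace transform supplies the decay `1 / ‖k‖` and `ψ`
the factor `e^{-x Im k}`. -/
theorem integral_leftover1_eq (hu : IsPotential u)
    (hψ : ∀ k : ℂ, 0 ≤ k.im → psi u 0 k ≠ 0) (hq : IsAdmissible (q 0) h') (hγ₁ : γ₁ < 0) (hx : 0 < x)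
    (hy : 0 < y) : (∫ t in Ioi (0 : ℝ), leftover1 u γ₁ q x y t)
      = Complex.I * ∫ t in Ioi (0 : ℝ), leftover1 u γ₁ q x y (t * Complex.I) := by
  obtain ⟨C, hC0, hC⟩ := exists_norm_leftover1_le hu hψ hγ₁ q hx.le y
  obtain ⟨M, hM⟩ := hq.exists_norm_mul_expConv_le le_rfl
  have h1 := tendsto_integral_bottom_sub_left
    (continuousOn_leftover1 hu hψ hq.int hγ₁ hx.le y)
    (differentiableOn_leftover1 hu hψ hq.int hγ₁ hx.le y) (C := C * M) hx fun k hk => by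
      have hre : Real.exp (-(y * k.re)) ≤ 1 :=
        Real.exp_le_one_iff.2 (by have := mul_nonneg hy.le hk.1; linarith)
      calc ‖k‖ * ‖leftover1 u γ₁ q x y k‖
          ≤ ‖k‖ * (C * Real.exp (-(x * k.im)) * 1 * ‖expConv (q 0) 0 k‖) := by
            refine mul_le_mul_of_nonneg_left ((hC k hk).trans ?_) (norm_nonneg _)
            gcongr
        _ = C * Real.exp (-(x * k.im)) * (‖k‖ * ‖expConv (q 0) 0 k‖) := by ring
        _ ≤ C * Real.exp (-(x * k.im)) * M := by
            have := hM k hk.1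
            gcongr
        _ = C * M * Real.exp (-(x * k.im)) := by ring
  have h2 := (intervalIntegral_tendsto_integral_Ioi 0
    (integrableOn_leftover1_ofReal hu hψ hq.int hγ₁ hx.le hy) tendsto_id).sub
    ((intervalIntegral_tendsto_integral_Ioi 0
      (integrableOn_leftover1_mul_I hu hψ hq.int hγ₁ hx y) tendsto_id).const_mul Complex.I)
  exact sub_eq_zero.1 (tendsto_nhds_unique h2 h1)

/-- On the real axis the integrand is only known to be `O(1 / |k|)`, so the rotation is stated for
the difference of truncated integrals. The factor `i` from `dk` exchanges imaginary and real parts.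
-/
theorem tendsto_im_integral_psi_div_mul_expConv (hu : IsPotential u)
    (hψ : ∀ k : ℂ, 0 ≤ k.im → psi u 0 k ≠ 0) (hh : IsAdmissible h h') (hx : 0 < x)
    (hy : 0 ≤ y) :
    Tendsto (fun R : ℝ => (∫ t in (0 : ℝ)..R, psi u x t / psi u 0 t * expConv h y t).im
      - (∫ t in (0 : ℝ)..R, psi u x (t * Complex.I) / psi u 0 (t * Complex.I)
        * expConv h y (t * Complex.I)).re) atTop (𝓝 0) := by
  obtain ⟨C, hC0, hC⟩ := hu.exists_norm_psi_div_le hψ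
  obtain ⟨M, hM⟩ := hh.exists_norm_mul_expConv_le hy
  have h1 := tendsto_integral_bottom_sub_left
    (f := fun k => psi u x k / psi u 0 k * expConv h y k)
    (((hu.continuousOn_psi_div hψ hx.le).mono fun k hk => hk.2).mul
      ((continuousOn_expConv hh.int y).mono fun k hk => hk.1))
    (((hu.differentiableOn_psi_div hψ hx.le).mono fun k hk => hk.2).mul
      ((differentiableOn_expConv hh.int y).mono fun k hk => hk.1)) (C := C * M) hx fun k hk => by
      calc ‖k‖ * ‖psi u x k / psi u 0 k * expConv h y k‖
          = ‖psi u x k / psi u 0 k‖ * (‖k‖ * ‖expConv h y k‖) := by rw [norm_mul]; ring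
        _ ≤ C * Real.exp (-(x * k.im)) * M :=
            mul_le_mul (hC x hx.le k hk.2) (hM k hk.1) (by positivity) (by positivity)
        _ = C * M * Real.exp (-(x * k.im)) := by ring
  have h2 := (Complex.continuous_im.tendsto 0).comp h1
  simpa [Function.comp_def] using h2

end

namespace IsDecayingSolution

variable {u w f g : ℝ → ℝ} {q qx qy : ℝ → ℝ → ℝ} {γ₁ γ₂ : ℝ}

theorem integrableOn_bottom (hq : IsDecayingSolution u q qx qy w)
    (hf : ∀ x, 0 < x → qy x 0 + γ₁ * q x 0 = f x) : IntegrableOn f (Ioi 0) :=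
  IntegrableOn.congr_fun ((hq.dom_y.integrableOn_left le_rfl).add
    ((hq.dom.integrableOn_left le_rfl).const_mul γ₁)) (fun x hx => hf x hx) measurableSet_Ioi

end IsDecayingSolution

/-! ### Integrability of the terms and the real form of the representation. -/

section

variable {u w f g : ℝ → ℝ} {q qx qy : ℝ → ℝ → ℝ} {γ₁ γ₂ x y : ℝ}

theorem integrableOn_term1 (hu : IsPotential u)
    (ha : ∀ k : ℂ, 0 ≤ k.im → k ≠ 0 → specA u k ≠ 0) (hf : IntegrableOn f (Ioi 0))
    (hγ₁ : γ₁ < 0) (hx : 0 ≤ x) (hy : 0 < y) :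
    IntegrableOn (fun t : ℝ => term1 u f γ₁ x y t) (Ioi 0) := by
  have hψ : ∀ k : ℂ, 0 ≤ k.im → psi u 0 k ≠ 0 := fun k hk => hu.psi_zero_ne_zero ha hk
  obtain ⟨C, hC0, hC⟩ := hu.exists_norm_psi_div_le hψ
  have hbd : ∀ t x, 0 < x → ‖f x * sineFn u x t‖ ≤ ‖f x‖ * ‖hu.jost‖ ^ 2 := fun t x hx => by
    rw [norm_mul]
    exact mul_le_mul_of_nonneg_left (hu.abs_sineFn_le t hx.le) (norm_nonneg _)
  have hbd' : ∀ t, ∀ᵐ x ∂volume.restrict (Ioi 0),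
      ‖f x * sineFn u x t‖ ≤ ‖f x‖ * ‖hu.jost‖ ^ 2 := fun t => by
    filter_upwards [ae_restrict_mem measurableSet_Ioi] with x hx using hbd t x hx
  have hfs : Continuous fun t => ∫ x in Ioi 0, f x * sineFn u x t := by
    refine continuous_of_dominated (fun t => ?_) hbd' (hf.norm.mul_const _) ?_
    · exact hf.aestronglyMeasurable.mul (((hu.continuousOn_sineFn_left t).mono
        Ioi_subset_Ici_self).aestronglyMeasurable measurableSet_Ioi)
    · filter_upwards [ae_restrict_mem measurableSet_Ioi] with x hx
        using continuous_const.mul (hu.continuous_sineFn (le_of_lt hx))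
  set M := ∫ x in Ioi 0, ‖f x‖ * ‖hu.jost‖ ^ 2 with hM
  have hfsb : ∀ t, |∫ x in Ioi 0, f x * sineFn u x t| ≤ M := fun t =>
    norm_integral_le_of_norm_le (hf.norm.mul_const _) (hbd' t)
  have hM0 : 0 ≤ M := (abs_nonneg _).trans (hfsb 0)
  have heq : EqOn (fun t : ℝ => Complex.exp (-(t * y)) * (psi u x t / psi u 0 t)
      * (2 * (∫ x in Ioi 0, f x * sineFn u x t : ℝ) / (t - γ₁)))
      (fun t : ℝ => term1 u f γ₁ x y t) (Ioi 0) := fun t ht => by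
    simp only
    rw [term1, hu.specN_eq ha hf γ₁ (ne_of_gt ht)]
    ring
  refine IntegrableOn.congr_fun ?_ heq measurableSet_Ioi
  refine integrableOn_of_norm_le_exp (C := C * (2 * M / (-γ₁))) ?_ hy fun t ht => ?_
  · have hfs' := Complex.continuous_ofReal.comp hfs
    refine ContinuousOn.mul (ContinuousOn.mul (by fun_prop) ?_) ?_
    · exact (hu.continuousOn_psi_div hψ hx).comp (by fun_prop) fun t _ => IsPotential.ofReal_im_nonneg t
    · refine ContinuousOn.div (hfs'.const_mul 2).continuousOn (by fun_prop) fun t ht => ?_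
      exact sub_ofReal_ne_zero (by simpa using le_of_lt ht) hγ₁
  · have h1 := hC x hx t (IsPotential.ofReal_im_nonneg t)
    simp only [Complex.ofReal_im, mul_zero, neg_zero, Real.exp_zero, mul_one] at h1
    have h2 : ‖(2 * (∫ x in Ioi 0, f x * sineFn u x t : ℝ) / (t - γ₁) : ℂ)‖
        ≤ 2 * M / (-γ₁) := by
      rw [norm_div, norm_mul, Complex.norm_real, ← Complex.ofReal_sub, Complex.norm_real]
      refine div_le_div₀ (by positivity) ?_ (by linarith) ?_
      · simpa using hfsb t
      · exact (by linarith : -γ₁ ≤ t - γ₁).trans (le_abs_self _)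
    rw [norm_mul, norm_mul, norm_exp_neg_mul_real, Complex.ofReal_re]
    calc _ ≤ Real.exp (-(y * t)) * C * (2 * M / (-γ₁)) := by gcongr
      _ = _ := by ring

theorem integrableOn_exp_mul_psi_div_mul_g0 (hu : IsPotential u)
    (hψ : ∀ k : ℂ, 0 ≤ k.im → psi u 0 k ≠ 0) (hi : IntegrableOn (q 0) (Ioi 0)) (hx : 0 < x)
    (y : ℝ) :
    IntegrableOn (fun t : ℝ => psi u x (t * Complex.I) / psi u 0 (t * Complex.I)
      * (Complex.exp (-(t * Complex.I * y)) * g0 q (t * Complex.I))) (Ioi 0) := by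
  obtain ⟨C, hC0, hC⟩ := hu.exists_norm_psi_div_le hψ
  have hg0 : ∀ t : ℝ, g0 q (t * Complex.I) = expConv (q 0) 0 (-(t * Complex.I)) := fun t => by
    rw [← g0_neg_eq_expConv, neg_neg]
  simp only [hg0]
  refine integrableOn_of_norm_le_exp (C := C * ∫ η in Ioi (0 : ℝ), ‖q 0 η‖) ?_ hx fun t ht => ?_
  · refine ContinuousOn.mul ?_ (ContinuousOn.mul (by fun_prop) ?_)
    · exact (hu.continuousOn_psi_div hψ hx.le).comp (by fun_prop)
        fun t ht => by simpa using le_of_lt ht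
    · exact (continuousOn_expConv hi 0).comp (by fun_prop) fun t _ => by simp
  · have h1 := hC x hx.le (t * Complex.I) (by simpa using ht.le)
    have him : ((t : ℂ) * Complex.I).im = t := by simp
    have hre : ((t : ℂ) * Complex.I).re = 0 := by simp
    have h2 := norm_expConv_le hi 0 (k := -(t * Complex.I)) (by simp)
    rw [him] at h1
    rw [norm_mul, norm_mul, norm_exp_neg_mul_real, hre, mul_zero, neg_zero, Real.exp_zero, one_mul,
      mul_right_comm]
    gcongr

/-- The identity may fail at the zeros of `D`, where the quotient defining `F` takes a default
value. Almost everywhere is enough, and it also yields integrability, although nothing in the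
formula for `F` shows that it stays bounded near those zeros. -/
theorem IsDecayingSolution.ae_term2_eq (hq : IsDecayingSolution u q qx qy w) (hu : IsPotential u)
    (hf : ∀ x, 0 < x → qy x 0 + γ₁ * q x 0 = f x)
    (hg : ∀ y, 0 < y → qx 0 y + γ₂ * q 0 y = g y) (hγ₁ : γ₁ < 0) (x y : ℝ) :
    ∀ᵐ t : ℝ ∂volume.restrict (Ioi 0), psi u x (t * Complex.I) / psi u 0 (t * Complex.I)
      * (Complex.exp (-(t * Complex.I * y)) * g0 q (t * Complex.I))
      + leftover1 u γ₁ q x y (t * Complex.I) = term2 u f g 0 γ₁ γ₂ x y (t * Complex.I) := by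
  filter_upwards [hu.ae_specD_ne_zero γ₂, ae_restrict_mem measurableSet_Ioi] with t hD ht
  rw [term2, hq.specF_eq hu hf hg hγ₁ ht hD, leftover1]
  ring

theorem IsDecayingSolution.integrableOn_term2 (hq : IsDecayingSolution u q qx qy w)
    (hu : IsPotential u) (hψ : ∀ k : ℂ, 0 ≤ k.im → psi u 0 k ≠ 0)
    (hf : ∀ x, 0 < x → qy x 0 + γ₁ * q x 0 = f x)
    (hg : ∀ y, 0 < y → qx 0 y + γ₂ * q 0 y = g y) (hγ₁ : γ₁ < 0) (hx : 0 < x) (y : ℝ) :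
    IntegrableOn (fun t : ℝ => term2 u f g 0 γ₁ γ₂ x y (t * Complex.I)) (Ioi 0) :=
  have hi := hq.dom.integrableOn_right (x := 0) le_rfl
  Integrable.congr ((integrableOn_exp_mul_psi_div_mul_g0 hu hψ hi hx y).add
    (integrableOn_leftover1_mul_I hu hψ hi hγ₁ hx y)) (hq.ae_term2_eq hu hf hg hγ₁ x y)

theorem IsDecayingSolution.representation (hq : IsDecayingSolution u q qx qy w)
    (hu : IsPotential u) (ha : ∀ k : ℂ, 0 ≤ k.im → k ≠ 0 → specA u k ≠ 0)
    (hf : ∀ x, 0 < x → qy x 0 + γ₁ * q x 0 = f x)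
    (hg : ∀ y, 0 < y → qx 0 y + γ₂ * q 0 y = g y) (hγ₁ : γ₁ < 0) (hx : 0 < x) (hy : 0 < y) :
    Real.pi * q x y = (∫ t in Ioi (0 : ℝ), term2 u f g 0 γ₁ γ₂ x y (t * Complex.I)).re
      - (∫ t in Ioi (0 : ℝ), term1 u f γ₁ x y t).im := by
  have hψ : ∀ k : ℂ, 0 ≤ k.im → psi u 0 k ≠ 0 := fun k hk => hu.psi_zero_ne_zero ha hk
  have hadm := hq.isAdmissible_right (x := 0) le_rfl
  have hfi := hq.integrableOn_bottom hf
  set B : ℂ → ℂ := fun k => psi u x k / psi u 0 k with hB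
  set G : ℝ → ℂ := fun t => B (t * Complex.I)
    * (Complex.exp (-(t * Complex.I * y)) * g0 q (t * Complex.I)) with hG
  have iT := integrableOn_term1 hu ha hfi hγ₁ hx.le hy
  have iL := integrableOn_leftover1_ofReal hu hψ hadm.int hγ₁ hx.le hy
  have iL' := integrableOn_leftover1_mul_I hu hψ hadm.int hγ₁ hx y
  have iG : IntegrableOn G (Ioi 0) := integrableOn_exp_mul_psi_div_mul_g0 hu hψ hadm.int hx y
  have hinv := (hu.tendsto_sine_inversion hψ (hq.isAdmissible_left hy.le) hx).const_mul 2
  have hBE : ∀ R : ℝ, 0 ≤ R → IntervalIntegrable (fun t : ℝ => B t * expConv (q 0) y t)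
      volume 0 R := fun R hR => by
    refine ContinuousOn.intervalIntegrable ?_
    rw [uIcc_of_le hR]
    exact ((hu.continuousOn_psi_div hψ hx.le).comp (by fun_prop)
      fun t _ => IsPotential.ofReal_im_nonneg t).mul ((continuousOn_expConv hadm.int y).comp (by fun_prop)
      fun t ht => by simpa using ht.1)
  have hBE' : ∀ R : ℝ, 0 ≤ R → IntervalIntegrable
      (fun t : ℝ => B (t * Complex.I) * expConv (q 0) y (t * Complex.I)) volume 0 R := fun R hR => by
    refine ContinuousOn.intervalIntegrable ?_
    rw [uIcc_of_le hR]
    exact ((hu.continuousOn_psi_div hψ hx.le).comp (by fun_prop)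
      fun t ht => by simpa using ht.1).mul ((continuousOn_expConv hadm.int y).comp (by fun_prop)
      fun t ht => by simp)
  have hii : ∀ {F : ℝ → ℂ} {R : ℝ}, 0 ≤ R → IntegrableOn F (Ioi 0) →
      IntervalIntegrable F volume 0 R := fun hR hF =>
    (intervalIntegrable_iff_integrableOn_Ioc_of_le hR).2 (hF.mono_set Ioc_subset_Ioi_self)
  -- the transform of `q` along the positive real axis
  have hreal : ∀ R : ℝ, 0 ≤ R → 2 * (∫ t in (0 : ℝ)..R, (B t).im
        * ∫ ξ in Ioi (0 : ℝ), sineFn u ξ t * q ξ y)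
      = (∫ t in (0 : ℝ)..R, B t * expConv (q 0) y t).im
        - (∫ t in (0 : ℝ)..R, term1 u f γ₁ x y t).im
        + (∫ t in (0 : ℝ)..R, leftover1 u γ₁ q x y t).im := fun R hR => by
    have i1 := hBE R hR
    have i2 := hii hR iT
    have i3 := hii hR iL
    rw [← Complex.sub_im, ← Complex.add_im, ← intervalIntegral.integral_sub i1 i2,
      ← intervalIntegral.integral_add (i1.sub i2) i3, ← intervalIntegral.integral_const_mul,
      intervalIntegral.integral_of_le hR, intervalIntegral.integral_of_le hR]
    have i4 := ((i1.sub i2).add i3).1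
    rw [← RCLike.im_eq_complex_im, ← integral_im i4]
    refine setIntegral_congr_fun measurableSet_Ioc fun t ht => ?_
    have h1 := hq.two_mul_sine_transform hu hf hγ₁ ht.1 hy.le
    have h2 : B t * expConv (q 0) y t - term1 u f γ₁ x y t + leftover1 u γ₁ q x y t
        = ((2 * ∫ ξ in Ioi (0 : ℝ), sineFn u ξ t * q ξ y : ℝ) : ℂ) * B t := by
      push_cast
      rw [h1, term1, hu.specN_eq ha hfi γ₁ ht.1.ne', leftover1, hB]
      simp only
      ring
    simp only [RCLike.im_eq_complex_im]
    rw [h2, Complex.im_ofReal_mul]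
    ring
  -- `B` is real on the imaginary axis, so only the real part of the Laplace integral matters, and
  -- `re_expConv_imaginary` replaces `e^{-k|η-y|}` by `e^{k(η-y)}`.
  have himag : ∀ R : ℝ, 0 ≤ R →
      (∫ t in (0 : ℝ)..R, B (t * Complex.I) * expConv (q 0) y (t * Complex.I)).re
        = (∫ t in (0 : ℝ)..R, G t).re := fun R hR => by
    rw [intervalIntegral.integral_of_le hR, intervalIntegral.integral_of_le hR,
      ← RCLike.re_eq_complex_re, ← integral_re (hBE' R hR).1, ← integral_re (hii hR iG).1]
    refine setIntegral_congr_fun measurableSet_Ioc fun t ht => ?_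
    have hBr : ((B (t * Complex.I)).re : ℂ) = B (t * Complex.I) := by
      rw [← Complex.conj_eq_iff_re, hB]
      simp only
      rw [map_div₀, hu.conj_psi_imaginary ht.1.le hx.le, hu.conj_psi_imaginary ht.1.le le_rfl]
    simp only [RCLike.re_eq_complex_re, hG]
    rw [← hBr, Complex.re_ofReal_mul, Complex.re_ofReal_mul, re_expConv_imaginary hadm.int, g0]
  have hrot := tendsto_im_integral_psi_div_mul_expConv hu hψ hadm hx hy.le
  have lT := (Complex.continuous_im.tendsto _).comp
    (intervalIntegral_tendsto_integral_Ioi 0 iT tendsto_id)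
  have lL := (Complex.continuous_im.tendsto _).comp
    (intervalIntegral_tendsto_integral_Ioi 0 iL tendsto_id)
  have lG := (Complex.continuous_re.tendsto _).comp
    (intervalIntegral_tendsto_integral_Ioi 0 iG tendsto_id)
  have hlim := ((hrot.add lG).sub lT).add lL
  have hfin := tendsto_nhds_unique (hinv.congr' ?_) hlim
  -- The leftover integral, moved to the imaginary axis, supplies the second summand
  -- `g₀(-k)(k+γ₁)/(k-γ₁)` of `F`.
  · rw [integral_leftover1_eq hu hψ hadm hγ₁ hx hy, Complex.I_mul_im] at hfin
    have h2 : ∫ t in Ioi (0 : ℝ), term2 u f g 0 γ₁ γ₂ x y (t * Complex.I)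
        = (∫ t in Ioi (0 : ℝ), G t)
          + ∫ t in Ioi (0 : ℝ), leftover1 u γ₁ q x y (t * Complex.I) := by
      rw [← integral_add iG iL']
      exact (integral_congr_ae (hq.ae_term2_eq hu hf hg hγ₁ x y)).symm
    rw [h2, Complex.add_re]
    linarith
  · filter_upwards [eventually_ge_atTop 0] with R hR
    have h1 := hreal R hR
    have h2 := himag R hR
    simp only [Function.comp_apply, id_eq]
    simp only [hB] at h1 h2 ⊢
    rw [h1, h2]
    ring

end

/-! ### Reflection in the imaginary axis -/

section

variable {u f g : ℝ → ℝ} {q : ℝ → ℝ → ℝ} {γ₁ γ₂ x : ℝ}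

theorem exp_mul_neg_conj (k : ℂ) (y : ℝ) :
    Complex.exp (-conj k * y) = conj (Complex.exp (-(k * y))) := by
  rw [← Complex.exp_conj]
  simp

/-- The reflection `k ↦ -conj k` exchanges the first and second quadrants and conjugates `ψ`, so
integrals over the second contour are conjugates of those over the first, up to orientation. -/
theorem term3_neg_conj (hu : IsPotential u) (f : ℝ → ℝ) (γ₁ : ℝ) (hx : 0 ≤ x) (y : ℝ) {k : ℂ}
    (hk : 0 ≤ k.im) : term3 u f γ₁ x y (-conj k) = conj (term1 u f γ₁ x y k) := by
  rw [term3, term1, map_mul, map_mul, exp_mul_neg_conj, hu.psi_neg_conj hk hx]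
  simp

theorem leftover2_neg_conj (hu : IsPotential u) (γ₁ : ℝ) (q : ℝ → ℝ → ℝ) (hx : 0 ≤ x) (y : ℝ)
    {k : ℂ} (hk : 0 ≤ k.im) :
    leftover2 u γ₁ q x y (-conj k) = conj (leftover1 u γ₁ q x y k) := by
  rw [leftover2, leftover1, exp_mul_neg_conj, hu.psi_neg_conj hk hx, hu.psi_neg_conj hk le_rfl]
  simp only [map_mul, map_div₀, map_add, map_sub, conj_g0, map_neg, Complex.conj_ofReal]
  rw [← neg_div_neg_eq (conj k + (γ₁ : ℂ))]
  ring_nf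

theorem neg_conj_ofReal_mul_I (t : ℝ) : -conj (t * Complex.I : ℂ) = t * Complex.I := by simp

/-- `-conj k = k` on the imaginary axis, so conjugation sends the numerator of `F` to its negative.
There `D` is real, and `k - γ₁` becomes `-(k + γ₁)`; this produces the extra quotient in the fourth
integrand. -/
theorem conj_specF (hu : IsPotential u) (f g : ℝ → ℝ) (hγ₁ : γ₁ < 0) (γ₂ : ℝ) {t : ℝ}
    (ht : 0 ≤ t) :
    conj (specF u f g 0 γ₁ γ₂ (t * Complex.I))
      = (t * Complex.I - γ₁) / (t * Complex.I + γ₁) * specF u f g 0 γ₁ γ₂ (t * Complex.I) := by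
  have hk : 0 ≤ (t * Complex.I : ℂ).im := by simpa using ht
  have hD : conj (specD u 0 γ₂ (t * Complex.I)) = specD u 0 γ₂ (t * Complex.I) := by
    rw [specD, hu.psiX0_eq_psiDeriv hk, map_add, map_mul, hu.conj_psi_imaginary ht le_rfl,
      ← hu.psiDeriv_neg_conj hk le_rfl, neg_conj_ofReal_mul_I]
    simp
  have h1 : (t * Complex.I - γ₁ : ℂ) ≠ 0 := sub_ofReal_ne_zero (by simp) hγ₁
  have h2 : (t * Complex.I + γ₁ : ℂ) ≠ 0 := fun h => by
    have := congrArg Complex.re h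
    simp at this
    exact hγ₁.ne this
  have h3 : (-(t * Complex.I) - γ₁ : ℂ) ≠ 0 := fun h => h2 (by linear_combination -h)
  rw [specF, neg_conj_ofReal_mul_I, map_div₀, map_mul, map_add, map_mul, map_mul, Complex.conj_conj,
    hD, map_sub, map_add, Complex.conj_ofReal, map_mul, Complex.conj_ofReal, Complex.conj_I,
    mul_neg]
  by_cases h0 : specD u 0 γ₂ (t * Complex.I) = 0
  · simp [h0]
  · field_simp
    ring

theorem term4_imaginary (hu : IsPotential u) (f g : ℝ → ℝ) (hγ₁ : γ₁ < 0) (γ₂ : ℝ) (hx : 0 ≤ x)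
    (y : ℝ) {t : ℝ} (ht : 0 ≤ t) :
    term4 u f g 0 γ₁ γ₂ x y (t * Complex.I) = conj (term2 u f g 0 γ₁ γ₂ x y (t * Complex.I)) := by
  rw [term4, term2, map_mul, map_mul, map_div₀, conj_specF hu f g hγ₁ γ₂ ht, ← exp_mul_neg_conj,
    neg_conj_ofReal_mul_I, hu.conj_psi_imaginary ht hx, hu.conj_psi_imaginary ht le_rfl]
  ring

theorem ofReal_mul_neg_one (t : ℝ) : (t * -1 : ℂ) = -conj (t : ℂ) := by simp

end

theorem MeasureTheory.IntegrableOn.conj {F : ℝ → ℂ} {s : Set ℝ} (hF : IntegrableOn F s) :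
    IntegrableOn (fun t => conj (F t)) s :=
  (Complex.conjCLE.toContinuousLinearMap).integrable_comp hF

/-- The representation of `q` and the vanishing of the leftover terms, for a potential defined and
continuous on the whole line. -/
theorem IsPotential.representation {u f g : ℝ → ℝ} {γ₁ γ₂ : ℝ} {q : ℝ → ℝ → ℝ}
    (hu : IsPotential u) (ha : ∀ k : ℂ, 0 ≤ k.im → k ≠ 0 → specA u k ≠ 0) (hγ₁ : γ₁ < 0)
    (hq : IsPoincareSolution u f g 0 γ₁ γ₂ q) (hq_decay : HasDecay q) {x y : ℝ} (hx : 0 < x)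
    (hy : 0 < y) :
      (RayIntegrable 1 (term1 u f γ₁ x y) ∧
        RayIntegrable Complex.I (term2 u f g 0 γ₁ γ₂ x y) ∧
        RayIntegrable (-1) (term3 u f γ₁ x y) ∧
        RayIntegrable Complex.I (term4 u f g 0 γ₁ γ₂ x y)) ∧
      (q x y : ℂ) =
        1 / (2 * Complex.I * Real.pi) *
          (-rayIntegral 1 (term1 u f γ₁ x y)
            + rayIntegral Complex.I (term2 u f g 0 γ₁ γ₂ x y))
        + 1 / (2 * Complex.I * Real.pi) *
          (-rayIntegral (-1) (term3 u f γ₁ x y)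
            + rayIntegral Complex.I (term4 u f g 0 γ₁ γ₂ x y)) ∧
      (RayIntegrable 1 (leftover1 u γ₁ q x y) ∧
        RayIntegrable Complex.I (leftover1 u γ₁ q x y) ∧
        -rayIntegral 1 (leftover1 u γ₁ q x y)
          + rayIntegral Complex.I (leftover1 u γ₁ q x y) = 0) ∧
      (RayIntegrable (-1) (leftover2 u γ₁ q x y) ∧
        RayIntegrable Complex.I (leftover2 u γ₁ q x y) ∧
        -rayIntegral (-1) (leftover2 u γ₁ q x y)
          + rayIntegral Complex.I (leftover2 u γ₁ q x y) = 0) := by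
  obtain ⟨w, hs⟩ := hq.exists_isDecayingSolution hq_decay
  have hψ : ∀ k : ℂ, 0 ≤ k.im → psi u 0 k ≠ 0 := fun k hk => hu.psi_zero_ne_zero ha hk
  have hf := hq.bc_bottom
  have hg : ∀ y, 0 < y → partialX q 0 y + γ₂ * q 0 y = g y := fun y hy => by
    simpa using hq.bc_left y hy
  have hadm := hs.isAdmissible_right (x := 0) le_rfl
  have i1 := integrableOn_term1 hu ha (hs.integrableOn_bottom hf) hγ₁ hx.le hy
  have i2 := hs.integrableOn_term2 hu hψ hf hg hγ₁ hx y
  have j1 := integrableOn_leftover1_ofReal hu hψ hadm.int hγ₁ hx.le hy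
  have j2 := integrableOn_leftover1_mul_I hu hψ hadm.int hγ₁ hx y
  have e3 : ∀ t : ℝ, term3 u f γ₁ x y (t * -1) = conj (term1 u f γ₁ x y t) := fun t => by
    rw [ofReal_mul_neg_one, term3_neg_conj hu f γ₁ hx.le y (ofReal_im_nonneg t)]
  have e4 : EqOn (fun t : ℝ => conj (term2 u f g 0 γ₁ γ₂ x y (t * Complex.I)))
      (fun t : ℝ => term4 u f g 0 γ₁ γ₂ x y (t * Complex.I)) (Ioi 0) := fun t ht =>
    (term4_imaginary hu f g hγ₁ γ₂ hx.le y (le_of_lt ht)).symm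
  have e5 : ∀ t : ℝ, leftover2 u γ₁ q x y (t * -1) = conj (leftover1 u γ₁ q x y t) := fun t => by
    rw [ofReal_mul_neg_one, leftover2_neg_conj hu γ₁ q hx.le y (ofReal_im_nonneg t)]
  have e6 : EqOn (fun t : ℝ => conj (leftover1 u γ₁ q x y (t * Complex.I)))
      (fun t : ℝ => leftover2 u γ₁ q x y (t * Complex.I)) (Ioi 0) := fun t ht => by
    simp only
    rw [← leftover2_neg_conj hu γ₁ q hx.le y (by simpa using le_of_lt ht), neg_conj_ofReal_mul_I]
  have hrep := hs.representation hu ha hf hg hγ₁ hx hy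
  have hlo := integral_leftover1_eq (q := q) hu hψ hadm hγ₁ hx hy
  have hI : ∀ z : ℂ, conj (Complex.I * z) = -Complex.I * conj z := fun z => by simp
  refine ⟨⟨?_, i2, ?_, i2.conj.congr_fun e4 measurableSet_Ioi⟩, ?_, ⟨?_, j2, ?_⟩,
    ⟨?_, j2.conj.congr_fun e6 measurableSet_Ioi, ?_⟩⟩
  · simpa only [RayIntegrable, mul_one] using i1
  · simpa only [RayIntegrable, e3] using i1.conj
  -- The two braces, with their prefactors, are conjugate to each other, so the right-hand side is
  -- `(Re B - Im A) / π`.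
  · rw [rayIntegral, rayIntegral, rayIntegral, rayIntegral,
      ← setIntegral_congr_fun measurableSet_Ioi e4]
    simp only [e3, mul_one, one_mul]
    rw [integral_conj, integral_conj]
    set A := ∫ t in Ioi (0 : ℝ), term1 u f γ₁ x y t
    set B := ∫ t in Ioi (0 : ℝ), term2 u f g 0 γ₁ γ₂ x y (t * Complex.I)
    have hA := Complex.sub_conj A
    have hB := Complex.add_conj B
    have hp : (Real.pi : ℂ) ≠ 0 := by exact_mod_cast Real.pi_ne_zero
    have hr : (Real.pi : ℂ) * q x y = B.re - A.im := by exact_mod_cast hrep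
    have hIne := Complex.I_ne_zero
    field_simp
    push_cast at hA hB
    linear_combination 2 * Complex.I * hr + hA - Complex.I * hB
  · simpa only [RayIntegrable, mul_one] using j1
  · rw [rayIntegral, rayIntegral]
    simp only [mul_one, one_mul]
    rw [hlo]; ring
  · simpa only [RayIntegrable, e5] using j1.conj
  · rw [rayIntegral, rayIntegral, ← setIntegral_congr_fun measurableSet_Ioi e6]
    simp only [e5]
    rw [integral_conj, integral_conj, hlo, hI]
    ring

/-! ### Potentials on the half line -/

section

variable {u v : ℝ → ℝ}

/-- Equality of the predicates, rather than an equivalence on solutions, makes the chosen functions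
literally equal. Hence `psi` and everything built on it depend only on `u` restricted to `[0, ∞)`.
-/
theorem isPsi_congr (h : EqOn u v (Ici 0)) (k : ℂ) : IsPsi u k = IsPsi v k := by
  have key : ∀ {u v : ℝ → ℝ}, EqOn u v (Ici 0) → ∀ χ, IsPsi u k χ → IsPsi v k χ :=
    fun h χ hχ => ⟨hχ.continuousOn, hχ.bounded, fun x hx => by
      rw [hχ.eqn x hx]
      congr 1
      exact setIntegral_congr_fun measurableSet_Ioi fun ξ hξ => by
        simp only [h (hx.trans (le_of_lt hξ) : (0 : ℝ) ≤ ξ)]⟩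
  exact funext fun χ => propext ⟨key h χ, key h.symm χ⟩

theorem isPhi_congr (h : EqOn u v (Ici 0)) (k : ℂ) : IsPhi u k = IsPhi v k := by
  have key : ∀ {u v : ℝ → ℝ}, EqOn u v (Ici 0) → ∀ χ, IsPhi u k χ → IsPhi v k χ :=
    fun h χ hχ => ⟨hχ.continuousOn, fun x hx => by
      rw [hχ.eqn x hx]
      congr 1
      refine intervalIntegral.integral_congr fun ξ hξ => ?_
      rw [uIcc_of_le hx] at hξ
      simp only [h (hξ.1 : (0 : ℝ) ≤ ξ)]⟩
  exact funext fun χ => propext ⟨key h χ, key h.symm χ⟩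

theorem psi_congr (h : EqOn u v (Ici 0)) : psi u = psi v := by
  funext x k
  unfold psi
  rw [isPsi_congr h k]

theorem phi_congr (h : EqOn u v (Ici 0)) : phi u = phi v := by
  funext x k
  unfold phi
  rw [isPhi_congr h k]

theorem specA_congr (h : EqOn u v (Ici 0)) : specA u = specA v := by
  funext k
  simp only [specA, psiX0, phiX0, psi_congr h, phi_congr h]

theorem specN_congr (h : EqOn u v (Ici 0)) : specN u = specN v := by
  funext f γ₁ k
  simp only [specN, specA_congr h, psi_congr h, phi_congr h]

theorem specF_congr (h : EqOn u v (Ici 0)) : specF u = specF v := by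
  funext f g β γ₁ γ₂ k
  simp only [specF, specH, specD, psiX0, psi_congr h]

/-- Extension of `u` by its value at 0 keeps it continuous on the whole line, and `1 + x ≤ 2 (1 +
x²)` reduces the first moment to the second. -/
theorem isPotential_max {u : ℝ → ℝ} (hu_cont : ContinuousOn u (Ici 0))
    (hu_decay : IntegrableOn (fun x : ℝ => (1 + x ^ 2) * |u x|) (Ioi 0)) :
    IsPotential fun x => u (max x 0) where
  cont := hu_cont.comp_continuous (by fun_prop) fun x => le_max_right x 0
  int := by
    have hc : ContinuousOn (fun x => (1 + x) * |u (max x 0)|) (Ioi 0) :=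
      ContinuousOn.mul (by fun_prop) (hu_cont.comp_continuous (by fun_prop)
        fun x => le_max_right x 0).abs.continuousOn
    refine Integrable.mono' (hu_decay.const_mul 2) (hc.aestronglyMeasurable measurableSet_Ioi) ?_
    filter_upwards [ae_restrict_mem measurableSet_Ioi] with x hx
    have hx' : 0 < x := hx
    rw [max_eq_left hx'.le, Real.norm_of_nonneg (by positivity), ← mul_assoc]
    exact mul_le_mul_of_nonneg_right (by nlinarith [sq_nonneg (x - 1), sq_nonneg x])
      (abs_nonneg _)

end

theorem proposition3p3 (u f g : ℝ → ℝ) (γ₁ γ₂ : ℝ) (q : ℝ → ℝ → ℝ)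
    (hu_cont : ContinuousOn u (Ici 0))
    (hu_decay : IntegrableOn (fun x : ℝ => (1 + x ^ 2) * |u x|) (Ioi 0))
    (ha : ∀ k : ℂ, 0 ≤ k.im → k ≠ 0 → specA u k ≠ 0)
    (hγ₁ : γ₁ < 0)
    (hq : IsPoincareSolution u f g 0 γ₁ γ₂ q)
    (hq_decay : HasDecay q) :
    ∀ x y : ℝ, 0 < x → 0 < y →
      -- all the integrals of the solution formula converge absolutely
      (RayIntegrable 1 (term1 u f γ₁ x y) ∧
        RayIntegrable Complex.I (term2 u f g 0 γ₁ γ₂ x y) ∧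
        RayIntegrable (-1) (term3 u f γ₁ x y) ∧
        RayIntegrable Complex.I (term4 u f g 0 γ₁ γ₂ x y)) ∧
      -- the solution formula
      (q x y : ℂ) =
        1 / (2 * Complex.I * Real.pi) *
          (-rayIntegral 1 (term1 u f γ₁ x y)
            + rayIntegral Complex.I (term2 u f g 0 γ₁ γ₂ x y))
        + 1 / (2 * Complex.I * Real.pi) *
          (-rayIntegral (-1) (term3 u f γ₁ x y)
            + rayIntegral Complex.I (term4 u f g 0 γ₁ γ₂ x y)) ∧
      -- the leftover term along the boundary of the first quadrant (from `+∞` to `0` to `i∞`)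
      (RayIntegrable 1 (leftover1 u γ₁ q x y) ∧
        RayIntegrable Complex.I (leftover1 u γ₁ q x y) ∧
        -rayIntegral 1 (leftover1 u γ₁ q x y)
          + rayIntegral Complex.I (leftover1 u γ₁ q x y) = 0) ∧
      -- the leftover term along the boundary of the second quadrant (from `-∞` to `0` to `i∞`)
      (RayIntegrable (-1) (leftover2 u γ₁ q x y) ∧
        RayIntegrable Complex.I (leftover2 u γ₁ q x y) ∧
        -rayIntegral (-1) (leftover2 u γ₁ q x y)
          + rayIntegral Complex.I (leftover2 u γ₁ q x y) = 0) := by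
  intro x y hx hy
  -- Every hypothesis and every integrand is insensitive to the values of `u` on the negative axis,
  -- so `u` may be replaced by this globally continuous extension.
  have hv : EqOn u (fun x => u (max x 0)) (Ici 0) := fun x hx => by
    simp only [max_eq_left (mem_Ici.1 hx)]
  have hq' : IsPoincareSolution (fun x => u (max x 0)) f g 0 γ₁ γ₂ q :=
    ⟨hq.contDiff_closed, hq.contDiff_open, fun x y hx hy => by
      simpa only [max_eq_left hx.le] using hq.pde x y hx hy, hq.bc_bottom, hq.bc_left⟩
  have h := (isPotential_max hu_cont hu_decay).representation (specA_congr hv ▸ ha) hγ₁ hq'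
    hq_decay hx hy
  have t1 : term1 u = term1 fun x => u (max x 0) := by
    funext f γ₁ x y k
    simp only [term1, specN_congr hv, psi_congr hv]
  have t2 : term2 u = term2 fun x => u (max x 0) := by
    funext f g β γ₁ γ₂ x y k
    simp only [term2, specF_congr hv, psi_congr hv]
  have t3 : term3 u = term3 fun x => u (max x 0) := by
    funext f γ₁ x y k
    simp only [term3, specN_congr hv, psi_congr hv]
  have t4 : term4 u = term4 fun x => u (max x 0) := by
    funext f g β γ₁ γ₂ x y k
    simp only [term4, specF_congr hv, psi_congr hv]
  have t5 : leftover1 u = leftover1 fun x => u (max x 0) := by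
    funext γ₁ q x y k
    simp only [leftover1, psi_congr hv]
  have t6 : leftover2 u = leftover2 fun x => u (max x 0) := by
    funext γ₁ q x y k
    simp only [leftover2, psi_congr hv]
  rw [t1, t2, t3, t4, t5, t6]
  exact h
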